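/- Let $p>2$, $f(x)=\frac12x^2-\frac1p|x|^p$, $z_{\max}=(p/2)^{1/(p-2)}$, and let $\varphi(x)=z_{\max}\,\mathrm{sech}^{2/(p-2)}\!\big(\tfrac{p-2}{2}x\big)$ be the real-line soliton. "Increasing", "decreasing" and "monotone" are meant in the strict sense. Put $$\ell_1^*=\frac{\pi}{\sqrt{p-2}},\qquad \ell_2^*(\theta)=\operatorname{arsinh}\!\Big(\frac{|\theta|}{\sqrt{1-\theta^2}}\Big)\quad(-1<\theta<0).$$ **(A) Overdetermined problem.** For $\theta\in\mathbb R$ and $\ell>0$ consider the functions $u:[0,\ell]\to(0,\infty)$ such that, for some $z\in(0,z_{\max})$, $$-u''+u=u^{p-1}\ \text{in }[0,\ell],\quad u(0)=z,\quad u'(0)=\theta\sqrt{2f(z)},\quad u'(\ell)=0.\qquad(*)$$ 1. $\theta=0$. (a) For every $\ell>0$, $u\equiv1$ is the only constant solution. (b) If $\ell\le\ell_1^*$, there is no monotone solution. (c) If $\ell>\ell_1^*$, there is a unique increasing solution, with $z\in(0,1)$, and a unique decreasing solution, with $z>1$. 2. $\theta\in(0,1)$. For every $\ell>0$ there is a unique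 monotone solution; it is increasing. 3. $\theta\in(-1,0)$. If $\ell\le\ell_2^*(\theta)$, there is no monotone solution. If $\ell>\ell_2^*(\theta)$, there is a unique monotone solution; it is decreasing. 4. $\theta=1$. For every $\ell>0$ there is a unique solution; it is increasing and a portion of the soliton, $u=\varphi(\cdot+a)$ on $[0,\ell]$ for some $a\in\mathbb R$. 5. $\theta\le-1$. There is no solution for any $\ell>0$. 6. $\theta>1$. For every $\ell>0$ there is an increasing solution. (a) If $\theta\le2$, then for every $\ell>0$ there is a unique solution, and it is increasing. **(B) Bound-states on graphs.** Let $\mathcal G$ be a regular single-knot metric graph of length $\ell>0$: $H\ge1$ half-lines, $P\ge 0$ pendants of length $\ell$ and $L\ge 0$ loops of length $2\ell$, all attached at one vertex $\mathbf 0$, with $P+L\ge1$. Each edge is parametrized from $\mathbf 0$, which sits at $x=0$. A function belongs to $H^1(\mathcal G)$ if it is continuous on $\mathcal G$ and $H^1$ on every edge; a bound-state is a nontrivial $u\in H^1(\mathcal G)$ with $\int_{\mathcal G}u'\eta'+u\eta-|u|^{p-2}u\eta=0$ for all $\eta\in H^1(\mathcal G)$. After putting a dummy vertex at the mid-point of each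 loop, all $P+2L$ compact edges are copies of $[0,\ell]$ parametrized from $\mathbf 0$; $u$ is core-symmetric if its restrictions to all compact edges coincide, core-increasing (core-decreasing) if these restrictions are increasing (decreasing) on $[0,\ell]$, and core-monotone if it is one of the two. The incidence index of $u$ is $\theta=(H^+-H^-)/(P+2L)$, where $H^+$ (resp. $H^-$) is the number of half-lines on which $u=\varphi(\cdot+y)$ (resp. $u=\varphi(\cdot-y)$) for some $y>0$. Let $\theta=(a-b)/(P+2L)$ with integers $a,b\ge0$, $a+b=H$. In what follows "solution" means a positive core-symmetric bound-state on $\mathcal G$ with incidence index $\theta$, and uniqueness is understood up to permutations of the half-lines. 1. $\theta=0$. (a) There is a unique solution that is constant on each compact edge. (b) If $\ell\le\ell_1^*$, there is no core-monotone solution. (c) If $\ell>\ell_1^*$, there is a unique core-increasing solution and a unique core-decreasing solution. 2. $\theta\in(0,1)$. There is a unique core-monotone solution; it is core-increasing. 3. $\theta\in(-1,0)$. If $\ell\le\ell_2^*(\theta)$, there is no core-monotone solution. If $\ell>\ell_2^*(\theta)$, there is a unique core-monotone solution; it is core-decreasing. 4. $\theta=1$. There is a unique solution; it is core-increasing. 5.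 $\theta\le-1$. There is no solution. 6. $\theta>1$. There is a core-monotone solution. (a) If $\theta\le2$, there is a unique core-monotone solution, and it is core-increasing. **(C) Multiplicity.** There is $\theta^*>2$, depending only on $p$, such that for every $\theta>\theta^*$ there are $0<\ell_1(\theta)<\ell_2(\theta)$ (depending only on $p$ and $\theta$) with the following properties. For every $\ell\in[\ell_1(\theta),\ell_2(\theta)]$, problem $(*)$ has at least two distinct increasing solutions. On every regular single-knot graph with $P+L\ge1$ and length $\ell\in[\ell_1(\theta),\ell_2(\theta)]$ for which $\theta=(a-b)/(P+2L)$ with integers $a,b\ge0$, $a+b=H$, there are at least two core-increasing positive core-symmetric bound-states of incidence index $\theta$ that are not related by a permutation of the half-lines. -/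

import Mathlib

open Set MeasureTheory
open scoped ContDiff

noncomputable section

/-! ### The nonlinearity, the soliton and the phase-plane potential -/

/-- The potential `f(x) = x² / 2 - |x|^p / p`. -/
def potential (p x : ℝ) : ℝ := x ^ 2 / 2 - |x| ^ p / p

/-- The maximal value `(p / 2)^(1 / (p - 2))` of the soliton. -/
def solitonMax (p : ℝ) : ℝ := (p / 2) ^ (1 / (p - 2))

/-- The real-line soliton `φ(x) = (p/2)^(1/(p-2)) sech^(2/(p-2)) ((p-2) x / 2)`. -/
def soliton (p x : ℝ) : ℝ :=
  solitonMax p * (1 / Real.cosh ((p - 2) / 2 * x)) ^ (2 / (p - 2))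

/-! ### The overdetermined problem on `[0, ℓ]` -/

/-- `u` is a (classical) positive solution on `[0, ℓ]` of `-u'' + u = u^(p-1)` with
`u(0) = z ∈ (0, (p/2)^(1/(p-2)))`, `u'(0) = θ √(2 f(z))` and `u'(ℓ) = 0`. The number `z` is
not a separate datum: it is `u 0`. The function `v` is the derivative of `u` (one-sided at the
two end-points). -/
def IsODESolution (p θ ℓ : ℝ) (u : ℝ → ℝ) : Prop :=
  ∃ v : ℝ → ℝ,
    (∀ x ∈ Icc 0 ℓ, HasDerivWithinAt u (v x) (Icc 0 ℓ) x) ∧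
    (∀ x ∈ Icc 0 ℓ, HasDerivWithinAt v (u x - u x ^ (p - 1)) (Icc 0 ℓ) x) ∧
    u 0 ∈ Ioo 0 (solitonMax p) ∧
    v 0 = θ * √(2 * potential p (u 0)) ∧
    v ℓ = 0 ∧
    ∀ x ∈ Icc 0 ℓ, 0 < u x

/-- `u` is increasing or decreasing on `[0, ℓ]` (in the strict sense). -/
def IsMonotoneOn (ℓ : ℝ) (u : ℝ → ℝ) : Prop :=
  StrictMonoOn u (Icc 0 ℓ) ∨ StrictAntiOn u (Icc 0 ℓ)

/-- There is exactly one function on `[0, ℓ]` with the property `Q`, and it also satisfies `R`. -/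
def ExistsUniqueOn (ℓ : ℝ) (Q R : (ℝ → ℝ) → Prop) : Prop :=
  ∃ u, Q u ∧ R u ∧ ∀ w, Q w → EqOn w u (Icc 0 ℓ)

/-! ### Regular single-knot metric graphs -/

/-- A regular single-knot metric graph of length `ℓ`: `H ≥ 1` half-lines, `P` pendants of length
`ℓ` and `L` loops of length `2ℓ`, all attached at one vertex. -/
structure RegularSingleKnot where
  H : ℕ
  P : ℕ
  L : ℕ
  ℓ : ℝ
  one_le_H : 1 ≤ H
  ℓ_pos : 0 < ℓ

namespace RegularSingleKnot

variable (G : RegularSingleKnot)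

/-- The edges: half-lines, pendants and loops. -/
abbrev Edge : Type := Fin G.H ⊕ Fin G.P ⊕ Fin G.L

/-- The edge associated with a half-line. -/
abbrev halfLine (h : Fin G.H) : G.Edge := Sum.inl h
/-- The edge associated with a pendant. -/
abbrev pendant (i : Fin G.P) : G.Edge := Sum.inr (Sum.inl i)
/-- The edge associated with a loop. -/
abbrev loop (j : Fin G.L) : G.Edge := Sum.inr (Sum.inr j)

/-- The closed interval with which an edge is identified. The common vertex corresponds to the
coordinate `0` on every edge, and also to the coordinate `2ℓ` on the loops. -/
def dom : G.Edge → Set ℝ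
  | Sum.inl _ => Ici 0
  | Sum.inr (Sum.inl _) => Icc 0 G.ℓ
  | Sum.inr (Sum.inr _) => Icc 0 (2 * G.ℓ)

/-- The interior of an edge. -/
def openDom : G.Edge → Set ℝ
  | Sum.inl _ => Ioi 0
  | Sum.inr (Sum.inl _) => Ioo 0 G.ℓ
  | Sum.inr (Sum.inr _) => Ioo 0 (2 * G.ℓ)

/-- Real functions on the graph, edge by edge; only the values `u e x` with `x ∈ G.dom e` are
meaningful. -/
abbrev Fun : Type := G.Edge → ℝ → ℝ

/-- `u` is a continuous function on the graph. -/
def IsContinuous (u : G.Fun) : Prop :=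
  (∀ e, ContinuousOn (u e) (G.dom e)) ∧
  ∃ c : ℝ, (∀ e, u e 0 = c) ∧ ∀ j, u (G.loop j) (2 * G.ℓ) = c

end RegularSingleKnot

/-- `g` is the weak derivative of `u` on the open set `I` of the real line. -/
def IsWeakDerivOn (I : Set ℝ) (u g : ℝ → ℝ) : Prop :=
  ∀ χ : ℝ → ℝ, ContDiff ℝ ∞ χ → HasCompactSupport χ → tsupport χ ⊆ I →
    ∫ x in I, u x * deriv χ x = -∫ x in I, g x * χ x

namespace RegularSingleKnot

variable (G : RegularSingleKnot)

/-- `du` is, on every edge, a square-integrable weak derivative of `u`. -/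
def IsWeakGradient (u du : G.Fun) : Prop :=
  ∀ e, MemLp (du e) 2 (volume.restrict (G.openDom e)) ∧ IsWeakDerivOn (G.openDom e) (u e) (du e)

/-- The space `H¹(G)`: continuous functions on the graph that are `H¹` on every edge. -/
def MemH1 (u : G.Fun) : Prop :=
  G.IsContinuous u ∧ (∀ e, MemLp (u e) 2 (volume.restrict (G.openDom e))) ∧
    ∃ du, G.IsWeakGradient u du

/-- `u` is a bound-state: a nontrivial weak solution `u ∈ H¹(G)` of `-u'' + u = |u|^(p-2) u`,
that is, `∫_G u' η' + u η - |u|^(p-2) u η = 0` for all `η ∈ H¹(G)`. -/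
def IsBoundState (p : ℝ) (u : G.Fun) : Prop :=
  G.MemH1 u ∧ (∃ e, ∃ x ∈ G.dom e, u e x ≠ 0) ∧
  ∃ du, G.IsWeakGradient u du ∧
    ∀ η dη, G.MemH1 η → G.IsWeakGradient η dη →
      ∑ e, ∫ x in G.openDom e,
        (du e x * dη e x + u e x * η e x - |u e x| ^ (p - 2) * u e x * η e x) = 0

/-- `u > 0` on the whole graph. -/
def IsPositive (u : G.Fun) : Prop := ∀ e, ∀ x ∈ G.dom e, 0 < u e x

/-- The compact edges after a dummy vertex has been put at the mid-point of each loop: the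
pendants, and two halves for each loop. -/
abbrev CoreEdge : Type := Fin G.P ⊕ Fin G.L ⊕ Fin G.L

/-- The restriction of `u` to a compact edge, as a function on `[0, ℓ]`, with the common vertex
at the coordinate `0` (so the second half of a loop is run backwards). -/
def coreRestrict (u : G.Fun) : G.CoreEdge → ℝ → ℝ
  | Sum.inl i => u (G.pendant i)
  | Sum.inr (Sum.inl j) => u (G.loop j)
  | Sum.inr (Sum.inr j) => fun x => u (G.loop j) (2 * G.ℓ - x)

/-- Core-symmetric: all restrictions to compact edges coincide. -/
def IsCoreSymmetric (u : G.Fun) : Prop :=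
  ∀ κ₁ κ₂, EqOn (G.coreRestrict u κ₁) (G.coreRestrict u κ₂) (Icc 0 G.ℓ)

/-- Core-increasing: increasing, away from the common vertex, on each compact edge. -/
def IsCoreIncreasing (u : G.Fun) : Prop :=
  ∀ κ, StrictMonoOn (G.coreRestrict u κ) (Icc 0 G.ℓ)

/-- Core-decreasing: decreasing, away from the common vertex, on each compact edge. -/
def IsCoreDecreasing (u : G.Fun) : Prop :=
  ∀ κ, StrictAntiOn (G.coreRestrict u κ) (Icc 0 G.ℓ)

/-- Core-monotone: core-increasing or core-decreasing. -/
def IsCoreMonotone (u : G.Fun) : Prop := G.IsCoreIncreasing u ∨ G.IsCoreDecreasing u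

/-- `u` is constant on each compact edge. -/
def IsCoreConstant (u : G.Fun) : Prop :=
  ∀ κ, ∀ x ∈ Icc 0 G.ℓ, G.coreRestrict u κ x = G.coreRestrict u κ 0

/-- `H⁺`: the number of half-lines on which `u = φ(· + y)` for some `y > 0`. On a continuous `u`
the value of `y` is the same for all these half-lines and for those counted by `numMinus`,
as `φ(y) = φ(-y)` is the value of `u` at the common vertex. -/
def numPlus (p : ℝ) (u : G.Fun) : ℕ :=
  {h : Fin G.H | ∃ y > 0, ∀ x ∈ Ici (0 : ℝ), u (G.halfLine h) x = soliton p (x + y)}.ncard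

/-- `H⁻`: the number of half-lines on which `u = φ(· - y)` for some `y > 0`. -/
def numMinus (p : ℝ) (u : G.Fun) : ℕ :=
  {h : Fin G.H | ∃ y > 0, ∀ x ∈ Ici (0 : ℝ), u (G.halfLine h) x = soliton p (x - y)}.ncard

/-- The incidence index `θ = (H⁺ - H⁻) / (P + 2 L)` of `u`. -/
def incidenceIndex (p : ℝ) (u : G.Fun) : ℝ :=
  ((G.numPlus p u : ℝ) - (G.numMinus p u : ℝ)) / ((G.P : ℝ) + 2 * (G.L : ℝ))

/-- `θ` is a possible incidence index on `G`: `θ = (H⁺ - H⁻) / (P + 2 L)` for natural numbers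
`H⁺`, `H⁻` with `H⁺ + H⁻ = H`. -/
def IsAdmissible (θ : ℝ) : Prop :=
  ∃ a b : ℕ, a + b = G.H ∧ θ = ((a : ℝ) - (b : ℝ)) / ((G.P : ℝ) + 2 * (G.L : ℝ))

/-- `u` is a positive core-symmetric bound-state with incidence index `θ`. -/
def IsSolution (p θ : ℝ) (u : G.Fun) : Prop :=
  G.IsBoundState p u ∧ G.IsPositive u ∧ G.IsCoreSymmetric u ∧ G.incidenceIndex p u = θ

/-- `u` and `w` are the same function on the graph up to a permutation of the half-lines. -/
def EqUpToPerm (u w : G.Fun) : Prop :=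
  ∃ σ : Equiv.Perm (Fin G.H),
    (∀ h, EqOn (u (G.halfLine h)) (w (G.halfLine (σ h))) (Ici 0)) ∧
    (∀ i, EqOn (u (G.pendant i)) (w (G.pendant i)) (Icc 0 G.ℓ)) ∧
    (∀ j, EqOn (u (G.loop j)) (w (G.loop j)) (Icc 0 (2 * G.ℓ)))

/-- Up to a permutation of the half-lines there is exactly one function on `G` with the property
`Q`, and it also satisfies `R`. -/
def ExistsUniqueUpToPerm (Q R : G.Fun → Prop) : Prop :=
  ∃ u, Q u ∧ R u ∧ ∀ w, Q w → G.EqUpToPerm w u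

end RegularSingleKnot

end

/-! Along `u'' = u - u^(p-1)` the energy `u'² - 2 f(u)` is conserved, and `f` increases on `[0, 1]`
and decreases on `[1, ∞)`. A solution that leaves `z` with slope `θ √(2 f(z))` can therefore come to
rest only at a level `m` with `f(m) = (1 - θ²) f(z)`. Monotone solutions are single arcs: a right
arc (rising to rest) for `θ > 0`, a reversed left arc (rising from rest) for `-1 < θ < 0`, an arc
from rest to rest for `θ = 0`. For `θ ≠ 0` an arc is determined by `z`. So existence for a given `ℓ`
is a question about the range of the length as a function of `z`, and uniqueness follows from its
strict monotonicity. The cases `θ = 1` and `θ ≤ -1` need the energy only.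

Monotonicity rests on four comparisons. (i) The half-period grows with the orbit
(`IsRestArc.time_lt`): in the coordinate `boxCox ((4 - p) / 3) u`, normalised to `[0, 1]`, the
squared speed solves a linear second-order equation whose coefficient depends on the ratio of the
end-points only, and a maximum principle compares two orbits. (ii) A Wronskian argument
(`rightArc_time_lt`) compares right arcs whose energies are ordered favourably. (iii) A Wronskian
together with the decrease of `x f'(x) / f(x)` (`leftArc_time_lt`) compares left arcs below `1`.
(iv) For `1 < θ ≤ 2` and `z ≥ 1`, log-concavity of `x^(p-1) - x` and `θ² - 1 ≤ 3` give
`outerArc_time_lt`. For `0 < θ < 1` a left arc followed by a right arc is an arc from rest to rest,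
so the missing cases are differences of (i) and of a known one.

The ranges come from explicit model curves: cosines give the threshold `π / √(p - 2)`, hyperbolic
cosines give `arsinh (|θ| / √(1 - θ²))`, and exponential or linear bounds give the limits `0` and
`∞`. The lengths are continuous because `exists_arc` builds the arcs by a regularised quadrature.

For large `θ` the length is not monotone: it is small at `z = 1`, but bounded below where `(θ² - 1)
f(z) = f(1)`, while it tends to `∞` at `z = 0` and to `0` at `z = solitonMax p`. The intermediate
value theorem on two disjoint intervals gives two solutions.

On a graph, a positive weak solution is classical edge by edge (du Bois-Reymond), every half-line
carries a translated soliton, and the balance of derivatives at the knot says exactly that the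
common slope on the core is `θ √(2 f(z))`. Symmetry of the two halves of a loop, or the free end of
a pendant, gives `u'(ℓ) = 0`. Core-symmetric bound-states of index `θ` thus correspond, up to
permutation of the half-lines, to solutions on `[0, ℓ]` (`IsSolution.exists_shift`,
`exists_isSolution`, `IsSolution.eqUpToPerm`). -/

noncomputable section

open Filter Topology

/-! ### The potential -/

section Potential

variable {p x : ℝ}

/-- Evenness allows left arcs to be obtained from the general arc construction by the reflection `u
↦ -u`. -/
lemma potential_neg (p x : ℝ) : potential p (-x) = potential p x := by
  simp [potential]

lemma potential_of_nonneg (hx : 0 ≤ x) : potential p x = x ^ 2 / 2 - x ^ p / p := by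
  rw [potential, abs_of_nonneg hx]

lemma rpow_sub_one_eq (hx : 0 < x) : x ^ (p - 1) = x ^ (p - 2) * x := by
  rw [show p - 1 = p - 2 + 1 by ring, Real.rpow_add_one hx.ne']

lemma rpow_eq_mul_sq (hx : 0 < x) : x ^ p = x ^ (p - 2) * x ^ 2 := by
  rw [← Real.rpow_natCast x 2, ← Real.rpow_add hx]
  norm_num

lemma potential_eq (hx : 0 < x) : potential p x = x ^ 2 * (1 / 2 - x ^ (p - 2) / p) := by
  rw [potential_of_nonneg hx.le, rpow_eq_mul_sq hx]
  ring

lemma hasDerivAt_potential (hp : 2 < p) (x : ℝ) :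
    HasDerivAt (potential p) (x - |x| ^ (p - 2) * x) x := by
  have h := ((hasDerivAt_pow 2 x).div_const 2).sub
    ((hasDerivAt_abs_rpow x (by linarith : 1 < p)).div_const p)
  refine h.congr_deriv ?_
  have : p ≠ 0 := by linarith
  field_simp
  norm_num
  ring

lemma hasDerivAt_potential_of_pos (hp : 2 < p) (hx : 0 < x) :
    HasDerivAt (potential p) (x - x ^ (p - 1)) x := by
  have h := hasDerivAt_potential hp x
  rwa [abs_of_pos hx, ← rpow_sub_one_eq hx] at h

lemma continuous_potential (hp : 2 < p) : Continuous (potential p) :=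
  continuous_iff_continuousAt.2 fun x => (hasDerivAt_potential hp x).continuousAt

lemma rpow_lt_self (hp : 2 < p) (hx : 0 < x) (hx1 : x < 1) : x ^ (p - 1) < x := by
  have := Real.rpow_lt_rpow_of_exponent_gt hx hx1 (show (1 : ℝ) < p - 1 by linarith)
  rwa [Real.rpow_one] at this

lemma self_lt_rpow (hp : 2 < p) (hx1 : 1 < x) : x < x ^ (p - 1) := by
  have := Real.rpow_lt_rpow_of_exponent_lt hx1 (show (1 : ℝ) < p - 1 by linarith)
  rwa [Real.rpow_one] at this

lemma strictMonoOn_potential (hp : 2 < p) : StrictMonoOn (potential p) (Icc 0 1) := by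
  refine strictMonoOn_of_hasDerivWithinAt_pos (f' := fun x => x - x ^ (p - 1)) (convex_Icc 0 1)
    (continuous_potential hp).continuousOn (fun x hx => ?_) (fun x hx => ?_)
  all_goals rw [interior_Icc] at hx
  · exact (hasDerivAt_potential_of_pos hp hx.1).hasDerivWithinAt
  · exact sub_pos.2 (rpow_lt_self hp hx.1 hx.2)

lemma strictAntiOn_potential (hp : 2 < p) : StrictAntiOn (potential p) (Ici 1) := by
  refine strictAntiOn_of_hasDerivWithinAt_neg (f' := fun x => x - x ^ (p - 1)) (convex_Ici 1)
    (continuous_potential hp).continuousOn (fun x hx => ?_) (fun x hx => ?_)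
  all_goals rw [interior_Ici, mem_Ioi] at hx
  · exact (hasDerivAt_potential_of_pos hp (by linarith)).hasDerivWithinAt
  · exact sub_neg.2 (self_lt_rpow hp hx)

lemma potential_zero (hp : 2 < p) : potential p 0 = 0 := by
  simp [potential, Real.zero_rpow (by linarith : p ≠ 0)]

lemma potential_one_pos (hp : 2 < p) : 0 < potential p 1 := by
  rw [← potential_zero hp]
  exact strictMonoOn_potential hp (by simp) (by simp) one_pos

lemma potential_lt_potential_one (hp : 2 < p) (hx : 0 ≤ x) (hx1 : x ≠ 1) :
    potential p x < potential p 1 := by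
  rcases lt_or_gt_of_ne hx1 with h | h
  · exact strictMonoOn_potential hp ⟨hx, h.le⟩ (by simp) h
  · exact strictAntiOn_potential hp (by simp) h.le h

lemma potential_le_potential_one (hp : 2 < p) (hx : 0 ≤ x) : potential p x ≤ potential p 1 := by
  rcases eq_or_ne x 1 with rfl | h
  · rfl
  · exact (potential_lt_potential_one hp hx h).le

lemma one_lt_solitonMax (hp : 2 < p) : 1 < solitonMax p :=
  Real.one_lt_rpow (by linarith) (by have : 0 < p - 2 := by linarith
                                     positivity)

lemma solitonMax_pos (hp : 2 < p) : 0 < solitonMax p := one_pos.trans (one_lt_solitonMax hp)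

lemma solitonMax_rpow (hp : 2 < p) : solitonMax p ^ (p - 2) = p / 2 := by
  have : p - 2 ≠ 0 := by linarith
  rw [solitonMax, ← Real.rpow_mul (by linarith), one_div, inv_mul_cancel₀ this, Real.rpow_one]

lemma potential_solitonMax (hp : 2 < p) : potential p (solitonMax p) = 0 := by
  have : p ≠ 0 := by linarith
  rw [potential_eq (solitonMax_pos hp), solitonMax_rpow hp]
  field_simp
  ring

lemma potential_pos (hp : 2 < p) (hx : x ∈ Ioo 0 (solitonMax p)) : 0 < potential p x := by
  rcases le_total x 1 with h | h
  · rw [← potential_zero hp]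
    exact strictMonoOn_potential hp (by simp) ⟨hx.1.le, h⟩ hx.1
  · rw [← potential_solitonMax hp]
    exact strictAntiOn_potential hp h (one_lt_solitonMax hp).le hx.2

lemma potential_nonpos (hp : 2 < p) (hx : solitonMax p ≤ x) : potential p x ≤ 0 := by
  rw [← potential_solitonMax hp]
  exact (strictAntiOn_potential hp).antitoneOn (one_lt_solitonMax hp).le
    ((one_lt_solitonMax hp).le.trans hx) hx

lemma lt_solitonMax_of_potential_pos (hp : 2 < p) (h : 0 < potential p x) : x < solitonMax p :=
  lt_of_not_ge fun h' => (potential_nonpos hp h').not_gt h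

lemma tendsto_potential_atTop (hp : 2 < p) : Tendsto (potential p) atTop atBot := by
  have h1 : Tendsto (fun x : ℝ => x ^ 2 * (1 / 2 - x ^ (p - 2) / p)) atTop atBot := by
    refine (tendsto_pow_atTop two_ne_zero).atTop_mul_atBot₀ ?_
    refine tendsto_atBot_add_const_left _ (1 / 2) (tendsto_neg_atTop_atBot.comp ?_)
    exact (tendsto_rpow_atTop (by linarith)).atTop_div_const (by linarith)
  refine h1.congr' ?_
  filter_upwards [eventually_gt_atTop 0] with x hx using (potential_eq hx).symm

end Potential

/-! ### The two branches of the inverse of the potential -/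

section Roots

variable {p : ℝ}

lemma exists_continuous_rightInverse {g : ℝ → ℝ} (hg : StrictMono g) (hs : g.Surjective) :
    ∃ r : ℝ → ℝ, Continuous r ∧ ∀ c, g (r c) = c :=
  ⟨(hg.orderIsoOfSurjective g hs).symm, (hg.orderIsoOfSurjective g hs).symm.continuous,
    fun c => (hg.orderIsoOfSurjective g hs).apply_symm_apply c⟩

/-- Continuing `-f` to the left of `1` by an affine function of slope `1` gives an increasing
bijection of `ℝ`. Its inverse is continuous everywhere, so no domain has to be carried along. The
same device serves in `exists_leftRoot` and `exists_inverse_of_strictMonoOn`. -/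
lemma exists_rightRoot (hp : 2 < p) : ∃ r : ℝ → ℝ, Continuous r ∧
    ∀ c ≤ potential p 1, 1 ≤ r c ∧ potential p (r c) = c := by
  have hf := strictAntiOn_potential hp
  have hc := continuous_potential hp
  obtain ⟨r, hr, hr'⟩ := exists_continuous_rightInverse
    (g := fun x => -(potential p (max x 1) + (max x 1 - x))) (fun x y hxy => by
      show -(potential p (max x 1) + (max x 1 - x)) < -(potential p (max y 1) + (max y 1 - y))
      rcases le_total y 1 with h | h
      · rw [max_eq_right h, max_eq_right (hxy.le.trans h)]
        linarith
      · rw [max_eq_left h]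
        rcases le_total x 1 with h' | h'
        · rw [max_eq_right h']
          rcases h.eq_or_lt with rfl | h''
          · linarith
          · have := hf (by simp) h h''
            linarith
        · have := hf h' h hxy
          rw [max_eq_left h']
          linarith) (by
      refine Continuous.surjective (by fun_prop) ?_ ?_
      · refine (tendsto_neg_atBot_atTop.comp (tendsto_potential_atTop hp)).congr' ?_
        filter_upwards [eventually_ge_atTop 1] with x hx
        simp [max_eq_left hx]
      · have : Tendsto (fun x : ℝ => x - (1 + potential p 1)) atBot atBot :=
          tendsto_atBot_add_const_right _ _ tendsto_id
        refine this.congr' ?_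
        filter_upwards [eventually_le_atBot 1] with x hx
        simp only [max_eq_right hx]
        ring)
  refine ⟨fun c => r (-c), hr.comp continuous_neg, fun c hcl => ?_⟩
  have h := hr' (-c)
  simp only [neg_inj] at h
  have h1 : 1 ≤ r (-c) := by
    by_contra! h1
    rw [max_eq_right h1.le] at h
    linarith
  rw [max_eq_left h1] at h
  exact ⟨h1, by linarith⟩

lemma exists_leftRoot (hp : 2 < p) : ∃ r : ℝ → ℝ, Continuous r ∧
    ∀ c, 0 ≤ c → c ≤ potential p 1 → 0 ≤ r c ∧ r c ≤ 1 ∧ potential p (r c) = c := by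
  have hf := strictMonoOn_potential hp
  have hc := continuous_potential hp
  have h0 := potential_zero hp
  have hcl : ∀ x : ℝ, max 0 (min x 1) ∈ Icc (0 : ℝ) 1 := fun x =>
    ⟨le_max_left _ _, max_le zero_le_one (min_le_right _ _)⟩
  obtain ⟨r, hr, hr'⟩ := exists_continuous_rightInverse
    (g := fun x => potential p (max 0 (min x 1)) + (x - max 0 (min x 1))) (fun x y hxy => by
      show potential p (max 0 (min x 1)) + (x - max 0 (min x 1)) <
        potential p (max 0 (min y 1)) + (y - max 0 (min y 1))
      have h1 : max 0 (min x 1) ≤ max 0 (min y 1) :=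
        max_le_max le_rfl (min_le_min hxy.le le_rfl)
      rcases h1.eq_or_lt with h | h
      · rw [h]
        linarith
      · have h2 := hf (hcl x) (hcl y) h
        -- Clamping to `[0, 1]` is nonexpansive.
        have h3 : x - max 0 (min x 1) ≤ y - max 0 (min y 1) := by
          rcases le_total x 1 with hx | hx <;> rcases le_total y 1 with hy | hy <;>
          rcases le_total 0 x with hx' | hx' <;> rcases le_total 0 y with hy' | hy' <;>
          simp [*] at h ⊢ <;> linarith
        linarith) (by
      refine Continuous.surjective (by fun_prop) ?_ ?_
      · have : Tendsto (fun x : ℝ => x + (potential p 1 - 1)) atTop atTop :=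
          tendsto_atTop_add_const_right _ _ tendsto_id
        refine this.congr' ?_
        filter_upwards [eventually_ge_atTop 1] with x hx
        simp only [min_eq_right hx, max_eq_right zero_le_one]
        ring
      · refine (tendsto_id (α := ℝ)).congr' ?_
        filter_upwards [eventually_le_atBot 0] with x hx
        simp [min_eq_left (hx.trans zero_le_one), max_eq_left hx, h0])
  refine ⟨r, hr, fun c hc0 hc1 => ?_⟩
  have h := hr' c
  have h1 : 0 ≤ r c := by
    by_contra! h1
    simp only [min_eq_left (h1.le.trans zero_le_one), max_eq_left h1.le, h0] at h
    linarith
  have h2 : r c ≤ 1 := by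
    by_contra! h2
    simp only [min_eq_right h2.le, max_eq_right zero_le_one] at h
    linarith
  simp only [min_eq_left h2, max_eq_right h1] at h
  exact ⟨h1, h2, by linarith⟩

/-- The inverse of the potential on `[1, ∞)`. -/
def rightRoot (p : ℝ) : ℝ → ℝ :=
  open Classical in if h : 2 < p then (exists_rightRoot h).choose else id

/-- The inverse of the potential on `[0, 1]`. -/
def leftRoot (p : ℝ) : ℝ → ℝ :=
  open Classical in if h : 2 < p then (exists_leftRoot h).choose else id

variable {c : ℝ}

lemma continuous_rightRoot (hp : 2 < p) : Continuous (rightRoot p) := by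
  rw [rightRoot, dif_pos hp]
  exact (exists_rightRoot hp).choose_spec.1

lemma continuous_leftRoot (hp : 2 < p) : Continuous (leftRoot p) := by
  rw [leftRoot, dif_pos hp]
  exact (exists_leftRoot hp).choose_spec.1

lemma one_le_rightRoot (hp : 2 < p) (hc : c ≤ potential p 1) : 1 ≤ rightRoot p c := by
  rw [rightRoot, dif_pos hp]
  exact ((exists_rightRoot hp).choose_spec.2 c hc).1

lemma potential_rightRoot (hp : 2 < p) (hc : c ≤ potential p 1) :
    potential p (rightRoot p c) = c := by
  rw [rightRoot, dif_pos hp]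
  exact ((exists_rightRoot hp).choose_spec.2 c hc).2

lemma one_lt_rightRoot (hp : 2 < p) (hc : c < potential p 1) : 1 < rightRoot p c := by
  refine lt_of_le_of_ne (one_le_rightRoot hp hc.le) fun h => ?_
  have := potential_rightRoot hp hc.le
  rw [← h] at this
  exact hc.ne' this

lemma leftRoot_nonneg (hp : 2 < p) (h0 : 0 ≤ c) (hc : c ≤ potential p 1) : 0 ≤ leftRoot p c := by
  rw [leftRoot, dif_pos hp]
  exact ((exists_leftRoot hp).choose_spec.2 c h0 hc).1

lemma leftRoot_le_one (hp : 2 < p) (h0 : 0 ≤ c) (hc : c ≤ potential p 1) : leftRoot p c ≤ 1 := by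
  rw [leftRoot, dif_pos hp]
  exact ((exists_leftRoot hp).choose_spec.2 c h0 hc).2.1

lemma potential_leftRoot (hp : 2 < p) (h0 : 0 ≤ c) (hc : c ≤ potential p 1) :
    potential p (leftRoot p c) = c := by
  rw [leftRoot, dif_pos hp]
  exact ((exists_leftRoot hp).choose_spec.2 c h0 hc).2.2

lemma leftRoot_pos (hp : 2 < p) (h0 : 0 < c) (hc : c ≤ potential p 1) : 0 < leftRoot p c := by
  refine lt_of_le_of_ne (leftRoot_nonneg hp h0.le hc) fun h => ?_
  have := potential_leftRoot hp h0.le hc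
  rw [← h, potential_zero hp] at this
  exact h0.ne this

lemma leftRoot_lt_one (hp : 2 < p) (h0 : 0 ≤ c) (hc : c < potential p 1) : leftRoot p c < 1 := by
  refine lt_of_le_of_ne (leftRoot_le_one hp h0 hc.le) fun h => ?_
  have := potential_leftRoot hp h0 hc.le
  rw [h] at this
  exact hc.ne' this

end Roots

/-! ### Positive trajectories of `u'' = u - u^(p-1)` -/

/-- `(u, v)` is a positive trajectory on `[0, ℓ]` of `u' = v`, `v' = u - u^(p-1)`. -/
structure IsTraj (p ℓ : ℝ) (u v : ℝ → ℝ) : Prop where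
  hu : ∀ x ∈ Icc 0 ℓ, HasDerivWithinAt u (v x) (Icc 0 ℓ) x
  hv : ∀ x ∈ Icc 0 ℓ, HasDerivWithinAt v (u x - u x ^ (p - 1)) (Icc 0 ℓ) x
  pos : ∀ x ∈ Icc 0 ℓ, 0 < u x

/-! ### One-sided derivatives on compact intervals. -/

section Calculus

variable {f : ℝ → ℝ} {f' a b x : ℝ}

lemma HasDerivWithinAt.Ici_of_Icc (h : HasDerivWithinAt f f' (Icc a b) x) (hx : x ∈ Ico a b) :
    HasDerivWithinAt f f' (Ici x) x :=
  h.mono_of_mem_nhdsWithin (Icc_mem_nhdsGE_of_mem hx)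

lemma HasDerivWithinAt.hasDerivAt_of_Icc (h : HasDerivWithinAt f f' (Icc a b) x)
    (hx : x ∈ Ioo a b) : HasDerivAt f f' x :=
  h.hasDerivAt (Icc_mem_nhds hx.1 hx.2)

/-- A function on `[a, b]` that is positive at `a` and has positive derivative at its zeros is
positive. -/
lemma pos_of_deriv_pos_at_zeros {D D' : ℝ → ℝ}
    (hD : ∀ x ∈ Icc a b, HasDerivWithinAt D (D' x) (Icc a b) x) (ha : 0 < D a)
    (h0 : ∀ x ∈ Icc a b, D x = 0 → 0 < D' x) : ∀ x ∈ Icc a b, 0 < D x := by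
  have hc : ContinuousOn D (Icc a b) := fun x hx => (hD x hx).continuousWithinAt
  have hnn : ∀ x ∈ Icc a b, 0 ≤ D x := by
    refine image_le_of_deriv_right_lt_deriv_boundary' (f' := fun _ => 0) continuousOn_const
      (fun x _ => hasDerivWithinAt_const _ _ _) ha.le hc
      (fun x hx => (hD x (Ico_subset_Icc_self hx)).Ici_of_Icc hx) ?_
    exact fun x hx h => h0 x (Ico_subset_Icc_self hx) h.symm
  intro x hx
  refine lt_of_le_of_ne (hnn x hx) fun h => ?_
  have hax : a < x := lt_of_le_of_ne hx.1 fun h' => by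
    rw [← h'] at h
    exact ha.ne h
  have hd := (hD x hx).mono (Icc_subset_Icc_right hx.2)
  have hpos := h0 x hx h.symm
  -- At a first zero the left difference quotients are nonpositive, against `0 < D' x`.
  have h2 : Tendsto (slope D x) (𝓝[<] x) (𝓝 (D' x)) := by
    have := (hasDerivWithinAt_iff_tendsto_slope' right_notMem_Ioo).1 (hd.mono Ioo_subset_Icc_self)
    rwa [nhdsWithin_Ioo_eq_nhdsLT hax] at this
  have h3 := h2.eventually (lt_mem_nhds hpos)
  obtain ⟨y, hy, hy'⟩ := (h3.and (Ioo_mem_nhdsLT hax)).exists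
  rw [slope_def_field, ← h, sub_zero] at hy
  have := hnn y ⟨hy'.1.le, hy'.2.le.trans hx.2⟩
  exact absurd hy (not_lt.2 (div_nonpos_of_nonneg_of_nonpos this (by linarith [hy'.2])))

end Calculus

namespace IsTraj

variable {p ℓ : ℝ} {u v u₁ v₁ u₂ v₂ : ℝ → ℝ}

lemma continuousOn_fst (h : IsTraj p ℓ u v) : ContinuousOn u (Icc 0 ℓ) :=
  fun x hx => (h.hu x hx).continuousWithinAt

lemma continuousOn_snd (h : IsTraj p ℓ u v) : ContinuousOn v (Icc 0 ℓ) :=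
  fun x hx => (h.hv x hx).continuousWithinAt

lemma hasDerivAt_fst (h : IsTraj p ℓ u v) {x : ℝ} (hx : x ∈ Ioo 0 ℓ) : HasDerivAt u (v x) x :=
  (h.hu x (Ioo_subset_Icc_self hx)).hasDerivAt_of_Icc hx

lemma hasDerivAt_snd (h : IsTraj p ℓ u v) {x : ℝ} (hx : x ∈ Ioo 0 ℓ) :
    HasDerivAt v (u x - u x ^ (p - 1)) x :=
  (h.hv x (Ioo_subset_Icc_self hx)).hasDerivAt_of_Icc hx

/-- The force `u - u^(p-1)` is `f'(u)`, so the two contributions to the derivative cancel. This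
identity fixes the level of every turning point. -/
lemma energy (hp : 2 < p) (h : IsTraj p ℓ u v) {x : ℝ} (hx : x ∈ Icc 0 ℓ) :
    v x ^ 2 - 2 * potential p (u x) = v 0 ^ 2 - 2 * potential p (u 0) := by
  refine constant_of_has_deriv_right_zero (f := fun x => v x ^ 2 - 2 * potential p (u x))
    ((h.continuousOn_snd.pow 2).sub (continuousOn_const.mul
      ((continuous_potential hp).comp_continuousOn h.continuousOn_fst))) (fun y hy => ?_) x hx
  have hy' := Ico_subset_Icc_self hy
  have h1 := (h.hu y hy').Ici_of_Icc hy
  have h2 := (h.hv y hy').Ici_of_Icc hy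
  refine ((h2.pow 2).sub (((hasDerivAt_potential_of_pos hp (h.pos y hy')).comp_hasDerivWithinAt y
    h1).const_mul 2)).congr_deriv ?_
  norm_num
  ring

lemma energy_eq (hp : 2 < p) (h : IsTraj p ℓ u v) {x y : ℝ} (hx : x ∈ Icc 0 ℓ)
    (hy : y ∈ Icc 0 ℓ) :
    v x ^ 2 - 2 * potential p (u x) = v y ^ 2 - 2 * potential p (u y) :=
  (h.energy hp hx).trans (h.energy hp hy).symm

lemma reverse (h : IsTraj p ℓ u v) : IsTraj p ℓ (fun x => u (ℓ - x)) (fun x => -v (ℓ - x)) := by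
  have hm : MapsTo (fun x => ℓ - x) (Icc 0 ℓ) (Icc 0 ℓ) :=
    fun x hx => ⟨by linarith [hx.2], by linarith [hx.1]⟩
  have hd : ∀ x, HasDerivWithinAt (fun x => ℓ - x) (-1) (Icc 0 ℓ) x := fun x => by
    simpa using (hasDerivWithinAt_id x (Icc 0 ℓ)).const_sub ℓ
  refine ⟨fun x hx => ?_, fun x hx => ?_, fun x hx => h.pos _ (hm hx)⟩
  · exact ((h.hu _ (hm hx)).comp x (hd x) hm).congr_deriv (by ring)
  · exact ((h.hv _ (hm hx)).comp x (hd x) hm).neg.congr_deriv (by ring)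

lemma restrict (h : IsTraj p ℓ u v) {ℓ' : ℝ} (hl : ℓ' ≤ ℓ) : IsTraj p ℓ' u v := by
  have hs : Icc 0 ℓ' ⊆ Icc 0 ℓ := Icc_subset_Icc_right hl
  exact ⟨fun x hx => (h.hu x (hs hx)).mono hs, fun x hx => (h.hv x (hs hx)).mono hs,
    fun x hx => h.pos x (hs hx)⟩

lemma lipschitzOn_rpow {q a b : ℝ} (hq : 1 ≤ q) (ha : 0 < a) :
    LipschitzOnWith (Real.toNNReal (q * b ^ (q - 1))) (fun x : ℝ => x ^ q) (Icc a b) := by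
  refine Convex.lipschitzOnWith_of_nnnorm_hasDerivWithin_le (convex_Icc a b)
    (f' := fun x => q * x ^ (q - 1))
    (fun x hx => (Real.hasDerivAt_rpow_const (Or.inl (ha.trans_le hx.1).ne')).hasDerivWithinAt)
    (fun x hx => ?_)
  have hx0 : 0 < x := ha.trans_le hx.1
  rw [← NNReal.coe_le_coe, coe_nnnorm, Real.norm_of_nonneg (by positivity)]
  refine le_trans ?_ (Real.le_coe_toNNReal _)
  exact mul_le_mul_of_nonneg_left (Real.rpow_le_rpow hx0.le hx.2 (by linarith)) (by linarith)

/-- A positive trajectory is determined by its initial data. -/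
theorem eqOn (hp : 2 < p) (h₁ : IsTraj p ℓ u₁ v₁) (h₂ : IsTraj p ℓ u₂ v₂) (hu : u₁ 0 = u₂ 0)
    (hv : v₁ 0 = v₂ 0) : EqOn u₁ u₂ (Icc 0 ℓ) ∧ EqOn v₁ v₂ (Icc 0 ℓ) := by
  rcases lt_or_ge ℓ 0 with hl | hl
  · simp [hl]
  have hne : (Icc 0 ℓ).Nonempty := nonempty_Icc.2 hl
  obtain ⟨x₁, hx₁, hm₁⟩ := isCompact_Icc.exists_isMinOn hne h₁.continuousOn_fst
  obtain ⟨x₂, hx₂, hm₂⟩ := isCompact_Icc.exists_isMinOn hne h₂.continuousOn_fst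
  obtain ⟨y₁, hy₁, hM₁⟩ := isCompact_Icc.exists_isMaxOn hne h₁.continuousOn_fst
  obtain ⟨y₂, hy₂, hM₂⟩ := isCompact_Icc.exists_isMaxOn hne h₂.continuousOn_fst
  -- Both orbits stay in a compact band away from `0`, where the force is Lipschitz.
  set a := min (u₁ x₁) (u₂ x₂)
  set b := max (u₁ y₁) (u₂ y₂)
  have ha : 0 < a := lt_min (h₁.pos _ hx₁) (h₂.pos _ hx₂)
  let w : ℝ → ℝ × ℝ → ℝ × ℝ := fun _ q => (q.2, q.1 - q.1 ^ (p - 1))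
  let s : Set (ℝ × ℝ) := {q | q.1 ∈ Icc a b}
  have hL1 : LipschitzOnWith (1 * 1 + Real.toNNReal ((p - 1) * b ^ (p - 1 - 1)) * 1)
      (fun q : ℝ × ℝ => q.1 - q.1 ^ (p - 1)) s := by
    have h1 : LipschitzOnWith 1 (fun q : ℝ × ℝ => q.1) s := LipschitzWith.prod_fst.lipschitzOnWith
    exact (LipschitzWith.id.lipschitzOnWith.comp h1 (mapsTo_univ _ _)).sub
      ((lipschitzOn_rpow (by linarith) ha).comp h1 fun q hq => hq)
  have hL := (LipschitzWith.prod_snd.lipschitzOnWith (s := s)).prodMk hL1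
  have key := ODE_solution_unique_of_mem_Icc_right (v := w) (s := fun _ => s)
    (f := fun x => (u₁ x, v₁ x)) (g := fun x => (u₂ x, v₂ x)) (a := 0) (b := ℓ)
    (fun _ _ => hL) (h₁.continuousOn_fst.prodMk h₁.continuousOn_snd)
    (fun x hx => ((h₁.hu x (Ico_subset_Icc_self hx)).Ici_of_Icc hx).prodMk
      ((h₁.hv x (Ico_subset_Icc_self hx)).Ici_of_Icc hx))
    (fun x hx => ⟨(min_le_left _ _).trans (hm₁ (Ico_subset_Icc_self hx)),
      le_max_of_le_left (hM₁ (Ico_subset_Icc_self hx))⟩)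
    (h₂.continuousOn_fst.prodMk h₂.continuousOn_snd)
    (fun x hx => ((h₂.hu x (Ico_subset_Icc_self hx)).Ici_of_Icc hx).prodMk
      ((h₂.hv x (Ico_subset_Icc_self hx)).Ici_of_Icc hx))
    (fun x hx => ⟨(min_le_right _ _).trans (hm₂ (Ico_subset_Icc_self hx)),
      le_max_of_le_right (hM₂ (Ico_subset_Icc_self hx))⟩)
    (Prod.ext hu hv)
  exact ⟨fun x hx => congrArg Prod.fst (key hx), fun x hx => congrArg Prod.snd (key hx)⟩

/-- A trajectory is determined by its final data. -/
theorem eqOn_of_right (hp : 2 < p) (h₁ : IsTraj p ℓ u₁ v₁) (h₂ : IsTraj p ℓ u₂ v₂)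
    (hu : u₁ ℓ = u₂ ℓ) (hv : v₁ ℓ = v₂ ℓ) : EqOn u₁ u₂ (Icc 0 ℓ) ∧ EqOn v₁ v₂ (Icc 0 ℓ) := by
  obtain ⟨h3, h4⟩ := h₁.reverse.eqOn hp h₂.reverse (by simpa using hu) (by simpa using hv)
  have hm : ∀ x ∈ Icc 0 ℓ, ℓ - x ∈ Icc 0 ℓ := fun x hx => ⟨by linarith [hx.2], by linarith [hx.1]⟩
  exact ⟨fun x hx => by simpa using h3 (hm x hx), fun x hx => by simpa using h4 (hm x hx)⟩

/-- Concatenation of two trajectories. -/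
theorem concat {a b : ℝ} (ha : 0 ≤ a) (hb : 0 ≤ b) (h₁ : IsTraj p a u₁ v₁) (h₂ : IsTraj p b u₂ v₂)
    (hu : u₁ a = u₂ 0) (hv : v₁ a = v₂ 0) : ∃ u v, IsTraj p (a + b) u v ∧
      (EqOn u u₁ (Icc 0 a) ∧ EqOn v v₁ (Icc 0 a)) ∧
      ∀ x ∈ Icc a (a + b), u x = u₂ (x - a) ∧ v x = v₂ (x - a) := by
  set u : ℝ → ℝ := fun x => if x ≤ a then u₁ x else u₂ (x - a) with hu_def
  set v : ℝ → ℝ := fun x => if x ≤ a then v₁ x else v₂ (x - a) with hv_def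
  have e1 : EqOn u u₁ (Icc 0 a) := fun x hx => if_pos hx.2
  have e2 : EqOn v v₁ (Icc 0 a) := fun x hx => if_pos hx.2
  have e3 : ∀ x ∈ Icc a (a + b), u x = u₂ (x - a) := fun x hx => by
    rcases hx.1.eq_or_lt with rfl | h
    · simp [hu_def, hu]
    · exact if_neg h.not_ge
  have e4 : ∀ x ∈ Icc a (a + b), v x = v₂ (x - a) := fun x hx => by
    rcases hx.1.eq_or_lt with rfl | h
    · simp [hv_def, hv]
    · exact if_neg h.not_ge
  have hm : MapsTo (fun x => x - a) (Icc a (a + b)) (Icc 0 b) :=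
    fun x hx => ⟨by linarith [hx.1], by linarith [hx.2]⟩
  have hd : ∀ x, HasDerivWithinAt (fun x => x - a) 1 (Icc a (a + b)) x := fun x => by
    simpa using (hasDerivWithinAt_id x (Icc a (a + b))).sub_const a
  have hU : Icc 0 (a + b) = Icc 0 a ∪ Icc a (a + b) :=
    (Icc_union_Icc_eq_Icc ha (by linarith)).symm
  -- On a union the derivative is glued from the two pieces. A point outside one closed piece
  -- imposes no condition there, and at the junction both pieces give the same value.
  have A : ∀ (w w₁ w₂ w' : ℝ → ℝ), EqOn w w₁ (Icc 0 a) →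
      (∀ x ∈ Icc a (a + b), w x = w₂ (x - a)) →
      (∀ x ∈ Icc 0 a, HasDerivWithinAt w₁ (w' x) (Icc 0 a) x) →
      (∀ x ∈ Icc a (a + b), HasDerivWithinAt w₂ (w' x) (Icc 0 b) (x - a)) →
      ∀ x ∈ Icc 0 (a + b), HasDerivWithinAt w (w' x) (Icc 0 (a + b)) x := by
    intro w w₁ w₂ w' he1 he2 hd1 hd2 x hx
    rw [hU]
    refine HasDerivWithinAt.union ?_ ?_
    · by_cases hxa : x ∈ Icc 0 a
      · exact (hd1 x hxa).congr he1 (he1 hxa)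
      · exact HasFDerivWithinAt.of_notMem_closure (by rwa [isClosed_Icc.closure_eq])
    · by_cases hxa : x ∈ Icc a (a + b)
      · exact (((hd2 x hxa).comp x (hd x) hm).congr he2 (he2 x hxa)).congr_deriv (by ring)
      · exact HasFDerivWithinAt.of_notMem_closure (by rwa [isClosed_Icc.closure_eq])
  refine ⟨u, v, ⟨A u u₁ u₂ v e1 e3 (fun x hx => e2 hx ▸ h₁.hu x hx)
    (fun x hx => e4 x hx ▸ h₂.hu _ (hm hx)),
    A v v₁ v₂ (fun x => u x - u x ^ (p - 1)) e2 e4 (fun x hx => ?_) (fun x hx => ?_), ?_⟩,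
    ⟨e1, e2⟩, fun x hx => ⟨e3 x hx, e4 x hx⟩⟩
  · simp only [e1 hx]
    exact h₁.hv x hx
  · simp only [e3 x hx]
    exact h₂.hv _ (hm hx)
  · intro x hx
    rw [hU] at hx
    rcases hx with hx | hx
    · rw [e1 hx]
      exact h₁.pos x hx
    · rw [e3 x hx]
      exact h₂.pos _ (hm hx)

lemma strictMonoOn (h : IsTraj p ℓ u v) (hv : ∀ x ∈ Ioo 0 ℓ, 0 < v x) :
    StrictMonoOn u (Icc 0 ℓ) := by
  refine strictMonoOn_of_hasDerivWithinAt_pos (f' := v) (convex_Icc 0 ℓ) h.continuousOn_fst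
    (fun x hx => ?_) (fun x hx => ?_)
  all_goals rw [interior_Icc] at hx
  · exact (h.hasDerivAt_fst hx).hasDerivWithinAt
  · exact hv x hx

lemma strictAntiOn (h : IsTraj p ℓ u v) (hv : ∀ x ∈ Ioo 0 ℓ, v x < 0) :
    StrictAntiOn u (Icc 0 ℓ) := by
  refine strictAntiOn_of_hasDerivWithinAt_neg (f' := v) (convex_Icc 0 ℓ) h.continuousOn_fst
    (fun x hx => ?_) (fun x hx => ?_)
  all_goals rw [interior_Icc] at hx
  · exact (h.hasDerivAt_fst hx).hasDerivWithinAt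
  · exact hv x hx

lemma const_of_snd_eq_zero (h : IsTraj p ℓ u v) (hv : ∀ x ∈ Icc 0 ℓ, v x = 0) :
    ∀ x ∈ Icc 0 ℓ, u x = u 0 :=
  constant_of_has_deriv_right_zero h.continuousOn_fst fun x hx => by
    have := (h.hu x (Ico_subset_Icc_self hx)).Ici_of_Icc hx
    rwa [hv x (Ico_subset_Icc_self hx)] at this

/-- An increasing trajectory has positive velocity. -/
lemma snd_pos_of_strictMonoOn (hp : 2 < p) (h : IsTraj p ℓ u v)
    (hm : StrictMonoOn u (Icc 0 ℓ)) : ∀ x ∈ Ioo 0 ℓ, 0 < v x := by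
  have hnn : ∀ x ∈ Ioo 0 ℓ, 0 ≤ v x := fun x hx => by
    have hl : 0 < ℓ := hx.1.trans hx.2
    have h1 := (h.hu x (Ioo_subset_Icc_self hx)).derivWithin
      (uniqueDiffOn_Icc hl x (Ioo_subset_Icc_self hx))
    rw [← h1]
    exact hm.monotoneOn.derivWithin_nonneg
  intro x hx
  have hl : 0 < ℓ := hx.1.trans hx.2
  have hxI := Ioo_subset_Icc_self hx
  refine lt_of_le_of_ne (hnn x hx) fun h0 => ?_
  -- A zero of the nonnegative velocity is a minimum of it, so the force vanishes and `u x = 1`.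
  -- Since `f` is maximal at `1`, the energy then forces `v = 0` everywhere, and the orbit is the
  -- equilibrium.
  have hmin : IsLocalMin v x := by
    filter_upwards [Ioo_mem_nhds hx.1 hx.2] with y hy
    rw [← h0]
    exact hnn y hy
  have hd := hmin.hasDerivAt_eq_zero (h.hasDerivAt_snd hx)
  have hux := h.pos x hxI
  have hu1 : u x = 1 := by
    rcases lt_trichotomy (u x) 1 with h1 | h1 | h1
    · linarith [rpow_lt_self hp hux h1]
    · exact h1
    · linarith [self_lt_rpow hp h1]
  have hv0 : ∀ y ∈ Icc 0 ℓ, v y = 0 := fun y hy => by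
    have h1 := h.energy_eq hp hy hxI
    rw [← h0, hu1] at h1
    have h2 := potential_le_potential_one hp (h.pos y hy).le
    have h3 : v y ^ 2 ≤ 0 := by linarith
    exact pow_eq_zero_iff two_ne_zero |>.1 (le_antisymm h3 (sq_nonneg _))
  have hc := h.const_of_snd_eq_zero hv0
  have := hm ⟨le_rfl, hl.le⟩ ⟨hl.le, le_rfl⟩ hl
  rw [hc ℓ ⟨hl.le, le_rfl⟩] at this
  exact lt_irrefl _ this

lemma snd_neg_of_strictAntiOn (hp : 2 < p) (h : IsTraj p ℓ u v)
    (hm : StrictAntiOn u (Icc 0 ℓ)) : ∀ x ∈ Ioo 0 ℓ, v x < 0 := by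
  intro x hx
  have h1 := h.reverse.snd_pos_of_strictMonoOn hp (fun y hy z hz hyz =>
    hm ⟨by linarith [hz.2], by linarith [hz.1]⟩ ⟨by linarith [hy.2], by linarith [hy.1]⟩
      (by linarith)) (ℓ - x) ⟨by linarith [hx.2], by linarith [hx.1]⟩
  simpa using h1

end IsTraj

/-! ### Existence of monotone arcs ending at rest -/

section Arc

/-- The average slope of the potential between `m - (m - z) t²` and `m`, in terms of the
force `ψ`. -/
def arcSlope (ψ : ℝ → ℝ) (z m t : ℝ) : ℝ := ∫ s in (0 : ℝ)..1, -ψ (m - s * ((m - z) * t ^ 2))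

/-- The time needed to reach the turning point `m` from `z`. -/
def arcTime (ψ : ℝ → ℝ) (z m : ℝ) : ℝ := ∫ t in (0 : ℝ)..1, √(2 * (m - z) / arcSlope ψ z m t)

/-- Separation of variables: `r` is the inverse of the primitive `H` of `a`. The lower bound `lo`
makes `H` surjective, so `r` is global. -/
lemma exists_autonomous_solution {a : ℝ → ℝ} (ha : Continuous a) {lo : ℝ} (hlo : 0 < lo)
    (h : ∀ t, lo ≤ a t) : ∃ r : ℝ → ℝ, (∀ y, HasDerivAt r (a (r y))⁻¹ y) ∧ r 0 = 0 ∧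
      r (∫ t in (0 : ℝ)..1, a t) = 1 ∧ StrictMono r := by
  set H : ℝ → ℝ := fun t => ∫ τ in (0 : ℝ)..t, a τ with hH
  have hd : ∀ t, HasDerivAt H (a t) t := fun t =>
    intervalIntegral.integral_hasDerivAt_right (ha.intervalIntegrable _ _)
      ha.stronglyMeasurable.stronglyMeasurableAtFilter ha.continuousAt
  have hmono : StrictMono H := strictMono_of_hasDerivAt_pos hd fun t => hlo.trans_le (h t)
  have hH0 : H 0 = 0 := by simp [hH]
  have hdiff : Monotone fun t => H t - lo * t :=
    monotone_of_hasDerivAt_nonneg (f' := fun t => a t - lo)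
      (fun t => ((hd t).sub ((hasDerivAt_id t).const_mul lo)).congr_deriv (by simp))
      fun t => sub_nonneg.2 (h t)
  have hs : H.Surjective := by
    refine Continuous.surjective (continuous_iff_continuousAt.2 fun t => (hd t).continuousAt) ?_ ?_
    · refine tendsto_atTop_mono' _ ?_ (tendsto_id.const_mul_atTop hlo)
      filter_upwards [eventually_ge_atTop 0] with t ht
      have := hdiff ht
      simp only [hH0] at this
      simp only [id]
      linarith
    · refine tendsto_atBot_mono' _ ?_ (tendsto_id.const_mul_atBot hlo)
      filter_upwards [eventually_le_atBot 0] with t ht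
      have := hdiff ht
      simp only [hH0] at this
      simp only [id]
      linarith
  set e := hmono.orderIsoOfSurjective H hs with he
  have hr : ∀ y, H (e.symm y) = y := fun y => e.apply_symm_apply y
  have hl : ∀ y, e.symm (H y) = y := fun y => e.symm_apply_apply y
  refine ⟨e.symm, fun y => ?_, ?_, ?_, e.symm.strictMono⟩
  · exact HasDerivAt.of_local_left_inverse e.symm.continuous.continuousAt (hd _)
      (hlo.trans_le (h _)).ne' (Eventually.of_forall hr)
  · have := hl 0
    rwa [hH0] at this
  · exact hl 1

lemma continuous_arcSlope {X : Type*} [TopologicalSpace X] {ψ : ℝ → ℝ} (hψ : Continuous ψ)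
    {z m t : X → ℝ} (hz : Continuous z) (hm : Continuous m) (ht : Continuous t) :
    Continuous fun x => arcSlope ψ (z x) (m x) (t x) := by
  unfold arcSlope
  refine intervalIntegral.continuous_parametric_intervalIntegral_of_continuous' ?_ 0 1
  fun_prop

variable {Ψ ψ : ℝ → ℝ} {z m : ℝ}

/-- In the variable `t` with `u = m - (m - z) t²`, the energy gap is `t²` times a factor that stays
positive at the turning point. This removes the square-root singularity of the time integral. -/
lemma arcSlope_mul (hψ : Continuous ψ) (hΨ : ∀ x, HasDerivAt Ψ (ψ x) x) (t : ℝ) :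
    (m - z) * t ^ 2 * arcSlope ψ z m t = Ψ (m - (m - z) * t ^ 2) - Ψ m := by
  have h1 : ∀ s ∈ uIcc (0 : ℝ) 1, HasDerivAt (fun s => Ψ (m - s * ((m - z) * t ^ 2)))
      ((m - z) * t ^ 2 * -ψ (m - s * ((m - z) * t ^ 2))) s := fun s _ => by
    have h2 : HasDerivAt (fun s => m - s * ((m - z) * t ^ 2)) (-((m - z) * t ^ 2)) s := by
      simpa using ((hasDerivAt_id s).mul_const ((m - z) * t ^ 2)).const_sub m
    exact ((hΨ _).comp s h2).congr_deriv (by ring)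
  have h3 := intervalIntegral.integral_eq_sub_of_hasDerivAt h1
    (Continuous.intervalIntegrable (by fun_prop) _ _)
  rw [arcSlope, ← intervalIntegral.integral_const_mul, h3]
  simp

lemma arcSlope_pos (hψ : Continuous ψ) (hΨ : ∀ x, HasDerivAt Ψ (ψ x) x) (hzm : z < m)
    (hu : ∀ u ∈ Ico z m, Ψ m < Ψ u) (hm : ψ m < 0) {t : ℝ} (ht : t ∈ Icc (-1 : ℝ) 1) :
    0 < arcSlope ψ z m t := by
  rcases eq_or_ne t 0 with rfl | h0
  · simpa [arcSlope] using hm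
  · have h1 : 0 < (m - z) * t ^ 2 := mul_pos (sub_pos.2 hzm) (by positivity)
    have h2 : t ^ 2 ≤ 1 := by nlinarith [ht.1, ht.2]
    have h3 := hu (m - (m - z) * t ^ 2) ⟨by nlinarith, by linarith⟩
    rw [← sub_pos, ← arcSlope_mul hψ hΨ] at h3
    exact pos_of_mul_pos_right h3 h1.le

/-- With `u = m - D w²` the equation `u' = √(2 (Ψ(u) - Ψ(m)))` becomes `w' = -1 / a(w)` with a
positive continuous `a`, which passes regularly through the turning point `w = 0`. The construction
yields the length as an integral that is visibly continuous in `z` and `m`. -/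
theorem exists_arc (hψ : Continuous ψ) (hΨ : ∀ x, HasDerivAt Ψ (ψ x) x) (hzm : z < m)
    (hu : ∀ u ∈ Ico z m, Ψ m < Ψ u) (hm : ψ m < 0) :
    0 < arcTime ψ z m ∧ ∃ u v : ℝ → ℝ,
      (∀ x ∈ Icc 0 (arcTime ψ z m), HasDerivWithinAt u (v x) (Icc 0 (arcTime ψ z m)) x) ∧
      (∀ x ∈ Icc 0 (arcTime ψ z m), HasDerivWithinAt v (ψ (u x)) (Icc 0 (arcTime ψ z m)) x) ∧
      (∀ x ∈ Icc 0 (arcTime ψ z m), u x ∈ Icc z m) ∧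
      u 0 = z ∧ u (arcTime ψ z m) = m ∧ v 0 = √(2 * (Ψ z - Ψ m)) ∧ v (arcTime ψ z m) = 0 ∧
      ∀ x ∈ Ico 0 (arcTime ψ z m), 0 < v x := by
  set τ := arcTime ψ z m with hτ
  set D := m - z with hD
  have hD0 : 0 < D := sub_pos.2 hzm
  set cl : ℝ → ℝ := fun t => max (-1) (min t 1) with hcl
  have hclc : Continuous cl := by fun_prop
  have hclm : ∀ t, cl t ∈ Icc (-1 : ℝ) 1 := fun t =>
    ⟨le_max_left _ _, max_le (by norm_num) (min_le_right _ _)⟩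
  have hcle : ∀ t ∈ Icc (0 : ℝ) 1, cl t = t := fun t ht => by
    simp only [hcl, min_eq_left ht.2]
    exact max_eq_right (by linarith [ht.1])
  set g : ℝ → ℝ := fun t => arcSlope ψ z m (cl t) with hg
  have hgc : Continuous g := continuous_arcSlope hψ continuous_const continuous_const hclc
  have hgp : ∀ t, 0 < g t := fun t => arcSlope_pos hψ hΨ hzm hu hm (hclm t)
  set a : ℝ → ℝ := fun t => √(2 * D / g t) with ha
  have hac : Continuous a := (continuous_const.div hgc fun t => (hgp t).ne').sqrt
  have hap : ∀ t, 0 < a t := fun t => Real.sqrt_pos.2 (div_pos (by linarith) (hgp t))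
  obtain ⟨t₀, -, ht₀⟩ := isCompact_Icc.exists_isMinOn (nonempty_Icc.2 (by norm_num : (-1 : ℝ) ≤ 1))
    hac.continuousOn
  have hlo : ∀ t, a t₀ ≤ a t := fun t => by
    have h1 := ht₀ (hclm t)
    have h2 : a (cl t) = a t := by
      have : cl (cl t) = cl t := by
        have := hclm t
        rw [hcl] at this ⊢
        simp only at this ⊢
        rw [min_eq_left this.2, max_eq_right this.1]
      simp only [ha, hg, this]
    rw [← h2]
    exact h1
  obtain ⟨r, hr, hr0, hr1, hrm⟩ := exists_autonomous_solution hac (hap t₀) hlo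
  have hτa : ∫ t in (0 : ℝ)..1, a t = τ := by
    rw [hτ, arcTime]
    refine intervalIntegral.integral_congr fun t ht => ?_
    rw [uIcc_of_le zero_le_one] at ht
    simp only [ha, hg, hcle t ht, hD]
  rw [hτa] at hr1
  have hτ0 : 0 < τ := by
    rw [← hrm.lt_iff_lt, hr0, hr1]
    exact one_pos
  -- `w` decreases from `1` (where `u = z`) to `0` (where `u = m`).
  set w : ℝ → ℝ := fun x => r (τ - x) with hw
  have hwd : ∀ x, HasDerivAt w (-(a (w x))⁻¹) x := fun x => by
    have := (hr (τ - x)).comp x ((hasDerivAt_id x).const_sub τ)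
    exact this.congr_deriv (by simp [hw])
  have hwc : Continuous w := continuous_iff_continuousAt.2 fun x => (hwd x).continuousAt
  have hwI : ∀ x ∈ Icc 0 τ, w x ∈ Icc (0 : ℝ) 1 := fun x hx => by
    constructor
    · rw [← hr0]
      exact hrm.monotone (by linarith [hx.2])
    · rw [← hr1]
      exact hrm.monotone (by linarith [hx.1])
  have hwpos : ∀ x < τ, 0 < w x := fun x hx => by
    rw [← hr0]
    exact hrm (by linarith)
  have hw0 : w 0 = 1 := by simp [hw, hr1]
  have hwτ : w τ = 0 := by simp [hw, hr0]
  set u : ℝ → ℝ := fun x => m - D * w x ^ 2 with hu_def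
  set v : ℝ → ℝ := fun x => w x * √(2 * D * g (w x)) with hv_def
  have hainv : ∀ t, (a t)⁻¹ = √(g t / (2 * D)) := fun t => by
    rw [ha, ← Real.sqrt_inv, inv_div]
  have hav : ∀ t, 2 * D * (a t)⁻¹ = √(2 * D * g t) := fun t => by
    rw [hainv, show 2 * D * g t = (2 * D) ^ 2 * (g t / (2 * D)) by field_simp,
      Real.sqrt_mul (by positivity), Real.sqrt_sq (by positivity)]
  have hud : ∀ x, HasDerivAt u (v x) x := fun x => by
    have := (((hwd x).pow 2).const_mul D).const_sub m
    refine this.congr_deriv ?_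
    rw [hv_def]
    simp only
    rw [← hav]
    norm_num
    ring
  have hv2 : ∀ x ∈ Icc 0 τ, v x = √(2 * (Ψ (u x) - Ψ m)) := fun x hx => by
    have h1 := hwI x hx
    rw [hu_def, ← arcSlope_mul hψ hΨ (z := z) (m := m) (w x), hv_def]
    simp only [hg, hcle _ h1]
    rw [show 2 * ((m - z) * w x ^ 2 * arcSlope ψ z m (w x)) =
      w x ^ 2 * (2 * D * arcSlope ψ z m (w x)) by ring, Real.sqrt_mul (sq_nonneg _),
      Real.sqrt_sq h1.1]
  have huI : ∀ x ∈ Icc 0 τ, u x ∈ Icc z m := fun x hx => by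
    have h1 := hwI x hx
    have h2 : w x ^ 2 ≤ 1 := by nlinarith [h1.1, h1.2]
    simp only [hu_def]
    constructor <;> nlinarith [sq_nonneg (w x)]
  have huτ : u τ = m := by simp [hu_def, hwτ]
  have hu0 : u 0 = z := by simp [hu_def, hw0, hD]
  refine ⟨hτ0, u, v, fun x _ => (hud x).hasDerivWithinAt, fun x hx => ?_, huI, hu0, huτ, ?_, ?_,
    fun x hx => mul_pos (hwpos x hx.2) (Real.sqrt_pos.2 (mul_pos (by linarith) (hgp _)))⟩
  · rcases hx.2.eq_or_lt with rfl | hxτ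
    -- At the turning point the square root is not differentiable. But `v` is `w` times a continuous
    -- factor and `w τ = 0`, so the difference quotient of `v` tends to `-(a 0)⁻¹ * (2 D (a 0)⁻¹) =
    -- -g 0 = ψ m`.
    · refine HasDerivAt.hasDerivWithinAt ?_
      rw [hasDerivAt_iff_tendsto_slope]
      have h1 := (hasDerivAt_iff_tendsto_slope.1 (hwd τ))
      have h2 : Tendsto (fun x => √(2 * D * g (w x))) (𝓝[≠] τ) (𝓝 √(2 * D * g (w τ))) :=
        (Continuous.tendsto (by fun_prop) τ).mono_left nhdsWithin_le_nhds
      have h3 := h1.mul h2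
      rw [hwτ, ← hav] at h3
      have h4 : -(a 0)⁻¹ * (2 * D * (a 0)⁻¹) = ψ (u τ) := by
        have : (a 0)⁻¹ * (a 0)⁻¹ = g 0 / (2 * D) := by
          rw [hainv]
          exact Real.mul_self_sqrt (div_nonneg (hgp 0).le (by linarith))
        have hg0 : g 0 = -ψ m := by
          simp [hg, hcle 0 (by simp), arcSlope]
        rw [huτ, show -(a 0)⁻¹ * (2 * D * (a 0)⁻¹) = -(2 * D) * ((a 0)⁻¹ * (a 0)⁻¹) by ring, this,
          hg0]
        field_simp
      rw [h4] at h3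
      refine h3.congr fun y => ?_
      simp only [slope_def_field, hv_def, hwτ]
      ring
    · have hvpos : 0 < v x :=
        mul_pos (hwpos x hxτ) (Real.sqrt_pos.2 (mul_pos (by linarith) (hgp _)))
      have hp : 0 < 2 * (Ψ (u x) - Ψ m) := by
        rw [hv2 x hx] at hvpos
        exact Real.sqrt_pos.1 hvpos
      have h1 : HasDerivAt (fun x => √(2 * (Ψ (u x) - Ψ m))) (ψ (u x)) x := by
        refine (((((hΨ (u x)).comp x (hud x)).sub_const (Ψ m)).const_mul 2).sqrt
          hp.ne').congr_deriv ?_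
        simp only [Function.comp]
        rw [← hv2 x hx]
        field_simp
      exact h1.hasDerivWithinAt.congr hv2 (hv2 x hx)
  · rw [hv2 0 ⟨le_rfl, hτ0.le⟩, hu0]
  · simp [hv_def, hwτ]

/-- The clamp is the identity on `[0, 1]`; it makes the integrand jointly continuous for all real
`t`, as needed for a parametric integral. -/
lemma continuous_arcTime {X : Type*} [TopologicalSpace X] (hψ : Continuous ψ)
    {z m : X → ℝ} (hz : Continuous z) (hm : Continuous m)
    (hpos : ∀ x, ∀ t ∈ Icc (-1 : ℝ) 1, 0 < arcSlope ψ (z x) (m x) t) :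
    Continuous fun x => arcTime ψ (z x) (m x) := by
  have h1 : ∀ x, arcTime ψ (z x) (m x) = ∫ t in (0 : ℝ)..1,
      √(2 * (m x - z x) / arcSlope ψ (z x) (m x) (max (-1) (min t 1))) := fun x => by
    refine intervalIntegral.integral_congr fun t ht => ?_
    rw [uIcc_of_le zero_le_one] at ht
    rw [min_eq_left ht.2, max_eq_right (by linarith [ht.1])]
  rw [funext h1]
  refine intervalIntegral.continuous_parametric_intervalIntegral_of_continuous' ?_ 0 1
  refine (Continuous.div (by fun_prop) (continuous_arcSlope hψ (by fun_prop) (by fun_prop)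
    (by fun_prop)) fun q => ?_).sqrt
  exact (hpos _ _ ⟨le_max_left _ _, max_le (by norm_num) (min_le_right _ _)⟩).ne'

end Arc

/-! ### Arcs of the equation that end or start at a turning point. -/

section ArcTraj

/-- The derivative of the potential. -/
def force (p x : ℝ) : ℝ := x - |x| ^ (p - 2) * x

variable {p z m n : ℝ}

lemma continuous_force (hp : 2 < p) : Continuous (force p) := by
  unfold force
  have : Continuous fun x : ℝ => |x| ^ (p - 2) :=
    continuous_abs.rpow_const fun x => Or.inr (by linarith)
  fun_prop

lemma force_of_pos {x : ℝ} (hx : 0 < x) : force p x = x - x ^ (p - 1) := by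
  rw [force, abs_of_pos hx, ← rpow_sub_one_eq hx]

lemma force_neg (x : ℝ) : force p (-x) = -force p x := by
  simp [force]
  ring

/-- The time from `z` to the turning point `m > z`. -/
def rightTime (p z m : ℝ) : ℝ := arcTime (force p) z m

/-- The time from the turning point `n < z` to `z`. -/
def leftTime (p n z : ℝ) : ℝ := arcTime (force p) (-z) (-n)

theorem exists_rightArc (hp : 2 < p) (hz : 0 < z) (hzm : z < m) (hm : 1 < m)
    (hu : ∀ u ∈ Ico z m, potential p m < potential p u) :
    0 < rightTime p z m ∧ ∃ u v, IsTraj p (rightTime p z m) u v ∧ u 0 = z ∧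
      u (rightTime p z m) = m ∧ v 0 = √(2 * (potential p z - potential p m)) ∧
      v (rightTime p z m) = 0 ∧ ∀ x ∈ Ico 0 (rightTime p z m), 0 < v x := by
  obtain ⟨h0, u, v, h1, h2, h3, h4, h5, h6, h7, h8⟩ := exists_arc (continuous_force hp)
    (hasDerivAt_potential hp) hzm hu (by
      rw [force_of_pos (by linarith)]
      linarith [self_lt_rpow hp hm])
  have hpos : ∀ x ∈ Icc 0 (rightTime p z m), 0 < u x := fun x hx => hz.trans_le (h3 x hx).1
  refine ⟨h0, u, v, ⟨h1, fun x hx => ?_, hpos⟩, h4, h5, h6, h7, h8⟩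
  rw [← force_of_pos (hpos x hx)]
  exact h2 x hx

/-- The potential is even, so an arc from `-z` to the turning point `-n`, after a change of sign and
a reversal of time, leaves `n` from rest and reaches `z`. -/
theorem exists_leftArc (hp : 2 < p) (hn : 0 < n) (hnz : n < z) (hn1 : n < 1)
    (hu : ∀ u ∈ Ioc n z, potential p n < potential p u) :
    0 < leftTime p n z ∧ ∃ u v, IsTraj p (leftTime p n z) u v ∧ u 0 = n ∧
      u (leftTime p n z) = z ∧ v 0 = 0 ∧
      v (leftTime p n z) = √(2 * (potential p z - potential p n)) ∧
      ∀ x ∈ Ioc 0 (leftTime p n z), 0 < v x := by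
  obtain ⟨h0, u, v, h1, h2, h3, h4, h5, h6, h7, h8⟩ := exists_arc (z := -z) (m := -n)
    (continuous_force hp) (hasDerivAt_potential hp) (by linarith) (fun u hu' => by
      rw [potential_neg, ← potential_neg p u]
      exact hu (-u) ⟨by linarith [hu'.2], by linarith [hu'.1]⟩) (by
      rw [force_neg, force_of_pos hn]
      linarith [rpow_lt_self hp hn hn1])
  set τ := arcTime (force p) (-z) (-n) with hτ
  have hpos : ∀ x ∈ Icc 0 τ, 0 < -u x := fun x hx => by linarith [(h3 x hx).2]
  have ht : IsTraj p τ (fun x => -u x) (fun x => -v x) := by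
    refine ⟨fun x hx => (h1 x hx).neg, fun x hx => ?_, hpos⟩
    rw [← force_of_pos (hpos x hx), force_neg]
    exact (h2 x hx).neg
  have hl : leftTime p n z = τ := rfl
  rw [hl]
  refine ⟨h0, _, _, ht.reverse, by simp [h5], by simp [h4], by simp [h7], ?_, fun x hx => ?_⟩
  · simp [h6, potential_neg]
  · simpa using h8 (τ - x) ⟨by linarith [hx.2], by linarith [hx.1]⟩

lemma continuous_rightTime {X : Type*} [TopologicalSpace X] (hp : 2 < p) {z m : X → ℝ}
    (hz : Continuous z) (hm : Continuous m) (hzm : ∀ x, z x < m x) (h1 : ∀ x, 1 < m x)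
    (hu : ∀ x, ∀ u ∈ Ico (z x) (m x), potential p (m x) < potential p u) :
    Continuous fun x => rightTime p (z x) (m x) :=
  continuous_arcTime (continuous_force hp) hz hm fun x _ ht =>
    arcSlope_pos (continuous_force hp) (hasDerivAt_potential hp) (hzm x) (hu x) (by
      rw [force_of_pos (by linarith [h1 x])]
      linarith [self_lt_rpow hp (h1 x)]) ht

lemma continuous_leftTime {X : Type*} [TopologicalSpace X] (hp : 2 < p) {n z : X → ℝ}
    (hn : Continuous n) (hz : Continuous z) (h0 : ∀ x, 0 < n x) (h1 : ∀ x, n x < 1)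
    (hnz : ∀ x, n x < z x) (hu : ∀ x, ∀ u ∈ Ioc (n x) (z x), potential p (n x) < potential p u) :
    Continuous fun x => leftTime p (n x) (z x) :=
  continuous_arcTime (continuous_force hp) hz.neg hn.neg fun x _ ht =>
    arcSlope_pos (continuous_force hp) (hasDerivAt_potential hp) (neg_lt_neg (hnz x))
      (fun u hu' => by
        rw [potential_neg, ← potential_neg p u]
        exact hu x (-u) ⟨by linarith [hu'.2], by linarith [hu'.1]⟩) (by
      rw [force_neg, force_of_pos (h0 x)]
      linarith [rpow_lt_self hp (h0 x) (h1 x)]) ht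

end ArcTraj

/-! ### Comparison of travel times -/

section TimeComparison

lemma exists_inverse_of_strictMonoOn {ℓ : ℝ} {σ : ℝ → ℝ} (hl : 0 ≤ ℓ)
    (hc : ContinuousOn σ (Icc 0 ℓ)) (hm : StrictMonoOn σ (Icc 0 ℓ)) :
    ∃ r : ℝ → ℝ, Continuous r ∧ (∀ x ∈ Icc 0 ℓ, r (σ x) = x) ∧
      ∀ y ∈ Icc (σ 0) (σ ℓ), r y ∈ Icc 0 ℓ ∧ σ (r y) = y := by
  set P : ℝ → ℝ := fun x => max 0 (min x ℓ) with hP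
  have hPI : ∀ x, P x ∈ Icc 0 ℓ := fun x => ⟨le_max_left _ _, max_le hl (min_le_right _ _)⟩
  have hPe : ∀ x ∈ Icc 0 ℓ, P x = x := fun x hx => by
    simp only [hP, min_eq_left hx.2, max_eq_right hx.1]
  have hPm : Monotone P := fun x y h => max_le_max le_rfl (min_le_min h le_rfl)
  have hP1 : ∀ x y, x ≤ y → P y - P x ≤ y - x := fun x y h => by
    simp only [hP]
    rcases le_total x ℓ with hx | hx <;> rcases le_total y ℓ with hy | hy <;>
    rcases le_total 0 x with hx' | hx' <;> rcases le_total 0 y with hy' | hy' <;>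
    simp [*] <;> linarith
  set g : ℝ → ℝ := fun x => σ (P x) + (x - P x) with hg
  have hgm : StrictMono g := fun x y hxy => by
    rcases (hPm hxy.le).eq_or_lt with h | h
    · simp only [hg, h]
      linarith
    · have := hm (hPI x) (hPI y) h
      have := hP1 x y hxy.le
      simp only [hg]
      linarith
  have hPc : Continuous P := by fun_prop
  have hgc : Continuous g := (hc.comp_continuous hPc hPI).add (continuous_id.sub hPc)
  have hgs : g.Surjective := by
    refine hgc.surjective ?_ ?_
    · refine (tendsto_atTop_add_const_right atTop (σ ℓ - ℓ) tendsto_id).congr' ?_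
      filter_upwards [eventually_ge_atTop ℓ] with x hx
      simp only [hg, hP, min_eq_right hx, max_eq_right hl, id]
      ring
    · refine (tendsto_atBot_add_const_right atBot (σ 0) tendsto_id).congr' ?_
      filter_upwards [eventually_le_atBot 0] with x hx
      simp only [hg, hP, min_eq_left (hx.trans hl), max_eq_left hx, id]
      ring
  set e := hgm.orderIsoOfSurjective g hgs
  have hl' : ∀ x ∈ Icc 0 ℓ, e.symm (σ x) = x := fun x hx => by
    have h1 : g x = σ x := by simp [hg, hPe x hx]
    rw [← h1]
    exact e.symm_apply_apply x
  refine ⟨e.symm, e.symm.continuous, hl', fun y hy => ?_⟩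
  obtain ⟨x, hx, rfl⟩ := intermediate_value_Icc hl hc hy
  rw [hl' x hx]
  exact ⟨hx, rfl⟩

/-- Of two increasing functions with the same values at the end-points, the one that is slower at
each height takes longer. -/
theorem time_lt_of_speed_lt {a b ℓ₁ ℓ₂ : ℝ} {σ₁ s₁ σ₂ s₂ : ℝ → ℝ} (hl₁ : 0 < ℓ₁) (hl₂ : 0 < ℓ₂)
    (hc₁ : ContinuousOn σ₁ (Icc 0 ℓ₁)) (hc₂ : ContinuousOn σ₂ (Icc 0 ℓ₂))
    (hd₁ : ∀ x ∈ Ioo 0 ℓ₁, HasDerivAt σ₁ (s₁ x) x) (hd₂ : ∀ x ∈ Ioo 0 ℓ₂, HasDerivAt σ₂ (s₂ x) x)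
    (hs₁ : ∀ x ∈ Ioo 0 ℓ₁, 0 < s₁ x) (hs₂ : ∀ x ∈ Ioo 0 ℓ₂, 0 < s₂ x)
    (ha₁ : σ₁ 0 = a) (ha₂ : σ₂ 0 = a) (hb₁ : σ₁ ℓ₁ = b) (hb₂ : σ₂ ℓ₂ = b)
    (h : ∀ x ∈ Ioo 0 ℓ₁, ∀ y ∈ Ioo 0 ℓ₂, σ₁ x = σ₂ y → s₁ x < s₂ y) : ℓ₂ < ℓ₁ := by
  have hmono : ∀ {ℓ : ℝ} {σ s : ℝ → ℝ}, ContinuousOn σ (Icc 0 ℓ) →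
      (∀ x ∈ Ioo 0 ℓ, HasDerivAt σ (s x) x) → (∀ x ∈ Ioo 0 ℓ, 0 < s x) →
      StrictMonoOn σ (Icc 0 ℓ) := fun {ℓ σ s} hc hd hs => by
    refine strictMonoOn_of_hasDerivWithinAt_pos (f' := s) (convex_Icc 0 ℓ) hc (fun x hx => ?_)
      (fun x hx => ?_)
    all_goals rw [interior_Icc] at hx
    · exact (hd x hx).hasDerivWithinAt
    · exact hs x hx
  have hm₁ := hmono hc₁ hd₁ hs₁
  have hm₂ := hmono hc₂ hd₂ hs₂
  have h0₁ : (0 : ℝ) ∈ Icc 0 ℓ₁ := ⟨le_rfl, hl₁.le⟩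
  have hℓ₁ : ℓ₁ ∈ Icc 0 ℓ₁ := ⟨hl₁.le, le_rfl⟩
  have h0₂ : (0 : ℝ) ∈ Icc 0 ℓ₂ := ⟨le_rfl, hl₂.le⟩
  have hℓ₂ : ℓ₂ ∈ Icc 0 ℓ₂ := ⟨hl₂.le, le_rfl⟩
  obtain ⟨r, hrc, hr, hr'⟩ := exists_inverse_of_strictMonoOn hl₂.le hc₂ hm₂
  have hin : ∀ x ∈ Ioo 0 ℓ₁, σ₁ x ∈ Ioo (σ₂ 0) (σ₂ ℓ₂) := fun x hx => by
    rw [ha₂, hb₂, ← ha₁, ← hb₁]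
    exact ⟨hm₁ h0₁ (Ioo_subset_Icc_self hx) hx.1, hm₁ (Ioo_subset_Icc_self hx) hℓ₁ hx.2⟩
  have hry : ∀ x ∈ Ioo 0 ℓ₁, r (σ₁ x) ∈ Ioo 0 ℓ₂ ∧ σ₂ (r (σ₁ x)) = σ₁ x := fun x hx => by
    obtain ⟨h1, h2⟩ := hr' _ (Ioo_subset_Icc_self (hin x hx))
    refine ⟨⟨lt_of_le_of_ne h1.1 fun h3 => ?_, lt_of_le_of_ne h1.2 fun h3 => ?_⟩, h2⟩
    · rw [← h3] at h2
      exact (hin x hx).1.ne h2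
    · rw [h3] at h2
      exact (hin x hx).2.ne' h2
  -- `σ₂⁻¹ ∘ σ₁` sends `0` to `0` and `ℓ₁` to `ℓ₂`, with derivative `s₁ / s₂ < 1`; the mean value
  -- theorem then bounds `ℓ₂ / ℓ₁`.
  have hder : ∀ x ∈ Ioo 0 ℓ₁, HasDerivAt (fun x => r (σ₁ x)) ((s₂ (r (σ₁ x)))⁻¹ * s₁ x) x := by
    intro x hx
    refine HasDerivAt.comp x (HasDerivAt.of_local_left_inverse hrc.continuousAt
      (hd₂ _ (hry x hx).1) (hs₂ _ (hry x hx).1).ne' ?_) (hd₁ x hx)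
    filter_upwards [Ioo_mem_nhds (hin x hx).1 (hin x hx).2] with y hy
    exact (hr' y (Ioo_subset_Icc_self hy)).2
  obtain ⟨c, hc, hce⟩ := exists_hasDerivAt_eq_slope (fun x => r (σ₁ x)) _ hl₁
    (hrc.comp_continuousOn hc₁) hder
  have e0 : r (σ₁ 0) = 0 := by rw [ha₁, ← ha₂, hr 0 h0₂]
  have e1 : r (σ₁ ℓ₁) = ℓ₂ := by rw [hb₁, ← hb₂, hr ℓ₂ hℓ₂]
  have h1 := h c hc _ (hry c hc).1 (hry c hc).2.symm
  have h2 := hs₂ _ (hry c hc).1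
  rw [e0, e1, sub_zero, sub_zero] at hce
  have h3 : (s₂ (r (σ₁ c)))⁻¹ * s₁ c < 1 := by
    rw [inv_mul_lt_iff₀ h2]
    simpa using h1
  rw [hce, div_lt_one hl₁] at h3
  exact h3

/-- A maximum principle on `[0, 1]`. -/
theorem pos_of_second_deriv_neg {D D' D'' : ℝ → ℝ} (hc : ContinuousOn D (Icc 0 1))
    (hd : ∀ x ∈ Ioo (0 : ℝ) 1, HasDerivAt D (D' x) x)
    (hd' : ∀ x ∈ Ioo (0 : ℝ) 1, HasDerivAt D' (D'' x) x) (h0 : 0 ≤ D 0) (h1 : 0 ≤ D 1)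
    (h : ∀ x ∈ Ioo (0 : ℝ) 1, D x ≤ 0 → D'' x < 0) : ∀ x ∈ Ioo (0 : ℝ) 1, 0 < D x := by
  -- At an interior minimum with `D c ≤ 0`, the first derivative vanishes and the second is
  -- negative, so `D` would strictly decrease just to the right of `c`.
  have key : ∀ c ∈ Ioo (0 : ℝ) 1, IsMinOn D (Icc 0 1) c → 0 < D c := by
    intro c hc' hmin
    by_contra! hle
    have hD' : D' c = 0 :=
      (hmin.isLocalMin (Icc_mem_nhds hc'.1 hc'.2)).hasDerivAt_eq_zero (hd c hc')
    have hneg := h c hc' hle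
    have h2 : Tendsto (slope D' c) (𝓝[>] c) (𝓝 (D'' c)) :=
      (hasDerivAt_iff_tendsto_slope.1 (hd' c hc')).mono_left
        (nhdsWithin_mono _ fun y hy => (ne_of_gt hy))
    have h3 := (h2.eventually (gt_mem_nhds hneg)).and (Ioo_mem_nhdsGT hc'.2)
    obtain ⟨e, hce, he⟩ := mem_nhdsGT_iff_exists_Ioo_subset.1 h3
    rw [mem_Ioi] at hce
    set y := (c + e) / 2 with hy
    have hcy : c < y := by linarith
    have hye : y < e := by linarith
    have hy1 : y < 1 := (he ⟨hcy, hye⟩).2.2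
    have hanti : StrictAntiOn D (Icc c y) := by
      refine strictAntiOn_of_hasDerivWithinAt_neg (f' := D') (convex_Icc c y)
        (hc.mono (Icc_subset_Icc hc'.1.le hy1.le)) (fun x hx => ?_) (fun x hx => ?_)
      all_goals rw [interior_Icc] at hx
      · exact (hd x ⟨hc'.1.trans hx.1, hx.2.trans hy1⟩).hasDerivWithinAt
      · have h4 := (he ⟨hx.1, hx.2.trans hye⟩).1
        simp only [slope_def_field, hD', sub_zero] at h4
        by_contra! h5
        exact absurd h4 (not_lt.2 (div_nonneg h5 (by linarith [hx.1])))
    have h6 := hanti ⟨le_rfl, hcy.le⟩ ⟨hcy.le, le_rfl⟩ hcy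
    exact absurd h6 (not_lt.2 (hmin ⟨(hc'.1.trans hcy).le, hy1.le⟩))
  obtain ⟨c, hcI, hmin⟩ := isCompact_Icc.exists_isMinOn (nonempty_Icc.2 zero_le_one) hc
  intro x hx
  by_contra! hle
  have hxI := Ioo_subset_Icc_self hx
  have hDc : D c ≤ 0 := (hmin hxI).trans hle
  by_cases hci : c ∈ Ioo (0 : ℝ) 1
  · exact absurd (key c hci hmin) (not_lt.2 hDc)
  -- A minimum attained at an end-point is nonnegative, so the interior point `x` with `D x ≤ 0` is
  -- a minimum as well.
  · have hc0 : 0 ≤ D c := by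
      rcases hcI.1.eq_or_lt with h2 | h2
      · rwa [← h2]
      · rcases hcI.2.eq_or_lt with h3 | h3
        · rwa [h3]
        · exact absurd ⟨h2, h3⟩ hci
    refine absurd (key x hx fun y hy => ?_) (not_lt.2 hle)
    exact (hle.trans hc0).trans (hmin hy)

end TimeComparison

/-! ### Wronskian comparison of two trajectories. -/

section Picone

variable {p ℓ₁ ℓ₂ : ℝ} {u₁ v₁ u₂ v₂ : ℝ → ℝ}

/-- The linear terms cancel in the derivative and leave `u₁ u₂ (u₂^(p-2) - u₁^(p-2))`, which is
positive because the equation is superlinear. -/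
lemma strictMonoOn_wronskian (hp : 2 < p) {ℓ : ℝ} (h₁ : IsTraj p ℓ u₁ v₁) (h₂ : IsTraj p ℓ u₂ v₂)
    (hlt : ∀ x ∈ Icc 0 ℓ, u₁ x < u₂ x) :
    StrictMonoOn (fun x => v₁ x * u₂ x - u₁ x * v₂ x) (Icc 0 ℓ) := by
  refine strictMonoOn_of_hasDerivWithinAt_pos
    (f' := fun x => u₁ x * u₂ x * (u₂ x ^ (p - 2) - u₁ x ^ (p - 2))) (convex_Icc 0 ℓ)
    ((h₁.continuousOn_snd.mul h₂.continuousOn_fst).sub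
      (h₁.continuousOn_fst.mul h₂.continuousOn_snd)) (fun x hx => ?_) (fun x hx => ?_)
  all_goals rw [interior_Icc] at hx
  all_goals have hI := Ioo_subset_Icc_self hx
  · refine (((h₁.hasDerivAt_snd hx).mul (h₂.hasDerivAt_fst hx)).sub
      ((h₁.hasDerivAt_fst hx).mul (h₂.hasDerivAt_snd hx))).hasDerivWithinAt.congr_deriv ?_
    rw [rpow_sub_one_eq (h₁.pos x hI), rpow_sub_one_eq (h₂.pos x hI)]
    ring
  · exact mul_pos (mul_pos (h₁.pos x hI) (h₂.pos x hI)) (sub_pos.2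
      (Real.rpow_lt_rpow (h₁.pos x hI).le (hlt x hI) (by linarith)))

/-- Comparison of two increasing arcs that end at rest: the one that starts lower, with less
energy but larger logarithmic derivative, takes longer. -/
theorem rightArc_time_lt (hp : 2 < p) (hl₁ : 0 < ℓ₁) (h₁ : IsTraj p ℓ₁ u₁ v₁)
    (h₂ : IsTraj p ℓ₂ u₂ v₂) (hv₂ : ∀ x ∈ Icc 0 ℓ₂, 0 ≤ v₂ x)
    (hend : v₁ ℓ₁ = 0) (hu : u₁ 0 < u₂ 0)
    (hE : v₁ 0 ^ 2 - 2 * potential p (u₁ 0) < v₂ 0 ^ 2 - 2 * potential p (u₂ 0))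
    (hW : 0 < v₁ 0 * u₂ 0 - u₁ 0 * v₂ 0) : ℓ₂ < ℓ₁ := by
  by_contra! hle
  have h₂' := h₂.restrict hle
  have hs : Icc 0 ℓ₁ ⊆ Icc 0 ℓ₂ := Icc_subset_Icc_right hle
  -- If the two curves met, the one with more energy would be faster there, so the gap has positive
  -- derivative at its zeros and the order persists.
  have hpos : ∀ x ∈ Icc 0 ℓ₁, 0 < u₂ x - u₁ x :=
    pos_of_deriv_pos_at_zeros (D := fun x => u₂ x - u₁ x) (D' := fun x => v₂ x - v₁ x)
      (fun x hx => (h₂'.hu x hx).sub (h₁.hu x hx)) (sub_pos.2 hu) fun x hx h0 => by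
        have e1 := h₁.energy hp hx
        have e2 := h₂'.energy hp hx
        rw [sub_eq_zero] at h0
        rw [h0] at e2
        exact sub_pos.2 (lt_of_pow_lt_pow_left₀ 2 (hv₂ x (hs hx)) (by linarith))
  -- The Wronskian starts positive and increases, but at `ℓ₁` it equals `-u₁ v₂ ≤ 0`.
  have hm := strictMonoOn_wronskian hp h₁ h₂' fun x hx => sub_pos.1 (hpos x hx)
  have hI : ℓ₁ ∈ Icc 0 ℓ₁ := ⟨hl₁.le, le_rfl⟩
  have h3 := hm ⟨le_rfl, hl₁.le⟩ hI hl₁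
  simp only [hend, zero_mul] at h3
  have := mul_nonneg (h₁.pos _ hI).le (hv₂ _ (hs hI))
  linarith

/-- The elasticity `x f'(x) / f(x)` equals `(1 - a) / (1/2 - a/p)` with `a = x^(p-2)`, which
decreases since `p > 2`. Cross-multiplied, the difference is a positive multiple of `(y^(p-2) -
x^(p-2)) (1/2 - 1/p)`, whatever the sign of `f`. -/
lemma elasticity_lt (hp : 2 < p) {x y : ℝ} (hx : 0 < x) (hxy : x < y) :
    y * (y - y ^ (p - 1)) * potential p x < x * (x - x ^ (p - 1)) * potential p y := by
  have hy := hx.trans hxy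
  have hab : x ^ (p - 2) < y ^ (p - 2) := Real.rpow_lt_rpow hx.le hxy (by linarith)
  rw [rpow_sub_one_eq hx, rpow_sub_one_eq hy, potential_eq hx, potential_eq hy, ← sub_pos]
  have h1 : 0 < 1 / 2 - 1 / p := by
    rw [sub_pos]
    exact one_div_lt_one_div_of_lt (by norm_num) hp
  have h2 : 0 < x ^ 2 * y ^ 2 * ((y ^ (p - 2) - x ^ (p - 2)) * (1 / 2 - 1 / p)) :=
    mul_pos (by positivity) (mul_pos (sub_pos.2 hab) h1)
  convert h2 using 1
  ring

/-- Comparison of two increasing arcs that start from rest, stay below `1` and along which the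
potential is multiplied by the same factor. -/
theorem leftArc_time_lt (hp : 2 < p) (hl₁ : 0 < ℓ₁) (hl₂ : 0 < ℓ₂) (h₁ : IsTraj p ℓ₁ u₁ v₁)
    (h₂ : IsTraj p ℓ₂ u₂ v₂) (hv₁ : ∀ x ∈ Ioc 0 ℓ₁, 0 < v₁ x) (hv₂ : ∀ x ∈ Ioc 0 ℓ₂, 0 < v₂ x)
    (h0₁ : v₁ 0 = 0) (h0₂ : v₂ 0 = 0) (hu : u₁ 0 < u₂ 0) (hz : u₁ ℓ₁ < u₂ ℓ₂) (hz1 : u₂ ℓ₂ ≤ 1)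
    (hf : potential p (u₁ 0) * potential p (u₂ ℓ₂) = potential p (u₂ 0) * potential p (u₁ ℓ₁)) :
    ℓ₁ < ℓ₂ := by
  by_contra! hle
  have h₁' := h₁.restrict hle
  have hs : Icc 0 ℓ₂ ⊆ Icc 0 ℓ₁ := Icc_subset_Icc_right hle
  have hm₁ := h₁.strictMonoOn fun x hx => hv₁ x (Ioo_subset_Ioc_self hx)
  have hm₂ := h₂.strictMonoOn fun x hx => hv₂ x (Ioo_subset_Ioc_self hx)
  have I0 : (0 : ℝ) ∈ Icc 0 ℓ₂ := ⟨le_rfl, hl₂.le⟩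
  have I2 : ℓ₂ ∈ Icc 0 ℓ₂ := ⟨hl₂.le, le_rfl⟩
  have I1 : ℓ₁ ∈ Icc 0 ℓ₁ := ⟨hl₁.le, le_rfl⟩
  have hend : u₁ ℓ₂ ≤ u₁ ℓ₁ := hm₁.monotoneOn (hs I2) I1 hle
  have hle1 : ∀ x ∈ Icc 0 ℓ₂, u₂ x ≤ 1 := fun x hx => (hm₂.monotoneOn hx I2 hx.2).trans hz1
  have hv₁n : ∀ x ∈ Icc 0 ℓ₁, 0 ≤ v₁ x := fun x hx => by
    rcases hx.1.eq_or_lt with rfl | h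
    · exact h0₁.ge
    · exact (hv₁ x ⟨h, hx.2⟩).le
  have hc : potential p (u₁ 0) < potential p (u₂ 0) :=
    strictMonoOn_potential hp ⟨(h₁'.pos 0 I0).le, hu.le.trans (hle1 0 I0)⟩
      ⟨(h₂.pos 0 I0).le, hle1 0 I0⟩ hu
  -- Followed backwards from `ℓ₂`, where `u₂` is above: at a meeting point `u₂` is slower, since the
  -- potential at its starting point is larger, so backwards in time the gap has positive derivative
  -- there.
  have hpos : ∀ x ∈ Icc 0 ℓ₂, 0 < u₂ (ℓ₂ - x) - u₁ (ℓ₂ - x) :=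
    pos_of_deriv_pos_at_zeros (D := fun x => u₂ (ℓ₂ - x) - u₁ (ℓ₂ - x))
      (D' := fun x => -v₂ (ℓ₂ - x) - -v₁ (ℓ₂ - x))
      (fun x hx => (h₂.reverse.hu x hx).sub (h₁'.reverse.hu x hx))
      (by simp only [sub_zero]; linarith) fun x hx he => by
        have hx' : ℓ₂ - x ∈ Icc 0 ℓ₂ := ⟨by linarith [hx.2], by linarith [hx.1]⟩
        have e1 := h₁'.energy hp hx'
        have e2 := h₂.energy hp hx'
        rw [sub_eq_zero] at he
        rw [he] at e2
        rw [h0₁] at e1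
        rw [h0₂] at e2
        have := lt_of_pow_lt_pow_left₀ 2 (hv₁n _ (hs hx'))
          (show v₂ (ℓ₂ - x) ^ 2 < v₁ (ℓ₂ - x) ^ 2 by linarith)
        linarith
  have hlt : ∀ x ∈ Icc 0 ℓ₂, u₁ x < u₂ x := fun x hx => by
    have := hpos (ℓ₂ - x) ⟨by linarith [hx.2], by linarith [hx.1]⟩
    rw [sub_sub_cancel] at this
    exact sub_pos.1 this
  have hW := strictMonoOn_wronskian hp h₁' h₂ hlt
  have hfpos₂ : ∀ x ∈ Icc 0 ℓ₂, 0 < potential p (u₂ x) := fun x hx =>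
    potential_pos hp ⟨h₂.pos x hx, (hle1 x hx).trans_lt (one_lt_solitonMax hp)⟩
  have hfpos₁ : ∀ x ∈ Icc 0 ℓ₂, 0 < potential p (u₁ x) := fun x hx =>
    potential_pos hp ⟨h₁'.pos x hx, ((hlt x hx).le.trans (hle1 x hx)).trans_lt
      (one_lt_solitonMax hp)⟩
  -- The logarithmic derivative of `f(u)` is the elasticity at `u` times `v / u`. The first factor
  -- is larger for `u₁` by `elasticity_lt`, the second by the Wronskian, which starts from `0`. By
  -- `hf`, the quotient at time `0` equals `f(u₁ ℓ₁) / f(u₂ ℓ₂)`, which is incompatible with this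
  -- growth if `ℓ₂ ≤ ℓ₁`.
  have hQ : StrictMonoOn (fun x => potential p (u₁ x) / potential p (u₂ x)) (Icc 0 ℓ₂) := by
    refine strictMonoOn_of_hasDerivWithinAt_pos (f' := fun x =>
      ((u₁ x - u₁ x ^ (p - 1)) * v₁ x * potential p (u₂ x) -
        potential p (u₁ x) * ((u₂ x - u₂ x ^ (p - 1)) * v₂ x)) / potential p (u₂ x) ^ 2)
      (convex_Icc 0 ℓ₂)
      (((continuous_potential hp).comp_continuousOn h₁'.continuousOn_fst).div
        ((continuous_potential hp).comp_continuousOn h₂.continuousOn_fst)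
        fun x hx => (hfpos₂ x hx).ne') (fun x hx => ?_) (fun x hx => ?_)
    all_goals rw [interior_Icc] at hx
    all_goals have hI := Ioo_subset_Icc_self hx
    · exact (((hasDerivAt_potential_of_pos hp (h₁'.pos x hI)).comp x (h₁'.hasDerivAt_fst hx)).div
        ((hasDerivAt_potential_of_pos hp (h₂.pos x hI)).comp x (h₂.hasDerivAt_fst hx))
        (hfpos₂ x hI).ne').hasDerivWithinAt
    · refine div_pos ?_ (by have := hfpos₂ x hI; positivity)
      have w0 := hW I0 hI hx.1
      simp only [h0₁, h0₂, zero_mul, mul_zero, sub_zero] at w0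
      have e1 := elasticity_lt hp (h₁'.pos x hI) (hlt x hI)
      have p1 := h₁'.pos x hI
      have p2 := h₂.pos x hI
      have q2 := hv₂ x ⟨hx.1, hx.2.le⟩
      have hF2 : 0 ≤ u₂ x - u₂ x ^ (p - 1) := by
        rcases (hle1 x hI).eq_or_lt with h | h
        · simp [h]
        · linarith [rpow_lt_self hp p2 h]
      have hB : 0 ≤ u₂ x * (u₂ x - u₂ x ^ (p - 1)) * potential p (u₁ x) :=
        mul_nonneg (mul_nonneg p2.le hF2) (hfpos₁ x hI).le
      have hw : u₁ x * v₂ x < v₁ x * u₂ x := by linarith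
      have key := mul_lt_mul'' e1 hw hB (mul_pos p1 q2).le
      refine pos_of_mul_pos_right (b := _) (a := u₁ x * u₂ x) ?_ (mul_pos p1 p2).le
      linear_combination key
  have h3 := hQ I0 I2 hl₂
  have h4 : potential p (u₁ ℓ₂) ≤ potential p (u₁ ℓ₁) :=
    (strictMonoOn_potential hp).monotoneOn ⟨(h₁.pos _ (hs I2)).le, by linarith⟩
      ⟨(h₁.pos _ I1).le, by linarith⟩ hend
  simp only at h3
  rw [div_lt_div_iff₀ (hfpos₂ 0 I0) (hfpos₂ ℓ₂ I2), hf, mul_comm] at h3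
  have := lt_of_mul_lt_mul_left (show potential p (u₂ 0) * potential p (u₁ ℓ₁) <
    potential p (u₂ 0) * potential p (u₁ ℓ₂) by linarith) (hfpos₂ 0 I0).le
  linarith

end Picone

/-! ### The Box–Cox transform -/

section BoxCox

/-- The primitive of `x ↦ x^(μ-1)` on `(0, ∞)` that vanishes at `1`. -/
def boxCox (μ x : ℝ) : ℝ := open Classical in if μ = 0 then Real.log x else (x ^ μ - 1) / μ

/-- The inverse of the Box–Cox transform. -/
def invBoxCox (μ y : ℝ) : ℝ := open Classical in if μ = 0 then Real.exp y else (1 + μ * y) ^ (1 / μ)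

variable {μ x y : ℝ}

lemma boxCox_one : boxCox μ 1 = 0 := by
  unfold boxCox
  split_ifs <;> simp

lemma hasDerivAt_boxCox (hx : 0 < x) : HasDerivAt (boxCox μ) (x ^ (μ - 1)) x := by
  by_cases h : μ = 0
  · have : boxCox μ = Real.log := by
      ext y
      simp [boxCox, h]
    rw [this, h, zero_sub, Real.rpow_neg_one]
    exact Real.hasDerivAt_log hx.ne'
  · have : boxCox μ = fun y => (y ^ μ - 1) / μ := by
      ext y
      simp [boxCox, h]
    rw [this]
    refine (((Real.hasDerivAt_rpow_const (Or.inl hx.ne')).sub_const 1).div_const μ).congr_deriv ?_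
    field_simp

lemma strictMonoOn_boxCox : StrictMonoOn (boxCox μ) (Ioi 0) := by
  refine strictMonoOn_of_hasDerivWithinAt_pos (f' := fun x => x ^ (μ - 1)) (convex_Ioi 0)
    (fun x hx => (hasDerivAt_boxCox hx).continuousAt.continuousWithinAt) (fun x hx => ?_)
    (fun x hx => ?_)
  all_goals rw [interior_Ioi] at hx
  · exact (hasDerivAt_boxCox hx).hasDerivWithinAt
  · exact Real.rpow_pos_of_pos hx _

lemma boxCox_pos (hx : 1 < x) : 0 < boxCox μ x := by
  have := strictMonoOn_boxCox (μ := μ) (mem_Ioi.2 one_pos) (mem_Ioi.2 (one_pos.trans hx)) hx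
  rwa [boxCox_one] at this

lemma boxCox_neg (hx : 0 < x) (hx1 : x < 1) : boxCox μ x < 0 := by
  have := strictMonoOn_boxCox (μ := μ) (mem_Ioi.2 hx) (mem_Ioi.2 one_pos) hx1
  rwa [boxCox_one] at this

/-- Makes `x^μ` an affine function of `boxCox μ x` for all `μ` at once, including `μ = 0`, which
occurs for `p = 4`. -/
lemma one_add_mul_boxCox : 1 + μ * boxCox μ x = x ^ μ := by
  unfold boxCox
  split_ifs with h
  · simp [h]
  · field_simp
    ring

/-- Homogeneity: up to the factor `x^μ` the difference depends on the ratio only. This is why the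
normalised equation of an orbit involves the ratio of its end-points and nothing else. -/
lemma boxCox_sub_boxCox (hx : 0 < x) (hy : 0 < y) :
    boxCox μ y - boxCox μ x = x ^ μ * boxCox μ (y / x) := by
  unfold boxCox
  split_ifs with h
  · rw [h, Real.rpow_zero, one_mul, Real.log_div hy.ne' hx.ne']
  · rw [Real.div_rpow hy.le hx.le]
    have := (Real.rpow_pos_of_pos hx μ).ne'
    field_simp
    ring

lemma invBoxCox_boxCox (hx : 0 < x) : invBoxCox μ (boxCox μ x) = x := by
  by_cases h : μ = 0
  · simp [invBoxCox, boxCox, h, Real.exp_log hx]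
  · have := one_add_mul_boxCox (μ := μ) (x := x)
    simp only [invBoxCox, h, if_false, this]
    rw [← Real.rpow_mul hx.le, mul_one_div_cancel h, Real.rpow_one]

lemma invBoxCox_pos (hy : 0 < 1 + μ * y) : 0 < invBoxCox μ y := by
  unfold invBoxCox
  split_ifs
  · exact Real.exp_pos y
  · exact Real.rpow_pos_of_pos hy _

lemma invBoxCox_rpow (hy : 0 < 1 + μ * y) : invBoxCox μ y ^ μ = 1 + μ * y := by
  unfold invBoxCox
  split_ifs with h
  · simp [h]
  · rw [← Real.rpow_mul hy.le, one_div_mul_cancel h, Real.rpow_one]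

lemma hasDerivAt_invBoxCox (hy : 0 < 1 + μ * y) :
    HasDerivAt (invBoxCox μ) (invBoxCox μ y ^ (1 - μ)) y := by
  by_cases h : μ = 0
  · have : invBoxCox μ = Real.exp := by
      ext y
      simp [invBoxCox, h]
    rw [this, h, sub_zero, Real.rpow_one]
    exact Real.hasDerivAt_exp y
  · have : invBoxCox μ = fun y => (1 + μ * y) ^ (1 / μ) := by
      ext y
      simp [invBoxCox, h]
    rw [this]
    have h1 : HasDerivAt (fun y => 1 + μ * y) μ y := by
      simpa using ((hasDerivAt_id y).const_mul μ).const_add 1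
    refine (h1.rpow_const (Or.inl hy.ne')).congr_deriv ?_
    rw [← Real.rpow_mul hy.le, show 1 / μ * (1 - μ) = 1 / μ - 1 by field_simp]
    field_simp

end BoxCox

/-! ### Monotonicity of the period -/

/-- An increasing trajectory that starts and ends at rest. -/
structure IsRestArc (p ℓ : ℝ) (u v : ℝ → ℝ) : Prop where
  traj : IsTraj p ℓ u v
  len : 0 < ℓ
  left : v 0 = 0
  right : v ℓ = 0
  vel : ∀ x ∈ Ioo 0 ℓ, 0 < v x

namespace IsRestArc

variable {p ℓ ℓ₁ ℓ₂ : ℝ} {u v u₁ v₁ u₂ v₂ : ℝ → ℝ}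

lemma left_mem (h : IsRestArc p ℓ u v) : (0 : ℝ) ∈ Icc 0 ℓ := ⟨le_rfl, h.len.le⟩

lemma right_mem (h : IsRestArc p ℓ u v) : ℓ ∈ Icc 0 ℓ := ⟨h.len.le, le_rfl⟩

lemma strictMonoOn (h : IsRestArc p ℓ u v) : StrictMonoOn u (Icc 0 ℓ) := h.traj.strictMonoOn h.vel

lemma lt (h : IsRestArc p ℓ u v) : u 0 < u ℓ := h.strictMonoOn h.left_mem h.right_mem h.len

lemma zero_lt (h : IsRestArc p ℓ u v) : 0 < u 0 := h.traj.pos 0 h.left_mem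

lemma potential_eq (hp : 2 < p) (h : IsRestArc p ℓ u v) :
    potential p (u ℓ) = potential p (u 0) := by
  have := h.traj.energy hp h.right_mem
  rw [h.left, h.right] at this
  linarith

lemma sq_eq (hp : 2 < p) (h : IsRestArc p ℓ u v) {x : ℝ} (hx : x ∈ Icc 0 ℓ) :
    v x ^ 2 = 2 * (potential p (u x) - potential p (u 0)) := by
  have := h.traj.energy hp hx
  rw [h.left] at this
  linarith

lemma lt_one (hp : 2 < p) (h : IsRestArc p ℓ u v) : u 0 < 1 := by
  by_contra! h1
  exact (strictAntiOn_potential hp h1 (h1.trans h.lt.le) h.lt).ne (h.potential_eq hp)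

lemma one_lt (hp : 2 < p) (h : IsRestArc p ℓ u v) : 1 < u ℓ := by
  by_contra! h1
  exact (strictMonoOn_potential hp ⟨h.zero_lt.le, h.lt.le.trans h1⟩
    ⟨(h.zero_lt.trans h.lt).le, h1⟩ h.lt).ne' (h.potential_eq hp)

lemma mem_Ioo (h : IsRestArc p ℓ u v) {x : ℝ} (hx : x ∈ Ioo 0 ℓ) : u x ∈ Ioo (u 0) (u ℓ) :=
  ⟨h.strictMonoOn h.left_mem (Ioo_subset_Icc_self hx) hx.1,
    h.strictMonoOn (Ioo_subset_Icc_self hx) h.right_mem hx.2⟩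

lemma potential_lt (hp : 2 < p) (h : IsRestArc p ℓ u v) {w : ℝ} (hw : w ∈ Ioo (u 0) (u ℓ)) :
    potential p (u 0) < potential p w := by
  rcases le_total w 1 with h1 | h1
  · exact strictMonoOn_potential hp ⟨h.zero_lt.le, (h.lt_one hp).le⟩
      ⟨(h.zero_lt.trans hw.1).le, h1⟩ hw.1
  · rw [← h.potential_eq hp]
    exact strictAntiOn_potential hp h1 (h.one_lt hp).le hw.2

end IsRestArc

/-! ### The normalised speed of an arc from rest to rest. -/

section Normalize

variable {p c : ℝ}

/-- The squared speed of `boxCox μ u` on a trajectory with energy `c`. -/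
def boxCoxSpeedSq (p c μ w : ℝ) : ℝ :=
  w ^ (2 * μ) - 2 / p * w ^ (p + 2 * μ - 2) - 2 * c * w ^ (2 * μ - 2)

lemma boxCoxSpeedSq_eq (μ : ℝ) {w : ℝ} (hw : 0 < w) :
    boxCoxSpeedSq p c μ w = (w ^ (μ - 1)) ^ 2 * (2 * (potential p w - c)) := by
  have e1 : (w ^ (μ - 1)) ^ 2 = w ^ (2 * μ - 2) := by
    rw [← Real.rpow_natCast, ← Real.rpow_mul hw.le]
    congr 1
    push_cast
    ring
  have e2 : w ^ (2 * μ) = w ^ (2 * μ - 2) * w ^ 2 := by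
    rw [← Real.rpow_natCast w 2, ← Real.rpow_add hw]
    congr 1
    push_cast
    ring
  have e3 : w ^ (p + 2 * μ - 2) = w ^ (2 * μ - 2) * w ^ p := by
    rw [← Real.rpow_add hw]
    congr 1
    ring
  rw [boxCoxSpeedSq, potential_of_nonneg hw.le, e1, e2, e3]
  ring

/-- The derivative of the squared speed with respect to `boxCox μ u`. -/
def boxCoxSpeedSqDeriv (p c μ w : ℝ) : ℝ :=
  2 * μ * w ^ μ - 2 / p * (p + 2 * μ - 2) * w ^ (p - 2 + μ) - 2 * c * (2 * μ - 2) * w ^ (μ - 2)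

lemma hasDerivAt_boxCoxSpeedSq (μ : ℝ) {w : ℝ} (hw : 0 < w) :
    HasDerivAt (boxCoxSpeedSq p c μ) (boxCoxSpeedSqDeriv p c μ w * w ^ (μ - 1)) w := by
  have h : ∀ q : ℝ, HasDerivAt (fun w : ℝ => w ^ q) (q * w ^ (q - 1)) w := fun q =>
    Real.hasDerivAt_rpow_const (Or.inl hw.ne')
  refine (((h (2 * μ)).sub ((h (p + 2 * μ - 2)).const_mul (2 / p))).sub
    ((h (2 * μ - 2)).const_mul (2 * c))).congr_deriv ?_
  have e1 : w ^ (2 * μ - 1) = w ^ μ * w ^ (μ - 1) := by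
    rw [← Real.rpow_add hw]
    congr 1
    ring
  have e2 : w ^ (p + 2 * μ - 2 - 1) = w ^ (p - 2 + μ) * w ^ (μ - 1) := by
    rw [← Real.rpow_add hw]
    congr 1
    ring
  have e3 : w ^ (2 * μ - 2 - 1) = w ^ (μ - 2) * w ^ (μ - 1) := by
    rw [← Real.rpow_add hw]
    congr 1
    ring
  rw [boxCoxSpeedSqDeriv, e1, e2, e3]
  ring

/-- With `S` the squared speed and `y = boxCox μ w`, each of the three powers in `d²S/dy²` is
`w^(-2μ)` times the one in `S`, with a new coefficient. The exponent `μ = (4 - p) / 3` is the one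
for which the multipliers `(p + 2μ - 2)(p - 2 + μ)` and `(2μ - 2)(μ - 2)` coincide, with common
value `2 (p - 1)(p + 2) / 9`. What is left over from the first term is the constant `-2 (p - 2)`,
and the energy `c` enters only through `S`. -/
lemma hasDerivAt_boxCoxSpeedSqDeriv (hp : 2 < p) {w : ℝ} (hw : 0 < w) :
    HasDerivAt (boxCoxSpeedSqDeriv p c ((4 - p) / 3))
      ((2 * (p - 1) * (p + 2) / 9 * boxCoxSpeedSq p c ((4 - p) / 3) w / (w ^ ((4 - p) / 3)) ^ 2
        - 2 * (p - 2)) * w ^ ((4 - p) / 3 - 1)) w := by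
  set μ := (4 - p) / 3 with hμ
  have hp0 : p ≠ 0 := by linarith
  have h : ∀ q : ℝ, HasDerivAt (fun w : ℝ => w ^ q) (q * w ^ (q - 1)) w := fun q =>
    Real.hasDerivAt_rpow_const (Or.inl hw.ne')
  refine ((((h μ).const_mul (2 * μ)).sub ((h (p - 2 + μ)).const_mul (2 / p * (p + 2 * μ - 2)))).sub
    ((h (μ - 2)).const_mul (2 * c * (2 * μ - 2)))).congr_deriv ?_
  have e0 : (w ^ μ) ^ 2 = w ^ (2 * μ) := by
    rw [← Real.rpow_natCast, ← Real.rpow_mul hw.le]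
    congr 1
    push_cast
    ring
  have e1 : w ^ (p + 2 * μ - 2) = w ^ (2 * μ) * w ^ (p - 2) := by
    rw [← Real.rpow_add hw]
    congr 1
    ring
  have e2 : w ^ (2 * μ - 2) = w ^ (2 * μ) * w ^ (-2 : ℝ) := by
    rw [← Real.rpow_add hw]
    congr 1
  have e3 : w ^ (p - 2 + μ - 1) = w ^ (p - 2) * w ^ (μ - 1) := by
    rw [← Real.rpow_add hw]
    congr 1
    ring
  have e4 : w ^ (μ - 2 - 1) = w ^ (-2 : ℝ) * w ^ (μ - 1) := by
    rw [← Real.rpow_add hw]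
    congr 1
    ring
  have hne : w ^ (2 * μ) ≠ 0 := (Real.rpow_pos_of_pos hw _).ne'
  rw [boxCoxSpeedSq, e0, e1, e2, e3, e4]
  have e5 : 2 * (p - 1) * (p + 2) / 9 * (w ^ (2 * μ) - 2 / p * (w ^ (2 * μ) * w ^ (p - 2)) -
      2 * c * (w ^ (2 * μ) * w ^ (-2 : ℝ))) / w ^ (2 * μ) =
      2 * (p - 1) * (p + 2) / 9 * (1 - 2 / p * w ^ (p - 2) - 2 * c * w ^ (-2 : ℝ)) := by
    field_simp
  rw [e5, hμ]
  ring

/-- Normalisation of a rest arc: an affine function `σ` of `boxCox μ u` runs from `0` to `1` with a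
squared speed `N(σ)` that solves a linear equation depending on the ratio of the end-points only. -/
theorem IsRestArc.normalize (hp : 2 < p) {ℓ : ℝ} {u v : ℝ → ℝ} (h : IsRestArc p ℓ u v) :
    ∃ N N' σ s : ℝ → ℝ, ContinuousOn N (Icc 0 1) ∧ N 0 = 0 ∧ N 1 = 0 ∧
      (∀ t ∈ Ioo (0 : ℝ) 1, 0 < N t) ∧ (∀ t ∈ Ioo (0 : ℝ) 1, HasDerivAt N (N' t) t) ∧
      (∀ t ∈ Ioo (0 : ℝ) 1, HasDerivAt N' (2 * (p - 1) * (p + 2) / 9 * N t /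
        ((1 - t) / boxCox ((4 - p) / 3) (u ℓ / u 0) - t / boxCox ((4 - p) / 3) (u 0 / u ℓ)) ^ 2
        - 2 * (p - 2)) t) ∧
      ContinuousOn σ (Icc 0 ℓ) ∧ σ 0 = 0 ∧ σ ℓ = 1 ∧ (∀ x ∈ Ioo 0 ℓ, σ x ∈ Ioo (0 : ℝ) 1) ∧
      ∀ x ∈ Ioo 0 ℓ, HasDerivAt σ (s x) x ∧ 0 < s x ∧ s x ^ 2 = N (σ x) := by
  set μ := (4 - p) / 3 with hμ
  set n := u 0
  set m := u ℓ
  have hn : 0 < n := h.zero_lt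
  have hnm : n < m := h.lt
  have hm : 0 < m := hn.trans hnm
  set a := boxCox μ n
  set Δ := boxCox μ m - boxCox μ n with hΔ
  have hΔ0 : 0 < Δ := sub_pos.2 (strictMonoOn_boxCox hn hm hnm)
  set c := potential p n
  set W : ℝ → ℝ := fun t => invBoxCox μ (a + t * Δ) with hW
  -- Thus `W^μ` is affine in `t`, with values `n^μ` and `m^μ` at the ends.
  have hlin : ∀ t, 1 + μ * (a + t * Δ) = (1 - t) * n ^ μ + t * m ^ μ := fun t => by
    rw [← one_add_mul_boxCox (μ := μ) (x := n), ← one_add_mul_boxCox (μ := μ) (x := m), hΔ]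
    ring
  have hlpos : ∀ t ∈ Icc (0 : ℝ) 1, 0 < 1 + μ * (a + t * Δ) := fun t ht => by
    rw [hlin]
    have h1 := Real.rpow_pos_of_pos hn μ
    have h2 := Real.rpow_pos_of_pos hm μ
    rcases ht.1.eq_or_lt with rfl | h3
    · simpa using h1
    · nlinarith [ht.2, mul_pos h3 h2, mul_nonneg (sub_nonneg.2 ht.2) h1.le]
  have hW0 : ∀ t ∈ Icc (0 : ℝ) 1, 0 < W t := fun t ht => invBoxCox_pos (hlpos t ht)
  have hWinv : ∀ x > 0, W ((boxCox μ x - a) / Δ) = x := fun x hx => by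
    have : a + (boxCox μ x - a) / Δ * Δ = boxCox μ x := by
      field_simp
      ring
    simp only [hW, this]
    exact invBoxCox_boxCox hx
  have hWin : W 0 = n := by
    have := hWinv n hn
    simpa [a] using this
  have hWim : W 1 = m := by
    have := hWinv m hm
    rwa [div_self hΔ0.ne'] at this
  have hWI : ∀ t ∈ Ioo (0 : ℝ) 1, W t ∈ Ioo n m := fun t ht => by
    have h1 : a + t * Δ ∈ Ioo (boxCox μ n) (boxCox μ m) :=
      ⟨by linarith [mul_pos ht.1 hΔ0], by nlinarith [ht.2]⟩
    obtain ⟨x, hx, hxe⟩ := intermediate_value_Ioo hnm.le (fun x hx =>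
      (hasDerivAt_boxCox (hn.trans_le hx.1)).continuousAt.continuousWithinAt) h1
    have : W t = x := by
      simp only [hW]
      rw [← hxe]
      exact invBoxCox_boxCox (hn.trans hx.1)
    rwa [this]
  have hWd : ∀ t ∈ Icc (0 : ℝ) 1, HasDerivAt W (W t ^ (1 - μ) * Δ) t := fun t ht => by
    have h1 : HasDerivAt (fun t => a + t * Δ) Δ t := by
      simpa using ((hasDerivAt_id t).mul_const Δ).const_add a
    exact (hasDerivAt_invBoxCox (hlpos t ht)).comp t h1
  set N : ℝ → ℝ := fun t => boxCoxSpeedSq p c μ (W t) / Δ ^ 2 with hN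
  set N' : ℝ → ℝ := fun t => boxCoxSpeedSqDeriv p c μ (W t) / Δ with hN'
  have hNe : ∀ t ∈ Icc (0 : ℝ) 1,
      N t = (W t ^ (μ - 1)) ^ 2 * (2 * (potential p (W t) - c)) / Δ ^ 2 :=
    fun t ht => by simp only [hN, boxCoxSpeedSq_eq μ (hW0 t ht)]
  have hcancel : ∀ t ∈ Icc (0 : ℝ) 1, W t ^ (μ - 1) * W t ^ (1 - μ) = 1 := fun t ht => by
    rw [← Real.rpow_add (hW0 t ht)]
    simp
  have hNd : ∀ t ∈ Icc (0 : ℝ) 1, HasDerivAt N (N' t) t := fun t ht => by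
    refine (((hasDerivAt_boxCoxSpeedSq μ (hW0 t ht)).comp t (hWd t ht)).div_const
      (Δ ^ 2)).congr_deriv ?_
    rw [show boxCoxSpeedSqDeriv p c μ (W t) * W t ^ (μ - 1) * (W t ^ (1 - μ) * Δ) =
      boxCoxSpeedSqDeriv p c μ (W t) * (W t ^ (μ - 1) * W t ^ (1 - μ)) * Δ by ring, hcancel t ht]
    simp only [hN']
    field_simp
  have hσpos : ∀ x ∈ Icc 0 ℓ, 0 < u x := h.traj.pos
  refine ⟨N, N', fun x => (boxCox μ (u x) - a) / Δ, fun x => u x ^ (μ - 1) * v x / Δ,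
    fun t ht => (hNd t ht).continuousAt.continuousWithinAt, ?_, ?_, ?_,
    fun t ht => hNd t (Ioo_subset_Icc_self ht), ?_, ?_, by simp [a, n], by simp [m, ← hΔ, a, hΔ0.ne'], ?_, ?_⟩
  · rw [hNe 0 (by simp), hWin]
    simp [c]
  · rw [hNe 1 (by simp), hWim, h.potential_eq hp]
    simp [c, n]
  · intro t ht
    rw [hNe t (Ioo_subset_Icc_self ht)]
    have h1 := h.potential_lt hp (hWI t ht)
    have h2 := Real.rpow_pos_of_pos (hW0 t (Ioo_subset_Icc_self ht)) (μ - 1)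
    have h3 : 0 < potential p (W t) - c := sub_pos.2 h1
    positivity
  · intro t ht
    have htI := Ioo_subset_Icc_self ht
    have hd := ((hasDerivAt_boxCoxSpeedSqDeriv (c := c) hp (hW0 t htI)).comp t
      (hWd t htI)).div_const Δ
    rw [← hμ] at hd
    refine hd.congr_deriv ?_
    have hR : 1 < m / n := (one_lt_div hn).2 hnm
    have hR' : n / m < 1 := (div_lt_one hm).2 hnm
    have e1 : Δ = n ^ μ * boxCox μ (m / n) := boxCox_sub_boxCox hn hm
    have e2 : Δ = -(m ^ μ * boxCox μ (n / m)) := by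
      rw [← boxCox_sub_boxCox hm hn]
      ring
    have b1 : boxCox μ (m / n) ≠ 0 := by
      intro h0
      rw [h0, mul_zero] at e1
      exact hΔ0.ne' e1
    have b2 : boxCox μ (n / m) ≠ 0 := by
      intro h0
      rw [h0, mul_zero, neg_zero] at e2
      exact hΔ0.ne' e2
    have hne : 0 < W t ^ μ := Real.rpow_pos_of_pos (hW0 t htI) μ
    -- The affine function `W^μ / Δ` has end values `n^μ / Δ` and `m^μ / Δ`; by `e1` and `e2` these
    -- depend on `m / n` only.
    have e3 : (1 - t) / boxCox μ (m / n) - t / boxCox μ (n / m) = W t ^ μ / Δ := by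
      have e4 : W t ^ μ = (1 - t) * n ^ μ + t * m ^ μ := by
        rw [← hlin]
        exact invBoxCox_rpow (hlpos t htI)
      rw [e4, add_div]
      nth_rewrite 1 [e1]
      rw [e2]
      have := (Real.rpow_pos_of_pos hn μ).ne'
      have := (Real.rpow_pos_of_pos hm μ).ne'
      field_simp
      ring
    rw [e3]
    rw [show ∀ X : ℝ, X * W t ^ (μ - 1) * (W t ^ (1 - μ) * Δ) / Δ =
      X * (W t ^ (μ - 1) * W t ^ (1 - μ)) * (Δ / Δ) from fun X => by ring, hcancel t htI,
      div_self hΔ0.ne']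
    simp only [hN]
    field_simp
  · refine ContinuousOn.div_const (ContinuousOn.sub (fun x hx => ?_) continuousOn_const) _
    exact (hasDerivAt_boxCox (hσpos x hx)).continuousAt.comp_continuousWithinAt
      (h.traj.continuousOn_fst x hx)
  · intro x hx
    have h1 := h.mem_Ioo hx
    have h2 := strictMonoOn_boxCox (μ := μ) hn (hn.trans h1.1) h1.1
    have h3 := strictMonoOn_boxCox (μ := μ) (hn.trans h1.1) hm h1.2
    refine ⟨div_pos (sub_pos.2 h2) hΔ0, (div_lt_one hΔ0).2 ?_⟩
    rw [hΔ]
    exact sub_lt_sub_right h3 _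
  · intro x hx
    have hxI := Ioo_subset_Icc_self hx
    have hux := hσpos x hxI
    have hr := Real.rpow_pos_of_pos hux (μ - 1)
    refine ⟨(((hasDerivAt_boxCox hux).comp x (h.traj.hasDerivAt_fst hx)).sub_const a).div_const Δ,
      div_pos (mul_pos hr (h.vel x hx)) hΔ0, ?_⟩
    have h1 := h.mem_Ioo hx
    have h2 := strictMonoOn_boxCox (μ := μ) hn (hn.trans h1.1) h1.1
    have h3 := strictMonoOn_boxCox (μ := μ) (hn.trans h1.1) hm h1.2
    rw [hNe _ ⟨div_nonneg (sub_pos.2 h2).le hΔ0.le, (div_le_one hΔ0).2 (by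
      rw [hΔ]
      exact (sub_lt_sub_right h3 _).le)⟩, hWinv _ hux, ← h.sq_eq hp hxI]
    field_simp

end Normalize

namespace IsRestArc

variable {p ℓ ℓ₁ ℓ₂ : ℝ} {u v u₁ v₁ u₂ v₂ : ℝ → ℝ}

/-- The larger the orbit, the longer the half-period. -/
theorem time_lt (hp : 2 < p) (h₁ : IsRestArc p ℓ₁ u₁ v₁) (h₂ : IsRestArc p ℓ₂ u₂ v₂)
    (hu : u₁ 0 < u₂ 0) : ℓ₂ < ℓ₁ := by
  have hm : u₂ ℓ₂ < u₁ ℓ₁ := by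
    by_contra! hle
    have e1 := (strictAntiOn_potential hp).antitoneOn (h₁.one_lt hp).le (h₂.one_lt hp).le hle
    rw [h₁.potential_eq hp, h₂.potential_eq hp] at e1
    exact absurd e1 (not_le.2 (strictMonoOn_potential hp ⟨h₁.zero_lt.le, (h₁.lt_one hp).le⟩
      ⟨h₂.zero_lt.le, (h₂.lt_one hp).le⟩ hu))
  obtain ⟨N₁, N₁', σ₁, s₁, c₁, a₁, b₁, p₁, d₁, dd₁, sc₁, sa₁, sb₁, si₁, sd₁⟩ := h₁.normalize hp
  obtain ⟨N₂, N₂', σ₂, s₂, c₂, a₂, b₂, p₂, d₂, dd₂, sc₂, sa₂, sb₂, si₂, sd₂⟩ := h₂.normalize hp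
  set μ := (4 - p) / 3
  have hn₁ := h₁.zero_lt
  have hn₂ := h₂.zero_lt
  have hm₁ : 0 < u₁ ℓ₁ := hn₁.trans h₁.lt
  have hm₂ : 0 < u₂ ℓ₂ := hn₂.trans h₂.lt
  have hY : StrictMonoOn (boxCox μ) (Ioi 0) := strictMonoOn_boxCox
  have r1 : boxCox μ (u₂ ℓ₂ / u₂ 0) < boxCox μ (u₁ ℓ₁ / u₁ 0) :=
    hY (div_pos hm₂ hn₂) (div_pos hm₁ hn₁) (div_lt_div₀ hm hu.le hm₁.le hn₁)
  have r2 : boxCox μ (u₁ 0 / u₁ ℓ₁) < boxCox μ (u₂ 0 / u₂ ℓ₂) :=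
    hY (div_pos hn₁ hm₁) (div_pos hn₂ hm₂) (div_lt_div₀ hu hm.le hn₂.le hm₂)
  have r3 : 0 < boxCox μ (u₂ ℓ₂ / u₂ 0) := boxCox_pos ((one_lt_div hn₂).2 h₂.lt)
  have r4 : boxCox μ (u₂ 0 / u₂ ℓ₂) < 0 :=
    boxCox_neg (div_pos hn₂ hm₂) ((div_lt_one hm₂).2 h₂.lt)
  -- The larger orbit has the larger ratio, hence the smaller denominator `A < B`. Where `N₂ ≤ N₁`
  -- the equations then give `(N₂ - N₁)'' < 0`, and the maximum principle applies. So the larger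
  -- orbit is slower at every normalised height.
  have key : ∀ t ∈ Ioo (0 : ℝ) 1, 0 < N₂ t - N₁ t := by
    refine pos_of_second_deriv_neg (D := fun t => N₂ t - N₁ t) (c₂.sub c₁)
      (fun t ht => (d₂ t ht).sub (d₁ t ht)) (fun t ht => (dd₂ t ht).sub (dd₁ t ht))
      (by simp [a₁, a₂]) (by simp [b₁, b₂]) fun t ht hle => ?_
    have hN : N₂ t ≤ N₁ t := by linarith
    have q1 : (1 - t) / boxCox μ (u₁ ℓ₁ / u₁ 0) < (1 - t) / boxCox μ (u₂ ℓ₂ / u₂ 0) :=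
      div_lt_div_of_pos_left (by linarith [ht.2]) r3 r1
    have q2 : t / -boxCox μ (u₁ 0 / u₁ ℓ₁) < t / -boxCox μ (u₂ 0 / u₂ ℓ₂) :=
      div_lt_div_of_pos_left ht.1 (by linarith) (by linarith)
    have q3 : 0 < (1 - t) / boxCox μ (u₁ ℓ₁ / u₁ 0) := div_pos (by linarith [ht.2]) (r3.trans r1)
    have q4 : 0 < t / -boxCox μ (u₁ 0 / u₁ ℓ₁) := div_pos ht.1 (by linarith)
    rw [div_neg] at q2 q4
    rw [div_neg] at q2
    set A := (1 - t) / boxCox μ (u₁ ℓ₁ / u₁ 0) - t / boxCox μ (u₁ 0 / u₁ ℓ₁)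
    set B := (1 - t) / boxCox μ (u₂ ℓ₂ / u₂ 0) - t / boxCox μ (u₂ 0 / u₂ ℓ₂)
    have hA : 0 < A := by simp only [A]; linarith
    have hAB : A < B := by simp only [A, B]; linarith
    have hM : 0 < 2 * (p - 1) * (p + 2) / 9 :=
      div_pos (mul_pos (mul_pos two_pos (by linarith)) (by linarith)) (by norm_num)
    have h5 : 2 * (p - 1) * (p + 2) / 9 * N₂ t / B ^ 2 < 2 * (p - 1) * (p + 2) / 9 * N₁ t / A ^ 2 :=
      div_lt_div₀' (mul_le_mul_of_nonneg_left hN hM.le)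
        (pow_lt_pow_left₀ hAB hA.le two_ne_zero) (mul_pos hM (p₁ t ht)) (by positivity)
    linarith
  refine time_lt_of_speed_lt h₁.len h₂.len sc₁ sc₂ (fun x hx => (sd₁ x hx).1)
    (fun x hx => (sd₂ x hx).1) (fun x hx => (sd₁ x hx).2.1) (fun x hx => (sd₂ x hx).2.1) sa₁ sa₂
    sb₁ sb₂ fun x hx y hy hxy => ?_
  refine lt_of_pow_lt_pow_left₀ 2 (sd₂ y hy).2.1.le ?_
  rw [(sd₁ x hx).2.2, (sd₂ y hy).2.2, ← hxy]
  linarith [key _ (si₁ x hx)]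

end IsRestArc

/-- The model: half an oscillation of frequency `√A`, scaled to run from `0` to `1`, with squared
speed `A σ (1 - σ)` and duration `π / √A`. -/
lemma cosine_arc {A : ℝ} (hA : 0 < A) :
    0 < Real.pi / √A ∧ (∀ x, HasDerivAt (fun x => (1 - Real.cos (√A * x)) / 2)
      (√A * Real.sin (√A * x) / 2) x) ∧
    (∀ x ∈ Ioo 0 (Real.pi / √A), 0 < √A * Real.sin (√A * x) / 2) ∧
    (∀ x, (√A * Real.sin (√A * x) / 2) ^ 2 = A * ((1 - Real.cos (√A * x)) / 2) *
      (1 - (1 - Real.cos (√A * x)) / 2)) ∧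
    (1 - Real.cos (√A * 0)) / 2 = 0 ∧ (1 - Real.cos (√A * (Real.pi / √A))) / 2 = 1 := by
  have hs := Real.sqrt_pos.2 hA
  refine ⟨div_pos Real.pi_pos hs, fun x => ?_, fun x hx => ?_, fun x => ?_, by simp, ?_⟩
  · have h1 : HasDerivAt (fun x => √A * x) √A x := by
      simpa using (hasDerivAt_id x).const_mul √A
    exact (((h1.cos).const_sub 1).div_const 2).congr_deriv (by ring)
  · have h1 := (lt_div_iff₀ hs).1 hx.2
    have := Real.sin_pos_of_pos_of_lt_pi (mul_pos hs hx.1) (by linarith)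
    positivity
  · have h1 := Real.sin_sq_add_cos_sq (√A * x)
    have h2 := Real.sq_sqrt hA.le
    rw [div_pow, mul_pow, h2]
    linear_combination A / 4 * h1
  · rw [mul_div_cancel₀ _ hs.ne', Real.cos_pi]
    norm_num

namespace IsRestArc

variable {p ℓ : ℝ} {u v : ℝ → ℝ}

/-- The zero-order term of the normalised equation is positive, so `N'' > -2 (p - 2)` and `N` lies
strictly below the parabola `(p - 2) t (1 - t)`, which vanishes at the same end-points. The orbit is
slower than the cosine with `A = p - 2`. -/
theorem lt_len (hp : 2 < p) (h : IsRestArc p ℓ u v) : Real.pi / √(p - 2) < ℓ := by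
  obtain ⟨N, N', σ, s, c, a, b, pos, d, dd, sc, sa, sb, si, sd⟩ := h.normalize hp
  have hA : 0 < p - 2 := by linarith
  obtain ⟨g1, g2, g3, g4, g5, g6⟩ := cosine_arc hA
  have key : ∀ t ∈ Ioo (0 : ℝ) 1, 0 < (p - 2) * t * (1 - t) - N t := by
    refine pos_of_second_deriv_neg (D := fun t => (p - 2) * t * (1 - t) - N t)
      (D' := fun t => (p - 2) * (1 - 2 * t) - N' t)
      (ContinuousOn.sub (by fun_prop) c) (fun t ht => HasDerivAt.sub ?_ (d t ht))
      (fun t ht => HasDerivAt.sub (f' := -2 * (p - 2)) ?_ (dd t ht))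
      (by simp [a]) (by simp [b]) fun t ht hle => ?_
    · exact (((hasDerivAt_id t).const_mul (p - 2)).mul ((hasDerivAt_id t).const_sub 1)).congr_deriv
        (by simp; ring)
    · exact ((((hasDerivAt_id t).const_mul 2).const_sub 1).const_mul (p - 2)).congr_deriv (by ring)
    · have hN := pos t ht
      have hM : 0 < 2 * (p - 1) * (p + 2) / 9 :=
        div_pos (mul_pos (mul_pos two_pos (by linarith)) (by linarith)) (by norm_num)
      have hR : 1 < u ℓ / u 0 := (one_lt_div h.zero_lt).2 h.lt
      have hR' : u 0 / u ℓ < 1 := (div_lt_one (h.zero_lt.trans h.lt)).2 h.lt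
      have r3 : 0 < boxCox ((4 - p) / 3) (u ℓ / u 0) := boxCox_pos hR
      have r4 : boxCox ((4 - p) / 3) (u 0 / u ℓ) < 0 :=
        boxCox_neg (div_pos h.zero_lt (h.zero_lt.trans h.lt)) hR'
      have q1 : 0 < (1 - t) / boxCox ((4 - p) / 3) (u ℓ / u 0) := div_pos (by linarith [ht.2]) r3
      have q2 : t / boxCox ((4 - p) / 3) (u 0 / u ℓ) < 0 := div_neg_of_pos_of_neg ht.1 r4
      have q3 : 0 < (1 - t) / boxCox ((4 - p) / 3) (u ℓ / u 0) -
        t / boxCox ((4 - p) / 3) (u 0 / u ℓ) := by linarith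
      have : 0 < 2 * (p - 1) * (p + 2) / 9 * N t / ((1 - t) / boxCox ((4 - p) / 3) (u ℓ / u 0) -
        t / boxCox ((4 - p) / 3) (u 0 / u ℓ)) ^ 2 := by positivity
      linarith
  refine time_lt_of_speed_lt h.len g1 sc (fun x _ => (g2 x).continuousAt.continuousWithinAt)
    (fun x hx => (sd x hx).1) (fun x _ => g2 x) (fun x hx => (sd x hx).2.1) g3 sa g5 sb g6
    fun x hx y hy hxy => ?_
  refine lt_of_pow_lt_pow_left₀ 2 (g3 y hy).le ?_
  rw [(sd x hx).2.2, g4, ← hxy]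
  linarith [key _ (si x hx)]

/-- Here `u` itself is rescaled affinely. The second derivative of the squared speed is `2 (1 - (p -
1) W^(p-2)) < -2 A`, because `W` stays above `u 0`, so the speed exceeds that of the cosine. As `u 0
→ 1` the bound tends to `π / √(p - 2)`. -/
theorem len_lt (hp : 2 < p) (h : IsRestArc p ℓ u v) (hA : 0 < (p - 1) * u 0 ^ (p - 2) - 1) :
    ℓ < Real.pi / √((p - 1) * u 0 ^ (p - 2) - 1) := by
  set A := (p - 1) * u 0 ^ (p - 2) - 1 with hA'
  obtain ⟨g1, g2, g3, g4, g5, g6⟩ := cosine_arc hA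
  have hn := h.zero_lt
  set Δ := u ℓ - u 0 with hΔ
  have hΔ0 : 0 < Δ := sub_pos.2 h.lt
  set W : ℝ → ℝ := fun t => u 0 + t * Δ with hW
  have hWd : ∀ t, HasDerivAt W Δ t := fun t =>
    (((hasDerivAt_id t).mul_const Δ).const_add (u 0)).congr_deriv (one_mul Δ)
  have hWpos : ∀ t, 0 ≤ t → 0 < W t := fun t ht => by
    have := mul_nonneg ht hΔ0.le
    simp only [hW]
    linarith
  set N : ℝ → ℝ := fun t => 2 * (potential p (W t) - potential p (u 0)) / Δ ^ 2 with hN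
  have hσ : ∀ x, W ((u x - u 0) / Δ) = u x := fun x => by
    simp only [hW]
    field_simp
    ring
  have key : ∀ t ∈ Ioo (0 : ℝ) 1, 0 < N t - A * t * (1 - t) := by
    refine pos_of_second_deriv_neg (D := fun t => N t - A * t * (1 - t))
      (D' := fun t => 2 * (W t - W t ^ (p - 1)) / Δ - A * (1 - 2 * t))
      (D'' := fun t => 2 * (1 - (p - 1) * W t ^ (p - 2)) - -2 * A) ?_
      (fun t ht => HasDerivAt.sub ?_ ?_) (fun t ht => HasDerivAt.sub ?_ ?_) ?_ ?_ fun t ht _ => ?_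
    · have := continuous_potential hp
      fun_prop
    · refine ((((hasDerivAt_potential_of_pos hp (hWpos t ht.1.le)).comp t
        (hWd t)).sub_const (potential p (u 0))).const_mul 2 |>.div_const (Δ ^ 2)).congr_deriv ?_
      field_simp
    · exact (((hasDerivAt_id t).const_mul A).mul ((hasDerivAt_id t).const_sub 1)).congr_deriv
        (by simp; ring)
    · have h1 : HasDerivAt (fun t => W t ^ (p - 1)) (Δ * (p - 1) * W t ^ (p - 1 - 1)) t :=
        (hWd t).rpow_const (Or.inl (hWpos t ht.1.le).ne')
      refine ((((hWd t).sub h1).const_mul 2).div_const Δ).congr_deriv ?_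
      rw [show p - 1 - 1 = p - 2 by ring]
      field_simp
    · exact ((((hasDerivAt_id t).const_mul 2).const_sub 1).const_mul A).congr_deriv (by ring)
    · simp [hN, hW]
    · simp [hN, hW, hΔ, h.potential_eq hp]
    · have h1 : u 0 < W t := by
        have := mul_pos ht.1 hΔ0
        simp only [hW]
        linarith
      have h2 := Real.rpow_lt_rpow hn.le h1 (show 0 < p - 2 by linarith)
      have h3 := mul_lt_mul_of_pos_left h2 (show 0 < p - 1 by linarith)
      simp only [hA']
      linarith
  have hsd : ∀ x ∈ Ioo 0 ℓ, HasDerivAt (fun x => (u x - u 0) / Δ) (v x / Δ) x := fun x hx =>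
    ((h.traj.hasDerivAt_fst hx).sub_const _).div_const _
  refine time_lt_of_speed_lt (σ₂ := fun x => (u x - u 0) / Δ) g1 h.len (fun x _ => (g2 x).continuousAt.continuousWithinAt)
    ((h.traj.continuousOn_fst.sub continuousOn_const).div_const Δ) (fun x _ => g2 x) hsd
    g3 (fun x hx => div_pos (h.vel x hx) hΔ0) g5 (by simp) g6 (by rw [← hΔ, div_self hΔ0.ne'])
    fun x hx y hy hxy => ?_
  refine lt_of_pow_lt_pow_left₀ 2 (div_pos (h.vel y hy) hΔ0).le ?_
  have h1 := h.mem_Ioo hy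
  have h2 := key ((u y - u 0) / Δ) ⟨div_pos (sub_pos.2 h1.1) hΔ0, (div_lt_one hΔ0).2 (by
    rw [hΔ]
    exact sub_lt_sub_right h1.2 _)⟩
  rw [g4, hxy, div_pow, h.sq_eq hp (Ioo_subset_Icc_self hy)]
  simp only [hN, hσ] at h2
  linarith

end IsRestArc

/-! ### Arcs through the outer region -/

section OuterArcs

variable {p z m K : ℝ}

lemma rpow_sub_self_pos (hp : 2 < p) {x : ℝ} (hx : 1 < x) : 0 < x ^ (p - 1) - x :=
  sub_pos.2 (self_lt_rpow hp hx)

lemma hasDerivAt_rpow_sub_self {x : ℝ} (hx : 0 < x) :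
    HasDerivAt (fun x : ℝ => x ^ (p - 1) - x) ((p - 1) * x ^ (p - 2) - 1) x := by
  have := (Real.hasDerivAt_rpow_const (p := p - 1) (Or.inl hx.ne')).sub (hasDerivAt_id x)
  rwa [show p - 1 - 1 = p - 2 by ring] at this

lemma strictMonoOn_rpow_sub_self (hp : 2 < p) :
    StrictMonoOn (fun x : ℝ => x ^ (p - 1) - x) (Ici 1) := by
  refine strictMonoOn_of_hasDerivWithinAt_pos (convex_Ici 1)
    (fun x hx => (hasDerivAt_rpow_sub_self (one_pos.trans_le
      (mem_Ici.1 hx))).continuousAt.continuousWithinAt)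
    (fun x hx => ?_) (fun x hx => ?_) (f' := fun x => (p - 1) * x ^ (p - 2) - 1)
  all_goals rw [interior_Ici, mem_Ioi] at hx
  · exact (hasDerivAt_rpow_sub_self (by linarith)).hasDerivWithinAt
  · have := Real.one_lt_rpow hx (show 0 < p - 2 by linarith)
    nlinarith

/-- Logarithmic concavity of `x ↦ x^(p-1) - x` on `(1, ∞)`. -/
lemma rpow_sub_self_le (hp : 2 < p) (hz : 1 < z) (hzm : z < m) :
    z ^ (p - 1) - z ≤ (m ^ (p - 1) - m) *
      Real.exp (-((m - z) * ((p - 1) * m ^ (p - 2) - 1) / (m ^ (p - 1) - m))) := by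
  have hm := hz.trans hzm
  -- Mean value theorem for `log F` with `F(x) = x^(p-1) - x`; it remains to see that `F' / F` at
  -- `ξ` is at least its value at `m`.
  obtain ⟨ξ, hξ, he⟩ := exists_hasDerivAt_eq_slope (fun x => Real.log (x ^ (p - 1) - x))
    (fun x => ((p - 1) * x ^ (p - 2) - 1) / (x ^ (p - 1) - x)) hzm
    (fun x hx => ((hasDerivAt_rpow_sub_self (by linarith [hx.1])).log
      (rpow_sub_self_pos hp (hz.trans_le hx.1)).ne').continuousAt.continuousWithinAt)
    (fun x hx => (hasDerivAt_rpow_sub_self (by linarith [hx.1])).log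
      (rpow_sub_self_pos hp (hz.trans hx.1)).ne')
  have hξ1 : 1 < ξ := hz.trans hξ.1
  have ha : 1 < ξ ^ (p - 2) := Real.one_lt_rpow hξ1 (by linarith)
  have hab : ξ ^ (p - 2) < m ^ (p - 2) := Real.rpow_lt_rpow (by linarith) hξ.2 (by linarith)
  have h1 : ((p - 1) * m ^ (p - 2) - 1) / (m ^ (p - 1) - m) ≤
      ((p - 1) * ξ ^ (p - 2) - 1) / (ξ ^ (p - 1) - ξ) := by
    -- In this form `F' / F` is a positive decreasing quantity divided by `x`.
    have e : ∀ x : ℝ, 1 < x → 1 < x ^ (p - 2) → ((p - 1) * x ^ (p - 2) - 1) / (x ^ (p - 1) - x) =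
        (p - 1 + (p - 2) / (x ^ (p - 2) - 1)) / x := fun x hx hx' => by
      rw [rpow_sub_one_eq (by linarith)]
      have : x ^ (p - 2) - 1 ≠ 0 := by linarith
      have h2 : x ^ (p - 2) * x - x ≠ 0 := by
        rw [show x ^ (p - 2) * x - x = (x ^ (p - 2) - 1) * x by ring]
        exact mul_ne_zero this (by linarith)
      field_simp
      ring
    rw [e m hm (ha.trans hab), e ξ hξ1 ha]
    have h2 : (p - 2) / (m ^ (p - 2) - 1) ≤ (p - 2) / (ξ ^ (p - 2) - 1) :=
      div_le_div_of_nonneg_left (by linarith) (by linarith) (by linarith)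
    have h3 : 0 ≤ (p - 2) / (m ^ (p - 2) - 1) := div_nonneg (by linarith) (by linarith)
    exact div_le_div₀ (by linarith) (by linarith) (by linarith) hξ.2.le
  rw [he, le_div_iff₀ (by linarith)] at h1
  have hFz := rpow_sub_self_pos hp hz
  have hFm := rpow_sub_self_pos hp hm
  rw [← Real.log_le_log_iff hFz (by positivity), Real.log_mul hFm.ne' (Real.exp_pos _).ne',
    Real.log_exp]
  have h4 : (m - z) * ((p - 1) * m ^ (p - 2) - 1) / (m ^ (p - 1) - m) =
    ((p - 1) * m ^ (p - 2) - 1) / (m ^ (p - 1) - m) * (m - z) := by ring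
  linarith

/-- The place where `θ ≤ 2`, that is `K = θ² - 1 ≤ 3`, is needed. With `F(x) = x^(p-1) - x` and `τ =
(m - z) F'(m) / F(m)`, log-concavity gives `F(z) ≤ F(m) e^(-τ)`, and the claim reduces to `K (τ - 1)
e^(-τ) ≤ 1`. The maximum of `(τ - 1) e^(-τ)` is `e^(-2)`, and `3 ≤ e²`. -/
lemma mul_rpow_sub_self_le (hp : 2 < p) (hK0 : 0 < K) (hK : K ≤ 3) (hz : 1 < z) (hzm : z < m) :
    K * (z ^ (p - 1) - z) * ((m - z) * ((p - 1) * m ^ (p - 2) - 1) - (m ^ (p - 1) - m)) ≤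
      (m ^ (p - 1) - m) ^ 2 := by
  have h1 := rpow_sub_self_le hp hz hzm
  have hFz := rpow_sub_self_pos hp hz
  have hF := rpow_sub_self_pos hp (hz.trans hzm)
  set F := m ^ (p - 1) - m
  set τ := (m - z) * ((p - 1) * m ^ (p - 2) - 1) / F with hτ
  have e1 : (m - z) * ((p - 1) * m ^ (p - 2) - 1) = τ * F := by
    rw [hτ]
    field_simp
  rw [e1]
  rcases le_total τ 1 with h | h
  · have : K * (z ^ (p - 1) - z) * (τ * F - F) ≤ 0 :=
      mul_nonpos_of_nonneg_of_nonpos (by positivity) (by nlinarith)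
    nlinarith [sq_nonneg F]
  · have h2 : τ - 1 ≤ Real.exp (τ - 2) := by linarith [Real.add_one_le_exp (τ - 2)]
    have h3 : (3 : ℝ) ≤ Real.exp 2 := by linarith [Real.add_one_le_exp (2 : ℝ)]
    have h4 : K * ((τ - 1) * Real.exp (-τ)) ≤ 1 := by
      have h5 : (τ - 1) * Real.exp (-τ) ≤ Real.exp (-2) := by
        calc _ ≤ Real.exp (τ - 2) * Real.exp (-τ) :=
              mul_le_mul_of_nonneg_right h2 (Real.exp_pos _).le
          _ = Real.exp (-2) := by
              rw [← Real.exp_add]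
              congr 1
              ring
      calc _ ≤ 3 * Real.exp (-2) := mul_le_mul hK h5
            (mul_nonneg (by linarith) (Real.exp_pos _).le) (by norm_num)
        _ ≤ Real.exp 2 * Real.exp (-2) := mul_le_mul_of_nonneg_right h3 (Real.exp_pos _).le
        _ = 1 := by
            rw [← Real.exp_add]
            simp
    calc K * (z ^ (p - 1) - z) * (τ * F - F)
        = (z ^ (p - 1) - z) * (K * (τ - 1) * F) := by ring
      _ ≤ F * Real.exp (-τ) * (K * (τ - 1) * F) :=
          mul_le_mul_of_nonneg_right h1 (mul_nonneg (mul_nonneg hK0.le (by linarith)) hF.le)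
      _ = K * ((τ - 1) * Real.exp (-τ)) * F ^ 2 := by ring
      _ ≤ 1 * F ^ 2 := mul_le_mul_of_nonneg_right h4 (sq_nonneg _)
      _ = F ^ 2 := one_mul _

lemma hasDerivAt_rightRoot (hp : 2 < p) {c : ℝ} (hc : c < potential p 1) :
    HasDerivAt (rightRoot p) (rightRoot p c - rightRoot p c ^ (p - 1))⁻¹ c := by
  have h1 := one_lt_rightRoot hp hc
  refine HasDerivAt.of_local_left_inverse (continuous_rightRoot hp).continuousAt
    (hasDerivAt_potential_of_pos hp (by linarith)) (by linarith [self_lt_rpow hp h1]) ?_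
  filter_upwards [Iio_mem_nhds hc] with y hy using potential_rightRoot hp (le_of_lt hy)

/-- With `F(x) = x^(p-1) - x` and `m > 1` given by `f(m) = -K f(z)`, the quotient `F(m) / (m - z)`
is nondecreasing in `z`. -/
lemma monotoneOn_slope_ratio (hp : 2 < p) (hK0 : 0 < K) (hK : K ≤ 3) :
    MonotoneOn (fun z => (rightRoot p (-K * potential p z) ^ (p - 1) -
      rightRoot p (-K * potential p z)) / (rightRoot p (-K * potential p z) - z))
      (Ico 1 (solitonMax p)) := by
  set m : ℝ → ℝ := fun z => rightRoot p (-K * potential p z) with hm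
  have hc : ∀ z ∈ Ico 1 (solitonMax p), -K * potential p z < 0 := fun z hz => by
    have := potential_pos hp ⟨one_pos.trans_le hz.1, hz.2⟩
    nlinarith
  have h1 := potential_one_pos hp
  have hm1 : ∀ z ∈ Ico 1 (solitonMax p), 1 < m z := fun z hz =>
    one_lt_rightRoot hp ((hc z hz).trans h1)
  have hzm : ∀ z ∈ Ico 1 (solitonMax p), z < m z := fun z hz => by
    by_contra! hle
    have e1 := (strictAntiOn_potential hp).antitoneOn (hm1 z hz).le hz.1 hle
    have e2 : potential p (m z) = -K * potential p z :=
      potential_rightRoot hp ((hc z hz).trans h1).le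
    have := potential_pos hp ⟨one_pos.trans_le hz.1, hz.2⟩
    linarith [hc z hz]
  -- Implicit differentiation of `f(m) = -K f(z)`.
  have hmd : ∀ z ∈ Ico 1 (solitonMax p), HasDerivAt m
      (-(K * (z ^ (p - 1) - z) / (m z ^ (p - 1) - m z))) z := fun z hz => by
    refine ((hasDerivAt_rightRoot hp ((hc z hz).trans h1)).comp z
      ((hasDerivAt_potential_of_pos hp (one_pos.trans_le hz.1)).const_mul (-K))).congr_deriv ?_
    have e1 : m z - m z ^ (p - 1) ≠ 0 := by linarith [self_lt_rpow hp (hm1 z hz)]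
    have e2 : m z ^ (p - 1) - m z ≠ 0 := by linarith [self_lt_rpow hp (hm1 z hz)]
    show (m z - m z ^ (p - 1))⁻¹ * _ = _
    rw [← neg_sub (m z ^ (p - 1))]
    field_simp
    ring
  have hFd : ∀ z ∈ Ico 1 (solitonMax p), HasDerivAt (fun z => (m z ^ (p - 1) - m z) / (m z - z))
      ((((p - 1) * m z ^ (p - 2) - 1) * -(K * (z ^ (p - 1) - z) / (m z ^ (p - 1) - m z)) *
        (m z - z) - (m z ^ (p - 1) - m z) *
        (-(K * (z ^ (p - 1) - z) / (m z ^ (p - 1) - m z)) - 1)) / (m z - z) ^ 2) z := fun z hz =>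
    (((hasDerivAt_rpow_sub_self (one_pos.trans (hm1 z hz))).comp z (hmd z hz))).div
      ((hmd z hz).sub (hasDerivAt_id z)) (by linarith [hzm z hz])
  refine monotoneOn_of_hasDerivWithinAt_nonneg (convex_Ico _ _)
    (fun z hz => (hFd z hz).continuousAt.continuousWithinAt) (fun z hz =>
      (hFd z (interior_subset hz)).hasDerivWithinAt) fun z hz => ?_
  rw [interior_Ico] at hz
  have hz' : z ∈ Ico 1 (solitonMax p) := ⟨hz.1.le, hz.2⟩
  refine div_nonneg ?_ (sq_nonneg _)
  have h2 := mul_rpow_sub_self_le hp hK0 hK hz.1 (hzm z hz')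
  have h3 := rpow_sub_self_pos hp (hm1 z hz')
  set F := m z ^ (p - 1) - m z
  set G := z ^ (p - 1) - z
  set B := (p - 1) * m z ^ (p - 2) - 1
  -- The numerator of the derivative is the quantity controlled by `mul_rpow_sub_self_le`, divided
  -- by `F`.
  have e : B * -(K * G / F) * (m z - z) - F * (-(K * G / F) - 1) =
      (F ^ 2 - K * G * ((m z - z) * B - F)) / F := by
    field_simp
    ring
  rw [e]
  exact div_nonneg (by linarith) h3.le

variable {ℓ₁ ℓ₂ : ℝ} {u₁ v₁ u₂ v₂ : ℝ → ℝ}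

/-- Both arcs are rescaled affinely to run from `0` to `1`. The difference `D` of the squared speeds
(second minus first) vanishes at `1` and has derivative `2 E` with `E = F(y₁) / Δ₁ - F(y₂) / Δ₂`, so
it is enough that `E < 0`. At `t = 1`, `E ≤ 0` is the monotonicity of the slope ratio. Where `y₁ ≤
y₂`, the sign follows from the growth of `F` and `Δ₂ < Δ₁`; elsewhere `E` increases up to `t = 1`.
-/
theorem outerArc_time_lt (hp : 2 < p) (hK0 : 0 < K) (hK : K ≤ 3) (hl₁ : 0 < ℓ₁) (hl₂ : 0 < ℓ₂)
    (h₁ : IsTraj p ℓ₁ u₁ v₁) (h₂ : IsTraj p ℓ₂ u₂ v₂) (hv₁ : ∀ x ∈ Ioo 0 ℓ₁, 0 < v₁ x)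
    (hv₂ : ∀ x ∈ Ioo 0 ℓ₂, 0 < v₂ x) (he₁ : v₁ ℓ₁ = 0) (he₂ : v₂ ℓ₂ = 0) (hz₁ : 1 ≤ u₁ 0)
    (hz : u₁ 0 < u₂ 0) (hz₂ : u₂ 0 < solitonMax p)
    (hf₁ : potential p (u₁ ℓ₁) = -K * potential p (u₁ 0))
    (hf₂ : potential p (u₂ ℓ₂) = -K * potential p (u₂ 0)) : ℓ₂ < ℓ₁ := by
  have hs₁ := h₁.strictMonoOn hv₁
  have hs₂ := h₂.strictMonoOn hv₂
  have I0₁ : (0 : ℝ) ∈ Icc 0 ℓ₁ := ⟨le_rfl, hl₁.le⟩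
  have I0₂ : (0 : ℝ) ∈ Icc 0 ℓ₂ := ⟨le_rfl, hl₂.le⟩
  have I1 : ℓ₁ ∈ Icc 0 ℓ₁ := ⟨hl₁.le, le_rfl⟩
  have I2 : ℓ₂ ∈ Icc 0 ℓ₂ := ⟨hl₂.le, le_rfl⟩
  set z₁ := u₁ 0
  set z₂ := u₂ 0
  set m₁ := u₁ ℓ₁
  set m₂ := u₂ ℓ₂
  have hzm₁ : z₁ < m₁ := hs₁ I0₁ I1 hl₁
  have hzm₂ : z₂ < m₂ := hs₂ I0₂ I2 hl₂
  have hz₂1 : 1 < z₂ := hz₁.trans_lt hz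
  have hfz : potential p z₂ < potential p z₁ := strictAntiOn_potential hp hz₁ hz₂1.le hz
  have hm : m₂ < m₁ := by
    by_contra! hle
    have := (strictAntiOn_potential hp).antitoneOn (hz₁.trans hzm₁.le)
      (hz₂1.le.trans hzm₂.le) hle
    rw [hf₁, hf₂] at this
    nlinarith
  have hroot : ∀ {z m : ℝ}, 1 ≤ z → z < solitonMax p → z < m →
      potential p m = -K * potential p z → rightRoot p (-K * potential p z) = m := by
    intro z m h1 h2 h3 h4
    have h5 := potential_pos hp ⟨one_pos.trans_le h1, h2⟩
    have h6 : -K * potential p z ≤ potential p 1 := by nlinarith [potential_one_pos hp]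
    exact (strictAntiOn_potential hp).injOn (one_le_rightRoot hp h6) (h1.trans h3.le)
      ((potential_rightRoot hp h6).trans h4.symm)
  have hΦ := monotoneOn_slope_ratio hp hK0 hK ⟨hz₁, hz.trans hz₂⟩ ⟨hz₂1.le, hz₂⟩ hz.le
  simp only at hΦ
  rw [hroot hz₁ (hz.trans hz₂) hzm₁ hf₁, hroot hz₂1.le hz₂ hzm₂ hf₂] at hΦ
  set Δ₁ := m₁ - z₁ with hΔ₁
  set Δ₂ := m₂ - z₂ with hΔ₂
  have d₁ : 0 < Δ₁ := sub_pos.2 hzm₁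
  have d₂ : 0 < Δ₂ := sub_pos.2 hzm₂
  have hΔ : Δ₂ < Δ₁ := by linarith
  set F : ℝ → ℝ := fun x => x ^ (p - 1) - x with hF
  have hFm : StrictMonoOn F (Ici 1) := strictMonoOn_rpow_sub_self hp
  set y₁ : ℝ → ℝ := fun t => z₁ + t * Δ₁ with hy₁
  set y₂ : ℝ → ℝ := fun t => z₂ + t * Δ₂ with hy₂
  have hyd₁ : ∀ t, HasDerivAt y₁ Δ₁ t := fun t =>
    (((hasDerivAt_id t).mul_const Δ₁).const_add z₁).congr_deriv (one_mul _)
  have hyd₂ : ∀ t, HasDerivAt y₂ Δ₂ t := fun t =>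
    (((hasDerivAt_id t).mul_const Δ₂).const_add z₂).congr_deriv (one_mul _)
  have hg₁ : ∀ t, 0 < t → 1 < y₁ t := fun t ht => by
    have := mul_pos ht d₁
    simp only [hy₁]
    linarith
  have hg₂ : ∀ t, 0 < t → 1 < y₂ t := fun t ht => by
    have := mul_pos ht d₂
    simp only [hy₂]
    linarith
  set E : ℝ → ℝ := fun t => F (y₁ t) / Δ₁ - F (y₂ t) / Δ₂ with hE
  have hE1 : E 1 ≤ 0 := by
    simp only [hE, hy₁, hy₂, hF, one_mul, hΔ₁, hΔ₂, add_sub_cancel]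
    exact sub_nonpos.2 hΦ
  have hEd : ∀ t, 0 < t → HasDerivAt E (((p - 1) * y₁ t ^ (p - 2) - 1) -
      ((p - 1) * y₂ t ^ (p - 2) - 1)) t := fun t ht => by
    refine ((((hasDerivAt_rpow_sub_self (one_pos.trans (hg₁ t ht))).comp t
      (hyd₁ t)).div_const Δ₁).sub (((hasDerivAt_rpow_sub_self (one_pos.trans (hg₂ t ht))).comp t
      (hyd₂ t)).div_const Δ₂)).congr_deriv ?_
    field_simp
  have hEneg : ∀ t ∈ Ioo (0 : ℝ) 1, E t < 0 := fun t ht => by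
    rcases le_or_gt (y₁ t) (y₂ t) with h | h
    · have h3 := hFm.monotoneOn (hg₁ t ht.1).le (hg₂ t ht.1).le h
      have h4 := rpow_sub_self_pos hp (hg₂ t ht.1)
      exact sub_neg.2 ((div_le_div_of_nonneg_right h3 d₁.le).trans_lt
        (div_lt_div_of_pos_left h4 d₂ hΔ))
    · refine lt_of_lt_of_le ?_ hE1
      -- Since `Δ₂ < Δ₁`, the order `y₂ < y₁` persists on `[t, 1]`, and there `E' = (p - 1)
      -- (y₁^(p-2) - y₂^(p-2)) > 0`.
      have hmono : StrictMonoOn E (Icc t 1) := by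
        refine strictMonoOn_of_hasDerivWithinAt_pos (convex_Icc t 1)
          (fun s hs => (hEd s (ht.1.trans_le hs.1)).continuousAt.continuousWithinAt)
          (fun s hs => (hEd s (ht.1.trans_le (interior_subset hs).1)).hasDerivWithinAt)
          (fun s hs => ?_)
        have hs' := interior_subset hs
        have h5 : y₂ s < y₁ s := by
          have := mul_nonneg (sub_nonneg.2 hs'.1) (sub_nonneg.2 hΔ.le)
          simp only [hy₁, hy₂] at h ⊢
          nlinarith
        have h6 := Real.rpow_lt_rpow (one_pos.trans (hg₂ s (ht.1.trans_le hs'.1))).le h5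
          (show 0 < p - 2 by linarith)
        have h7 := mul_lt_mul_of_pos_left h6 (show 0 < p - 1 by linarith)
        linarith
      exact hmono ⟨le_rfl, ht.2.le⟩ ⟨ht.2.le, le_rfl⟩ ht.2
  set D : ℝ → ℝ := fun t => 2 * (potential p (y₂ t) - potential p m₂) / Δ₂ ^ 2 -
    2 * (potential p (y₁ t) - potential p m₁) / Δ₁ ^ 2 with hD
  have hDd : ∀ t, 0 < t → HasDerivAt D (2 * E t) t := fun t ht => by
    refine ((((((hasDerivAt_potential_of_pos hp (one_pos.trans (hg₂ t ht))).comp t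
      (hyd₂ t)).sub_const _).const_mul 2).div_const (Δ₂ ^ 2)).sub
      (((((hasDerivAt_potential_of_pos hp (one_pos.trans (hg₁ t ht))).comp t
      (hyd₁ t)).sub_const _).const_mul 2).div_const (Δ₁ ^ 2))).congr_deriv ?_
    simp only [hE, hF]
    field_simp
    ring
  have hDanti : StrictAntiOn D (Ioc 0 1) := by
    refine strictAntiOn_of_hasDerivWithinAt_neg (convex_Ioc 0 1)
      (fun t ht => (hDd t ht.1).continuousAt.continuousWithinAt)
      (fun t ht => (hDd t (interior_subset ht).1).hasDerivWithinAt) (fun t ht => ?_)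
    rw [interior_Ioc] at ht
    linarith [hEneg t ht]
  have hD1 : D 1 = 0 := by simp [hD, hy₁, hy₂, hΔ₁, hΔ₂]
  have hDpos : ∀ t ∈ Ioo (0 : ℝ) 1, 0 < D t := fun t ht => by
    rw [← hD1]
    exact hDanti ⟨ht.1, ht.2.le⟩ ⟨one_pos, le_rfl⟩ ht.2
  refine time_lt_of_speed_lt (a := 0) (b := 1) (σ₁ := fun x => (u₁ x - z₁) / Δ₁) (s₁ := fun x => v₁ x / Δ₁)
    (σ₂ := fun x => (u₂ x - z₂) / Δ₂) (s₂ := fun x => v₂ x / Δ₂) hl₁ hl₂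
    ((h₁.continuousOn_fst.sub continuousOn_const).div_const _)
    ((h₂.continuousOn_fst.sub continuousOn_const).div_const _)
    (fun x hx => ((h₁.hasDerivAt_fst hx).sub_const _).div_const _)
    (fun x hx => ((h₂.hasDerivAt_fst hx).sub_const _).div_const _)
    (fun x hx => div_pos (hv₁ x hx) d₁) (fun x hx => div_pos (hv₂ x hx) d₂)
    (by simp [z₁]) (by simp [z₂]) (div_self d₁.ne') (div_self d₂.ne') fun x hx y hy hxy => ?_
  have hxI := Ioo_subset_Icc_self hx
  have hyI := Ioo_subset_Icc_self hy
  refine lt_of_pow_lt_pow_left₀ 2 (div_pos (hv₂ y hy) d₂).le ?_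
  have e1 := h₁.energy_eq hp hxI I1
  have e2 := h₂.energy_eq hp hyI I2
  rw [he₁] at e1
  rw [he₂] at e2
  have ht : (u₁ x - z₁) / Δ₁ ∈ Ioo (0 : ℝ) 1 := by
    have h3 := hs₁ I0₁ hxI hx.1
    have h4 := hs₁ hxI I1 hx.2
    exact ⟨div_pos (sub_pos.2 h3) d₁, (div_lt_one d₁).2 (sub_lt_sub_right h4 _)⟩
  have h5 := hDpos _ ht
  have h6 : y₁ ((u₁ x - z₁) / Δ₁) = u₁ x := by
    simp only [hy₁]
    field_simp
    ring
  have h7 : y₂ ((u₁ x - z₁) / Δ₁) = u₂ y := by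
    rw [hxy]
    simp only [hy₂]
    field_simp
    ring
  simp only [hD, h6, h7] at h5
  have e1' : v₁ x ^ 2 = 2 * (potential p (u₁ x) - potential p m₁) := by linarith
  have e2' : v₂ y ^ 2 = 2 * (potential p (u₂ y) - potential p m₂) := by linarith
  rw [div_pow, div_pow, e1', e2']
  linarith

end OuterArcs

/-! ### The soliton -/

section Soliton

variable {p x y z : ℝ}

/-- The derivative of the soliton. -/
def solitonVel (p x : ℝ) : ℝ := -soliton p x * Real.tanh ((p - 2) / 2 * x)

lemma sech_pos (x : ℝ) : 0 < 1 / Real.cosh x := one_div_pos.2 (Real.cosh_pos x)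

lemma soliton_pos (hp : 2 < p) (x : ℝ) : 0 < soliton p x :=
  mul_pos (solitonMax_pos hp) (Real.rpow_pos_of_pos (sech_pos _) _)

lemma soliton_neg (p x : ℝ) : soliton p (-x) = soliton p x := by
  simp [soliton, Real.cosh_neg, mul_neg]

lemma solitonVel_neg (p x : ℝ) : solitonVel p (-x) = -solitonVel p x := by
  simp [solitonVel, soliton_neg, Real.tanh_neg, mul_neg]

lemma soliton_zero (p : ℝ) : soliton p 0 = solitonMax p := by simp [soliton]

lemma solitonVel_zero (p : ℝ) : solitonVel p 0 = 0 := by simp [solitonVel]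

lemma soliton_rpow (hp : 2 < p) (x : ℝ) :
    soliton p x ^ (p - 2) = p / 2 * (1 / Real.cosh ((p - 2) / 2 * x)) ^ 2 := by
  have h2 : p - 2 ≠ 0 := by linarith
  rw [soliton, Real.mul_rpow (solitonMax_pos hp).le (Real.rpow_nonneg (sech_pos _).le _),
    solitonMax_rpow hp, ← Real.rpow_mul (sech_pos _).le, div_mul_cancel₀ _ h2]
  norm_num

lemma hasDerivAt_soliton (hp : 2 < p) (x : ℝ) :
    HasDerivAt (soliton p) (solitonVel p x) x := by
  have h2 : p - 2 ≠ 0 := by linarith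
  have hc := (Real.cosh_pos ((p - 2) / 2 * x)).ne'
  have h1 : HasDerivAt (fun x : ℝ => (p - 2) / 2 * x) ((p - 2) / 2) x := by
    simpa using (hasDerivAt_id x).const_mul ((p - 2) / 2)
  have h3 := (((h1.cosh.inv hc).rpow_const (p := 2 / (p - 2))
    (Or.inl (inv_ne_zero hc))).const_mul (solitonMax p))
  have h4 : soliton p = fun x => solitonMax p *
      (fun x => Real.cosh ((p - 2) / 2 * x))⁻¹ x ^ (2 / (p - 2)) := by
    funext x
    simp [soliton]
  rw [h4]
  refine h3.congr_deriv ?_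
  have h5 : (Real.cosh ((p - 2) / 2 * x))⁻¹ ^ (2 / (p - 2) - 1) =
      (Real.cosh ((p - 2) / 2 * x))⁻¹ ^ (2 / (p - 2)) * Real.cosh ((p - 2) / 2 * x) := by
    rw [Real.rpow_sub_one (inv_ne_zero hc), div_inv_eq_mul]
  simp only [Pi.inv_apply, h5, solitonVel, soliton, Real.tanh_eq_sinh_div_cosh, one_div]
  field_simp

lemma tanh_sq_add_sech_sq (x : ℝ) : Real.tanh x ^ 2 = 1 - (1 / Real.cosh x) ^ 2 := by
  have hc := (Real.cosh_pos x).ne'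
  have := Real.cosh_sq x
  rw [Real.tanh_eq_sinh_div_cosh]
  field_simp
  linarith

lemma hasDerivAt_solitonVel (hp : 2 < p) (x : ℝ) :
    HasDerivAt (solitonVel p) (soliton p x - soliton p x ^ (p - 1)) x := by
  have h2 : p - 2 ≠ 0 := by linarith
  have hc := (Real.cosh_pos ((p - 2) / 2 * x)).ne'
  have h1 : HasDerivAt (fun x : ℝ => (p - 2) / 2 * x) ((p - 2) / 2) x := by
    simpa using (hasDerivAt_id x).const_mul ((p - 2) / 2)
  have h3 : HasDerivAt (fun x : ℝ => Real.tanh ((p - 2) / 2 * x))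
      ((1 / Real.cosh ((p - 2) / 2 * x)) ^ 2 * ((p - 2) / 2)) x := by
    have h4 := h1.sinh.div h1.cosh hc
    have h5 : (fun x : ℝ => Real.tanh ((p - 2) / 2 * x)) =
        (fun x => Real.sinh ((p - 2) / 2 * x)) / fun x => Real.cosh ((p - 2) / 2 * x) := by
      funext x
      exact Real.tanh_eq_sinh_div_cosh _
    rw [h5]
    refine h4.congr_deriv ?_
    rw [div_eq_iff (pow_ne_zero 2 hc), one_div, inv_pow,
      mul_right_comm (Real.cosh ((p - 2) / 2 * x) ^ 2)⁻¹,
      inv_mul_cancel₀ (pow_ne_zero 2 hc)]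
    linear_combination (p - 2) / 2 * Real.cosh_sq ((p - 2) / 2 * x)
  have h6 := (hasDerivAt_soliton hp x).neg.mul h3
  refine h6.congr_deriv ?_
  rw [rpow_sub_one_eq (soliton_pos hp x), soliton_rpow hp]
  have h7 := tanh_sq_add_sech_sq ((p - 2) / 2 * x)
  simp only [Pi.neg_apply, solitonVel]
  linear_combination soliton p x * h7

/-- The soliton is the orbit of energy zero. -/
lemma solitonVel_sq (hp : 2 < p) (x : ℝ) :
    solitonVel p x ^ 2 = 2 * potential p (soliton p x) := by
  rw [potential_eq (soliton_pos hp x), soliton_rpow hp, solitonVel, mul_pow, neg_sq,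
    tanh_sq_add_sech_sq]
  have : p ≠ 0 := by linarith
  field_simp

lemma tanh_pos (hx : 0 < x) : 0 < Real.tanh x := by
  rw [Real.tanh_eq_sinh_div_cosh]
  exact div_pos (Real.sinh_pos_iff.2 hx) (Real.cosh_pos x)

lemma solitonVel_neg_of_pos (hp : 2 < p) (hx : 0 < x) : solitonVel p x < 0 := by
  have := mul_pos (soliton_pos hp x) (tanh_pos (mul_pos (by linarith : 0 < (p - 2) / 2) hx))
  rw [solitonVel]
  linarith

lemma abs_solitonVel_le (hp : 2 < p) (x : ℝ) : |solitonVel p x| ≤ soliton p x := by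
  have h1 := tanh_sq_add_sech_sq ((p - 2) / 2 * x)
  rw [solitonVel, abs_mul, abs_neg, abs_of_pos (soliton_pos hp x)]
  refine mul_le_of_le_one_right (soliton_pos hp x).le (abs_le_of_sq_le_sq' ?_ zero_le_one |> abs_le.2)
  nlinarith [sq_nonneg (1 / Real.cosh ((p - 2) / 2 * x))]

lemma continuous_soliton (hp : 2 < p) : Continuous (soliton p) :=
  continuous_iff_continuousAt.2 fun x => (hasDerivAt_soliton hp x).continuousAt

lemma continuous_solitonVel (hp : 2 < p) : Continuous (solitonVel p) :=
  continuous_iff_continuousAt.2 fun x => (hasDerivAt_solitonVel hp x).continuousAt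

lemma strictAntiOn_soliton (hp : 2 < p) : StrictAntiOn (soliton p) (Ici 0) := by
  refine strictAntiOn_of_hasDerivWithinAt_neg (f' := solitonVel p) (convex_Ici 0)
    (continuous_soliton hp).continuousOn
    (fun x _ => (hasDerivAt_soliton hp x).hasDerivWithinAt) fun x hx => ?_
  rw [interior_Ici] at hx
  exact solitonVel_neg_of_pos hp hx

lemma soliton_le_mul_exp (hp : 2 < p) (x : ℝ) :
    soliton p x ≤ solitonMax p * 2 ^ (2 / (p - 2)) * Real.exp (-x) := by
  have h2 : p - 2 ≠ 0 := by linarith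
  have h0 : 0 < (p - 2) := by linarith
  have h1 : 1 / Real.cosh ((p - 2) / 2 * x) ≤ 2 * Real.exp (-((p - 2) / 2 * x)) := by
    rw [div_le_iff₀ (Real.cosh_pos _), Real.cosh_eq]
    have := Real.exp_pos (-((p - 2) / 2 * x))
    have e : Real.exp (-((p - 2) / 2 * x)) * Real.exp ((p - 2) / 2 * x) = 1 := by
      rw [← Real.exp_add]
      simp
    nlinarith
  have h3 := Real.rpow_le_rpow (sech_pos _).le h1 (div_pos two_pos h0).le
  rw [Real.mul_rpow zero_le_two (Real.exp_pos _).le, ← Real.exp_mul] at h3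
  have h4 : -((p - 2) / 2 * x) * (2 / (p - 2)) = -x := by
    field_simp
  rw [h4] at h3
  rw [soliton, mul_assoc]
  exact mul_le_mul_of_nonneg_left h3 (solitonMax_pos hp).le

lemma tendsto_soliton_atTop (hp : 2 < p) : Tendsto (soliton p) atTop (𝓝 0) := by
  refine squeeze_zero (fun x => (soliton_pos hp x).le) (soliton_le_mul_exp hp) ?_
  simpa using (Real.tendsto_exp_neg_atTop_nhds_zero).const_mul
    (solitonMax p * 2 ^ (2 / (p - 2)))

lemma exists_soliton_eq (hp : 2 < p) (hz : z ∈ Ioc 0 (solitonMax p)) :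
    ∃ y ≥ 0, soliton p y = z := by
  obtain ⟨X, hX0, hX⟩ := (((tendsto_order.1 (tendsto_soliton_atTop hp)).2 z hz.1).and
    (eventually_ge_atTop (0 : ℝ))).exists.imp fun _ h => And.intro h.2 h.1
  obtain ⟨y, hy, he⟩ := intermediate_value_Icc' hX0 (continuous_soliton hp).continuousOn
    (show z ∈ Icc _ _ from ⟨hX.le, (soliton_zero p).symm ▸ hz.2⟩)
  exact ⟨y, hy.1, he⟩

lemma soliton_le_solitonMax (hp : 2 < p) (x : ℝ) : soliton p x ≤ solitonMax p := by
  rw [← soliton_zero p]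
  rcases le_total 0 x with hx | hx
  · exact (strictAntiOn_soliton hp).antitoneOn self_mem_Ici hx hx
  · rw [← soliton_neg p x]
    exact (strictAntiOn_soliton hp).antitoneOn self_mem_Ici (mem_Ici.2 (by linarith)) (by linarith)

lemma soliton_lt_solitonMax (hp : 2 < p) (hx : x ≠ 0) : soliton p x < solitonMax p := by
  rw [← soliton_zero p]
  rcases lt_or_gt_of_ne hx with hx | hx
  · rw [← soliton_neg p x]
    exact strictAntiOn_soliton hp self_mem_Ici (mem_Ici.2 (by linarith)) (by linarith)
  · exact strictAntiOn_soliton hp self_mem_Ici hx.le hx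

lemma solitonVel_eq (hp : 2 < p) (hx : 0 ≤ x) :
    solitonVel p x = -√(2 * potential p (soliton p x)) := by
  rw [← solitonVel_sq hp, Real.sqrt_sq_eq_abs]
  rcases hx.eq_or_lt with rfl | hx
  · simp [solitonVel_zero]
  · rw [abs_of_neg (solitonVel_neg_of_pos hp hx), neg_neg]

lemma soliton_isTraj (hp : 2 < p) (a ℓ : ℝ) :
    IsTraj p ℓ (fun x => soliton p (x + a)) fun x => solitonVel p (x + a) where
  hu x _ := ((hasDerivAt_soliton hp _).comp_add_const x a).hasDerivWithinAt
  hv x _ := ((hasDerivAt_solitonVel hp _).comp_add_const x a).hasDerivWithinAt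
  pos _ _ := soliton_pos hp _

/-- A positive trajectory on a half-line along which `u² + v²` is integrable is a portion of the
soliton. -/
theorem IsTraj.eq_soliton (hp : 2 < p) {u v : ℝ → ℝ} (h : ∀ ℓ, IsTraj p ℓ u v)
    (hi : IntegrableOn (fun x => u x ^ 2 + v x ^ 2) (Ioi 0)) :
    ∃ y ≥ 0, (∀ x ∈ Ici (0 : ℝ), u x = soliton p (x + y) ∧ v x = solitonVel p (x + y)) ∨
      ∀ x ∈ Ici (0 : ℝ), u x = soliton p (x - y) ∧ v x = solitonVel p (x - y) := by
  -- The energy is continuous and vanishes at the origin of the phase plane, so a nonzero value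
  -- keeps `(u, v)` away from it. Then `u² + v²` is bounded below on a set of infinite measure.
  have hE : v 0 ^ 2 - 2 * potential p (u 0) = 0 := by
    by_contra hne
    set E := v 0 ^ 2 - 2 * potential p (u 0) with hE
    have hcont : Continuous fun q : ℝ × ℝ => q.2 ^ 2 - 2 * potential p q.1 := by
      have := continuous_potential hp
      fun_prop
    have h1 : ∀ᶠ q : ℝ × ℝ in 𝓝 (0, 0), |q.2 ^ 2 - 2 * potential p q.1| < |E| := by
      refine hcont.abs.tendsto (0, 0) |>.eventually (gt_mem_nhds ?_)
      simpa [potential_zero hp] using hne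
    obtain ⟨δ, hδ, h2⟩ := Metric.eventually_nhds_iff.1 h1
    have h3 : ∀ x ∈ Ioi (0 : ℝ), δ ^ 2 ≤ u x ^ 2 + v x ^ 2 := fun x hx => by
      by_contra! hlt
      refine absurd (h2 (y := (u x, v x)) ?_) (not_lt.2 ?_)
      · rw [Prod.dist_eq, max_lt_iff, Real.dist_eq, Real.dist_eq, sub_zero, sub_zero]
        exact ⟨abs_lt_of_sq_lt_sq (by nlinarith [sq_nonneg (v x)]) hδ.le,
          abs_lt_of_sq_lt_sq (by nlinarith [sq_nonneg (u x)]) hδ.le⟩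
      · rw [show (u x, v x).2 ^ 2 - 2 * potential p (u x, v x).1 = E from
          (h x).energy hp ⟨le_of_lt hx, le_rfl⟩]
    have h4 : IntegrableOn (fun _ : ℝ => δ ^ 2) (Ioi 0) :=
      Integrable.mono' hi aestronglyMeasurable_const
        ((ae_restrict_iff' measurableSet_Ioi).2 (ae_of_all _ fun x hx => by
          rw [Real.norm_of_nonneg (by positivity)]
          exact h3 x hx))
    rw [integrableOn_const_iff] at h4
    rcases h4 with h4 | h4
    · exact (pow_pos hδ 2).ne' (by simpa using h4)
    · simp at h4
  have h0 : 0 < u 0 := (h 0).pos 0 ⟨le_rfl, le_rfl⟩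
  have hle : u 0 ≤ solitonMax p := by
    by_contra! hlt
    have h1 := strictAntiOn_potential hp (one_lt_solitonMax hp).le
      ((one_lt_solitonMax hp).trans hlt).le hlt
    rw [potential_solitonMax hp] at h1
    nlinarith [sq_nonneg (v 0)]
  obtain ⟨y, hy, he⟩ := exists_soliton_eq hp ⟨h0, hle⟩
  refine ⟨y, hy, ?_⟩
  -- Two points of energy zero with the same `u` differ at most by the sign of `v`; the two signs
  -- are the two translates.
  have hv : v 0 ^ 2 = solitonVel p y ^ 2 := by
    rw [solitonVel_sq hp, he]
    linarith
  rcases sq_eq_sq_iff_eq_or_eq_neg.1 hv with hv | hv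
  · left
    intro x hx
    have := (h x).eqOn hp (soliton_isTraj hp y x) (by simp [he]) (by simp [hv])
    exact ⟨this.1 ⟨hx, le_rfl⟩, this.2 ⟨hx, le_rfl⟩⟩
  · right
    intro x hx
    have := (h x).eqOn hp (soliton_isTraj hp (-y) x) (by simp [he, soliton_neg])
      (by simp [hv, solitonVel_neg])
    exact ⟨by simpa [sub_eq_add_neg] using this.1 ⟨hx, le_rfl⟩,
      by simpa [sub_eq_add_neg] using this.2 ⟨hx, le_rfl⟩⟩

end Soliton

/-! ### Growth along trajectories -/

section Growth

variable {p ℓ : ℝ} {u v : ℝ → ℝ}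

/-- Gronwall: `u e^(-Kx)` is nonincreasing. -/
lemma IsTraj.le_mul_exp (h : IsTraj p ℓ u v) (hl : 0 ≤ ℓ) {K : ℝ}
    (hK : ∀ x ∈ Ioo 0 ℓ, v x ≤ K * u x) : u ℓ ≤ u 0 * Real.exp (K * ℓ) := by
  have hanti : AntitoneOn (fun x => u x * Real.exp (-(K * x))) (Icc 0 ℓ) := by
    refine antitoneOn_of_deriv_nonpos (convex_Icc 0 ℓ)
      (h.continuousOn_fst.mul (by fun_prop)) (fun x hx => ?_) fun x hx => ?_
    all_goals
      rw [interior_Icc] at hx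
      have h1 : HasDerivAt (fun x => Real.exp (-(K * x))) (Real.exp (-(K * x)) * -(K * 1)) x :=
        (((hasDerivAt_id x).const_mul K).neg).exp
      have h2 := (h.hasDerivAt_fst hx).mul h1
    · exact h2.differentiableAt.differentiableWithinAt
    · rw [show deriv (fun x => u x * Real.exp (-(K * x))) x = _ from h2.deriv]
      nlinarith [hK x hx, Real.exp_pos (-(K * x))]
  have h1 := hanti ⟨le_rfl, hl⟩ ⟨hl, le_rfl⟩ hl
  simp only [mul_zero, neg_zero, Real.exp_zero, mul_one, Real.exp_neg] at h1
  rwa [← div_eq_mul_inv, div_le_iff₀ (Real.exp_pos _)] at h1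

lemma exists_first_zero {a b : ℝ} {v : ℝ → ℝ} (hab : a ≤ b) (hc : ContinuousOn v (Icc a b))
    (ha : v a ≠ 0) (hb : v b = 0) :
    ∃ c ∈ Ioc a b, v c = 0 ∧ ∀ x ∈ Ico a c, 0 < v a * v x := by
  obtain ⟨c, hc1, hc2⟩ := (isCompact_Icc.of_isClosed_subset
    (hc.preimage_isClosed_of_isClosed isClosed_Icc isClosed_singleton)
    inter_subset_left).exists_isLeast ⟨b, ⟨hab, le_rfl⟩, (show v b ∈ ({0} : Set ℝ) from hb)⟩
  have hc0 : v c = 0 := hc1.2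
  have hac : a < c := hc1.1.1.lt_of_ne (by rintro rfl; exact ha hc0)
  refine ⟨c, ⟨hac, hc1.1.2⟩, hc0, fun x hx => ?_⟩
  by_contra! hneg
  have h1 : ContinuousOn (fun y => v a * v y) (Icc a x) :=
    continuousOn_const.mul (hc.mono (Icc_subset_Icc_right (hx.2.le.trans hc1.1.2)))
  obtain ⟨y, hy, h2⟩ := intermediate_value_Icc' hx.1 h1
    (show (0 : ℝ) ∈ Icc _ _ from ⟨hneg, mul_self_nonneg _⟩)
  have h3 : v y = 0 := (mul_eq_zero.1 h2).resolve_left ha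
  exact absurd (hc2 ⟨⟨hy.1, hy.2.trans (hx.2.le.trans hc1.1.2)⟩, h3⟩)
    (not_le.2 (hy.2.trans_lt hx.2))

lemma sqrt_two_mul_potential {z : ℝ} (hz : 0 < z) :
    √(2 * potential p z) = z * √(1 - 2 / p * z ^ (p - 2)) := by
  rw [potential_eq hz, show 2 * (z ^ 2 * (1 / 2 - z ^ (p - 2) / p)) =
    z ^ 2 * (1 - 2 / p * z ^ (p - 2)) by ring, Real.sqrt_mul (sq_nonneg z), Real.sqrt_sq hz.le]

/-- The ratio `√(2 f(z)) / z = √(1 - (2/p) z^(p-2))` decreases. Times `θ` it is the initial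
logarithmic derivative of a right arc, so this gives the initial sign of the Wronskian. -/
lemma sqrt_potential_div_lt (hp : 2 < p) {y z : ℝ} (hy : 0 < y) (hyz : y < z)
    (hz : z < solitonMax p) :
    y * √(2 * potential p z) < √(2 * potential p y) * z := by
  have hz0 := hy.trans hyz
  have h1 : y ^ (p - 2) < z ^ (p - 2) := Real.rpow_lt_rpow hy.le hyz (by linarith)
  have h2 : z ^ (p - 2) < p / 2 := by
    rw [← solitonMax_rpow hp]
    exact Real.rpow_lt_rpow hz0.le hz (by linarith)
  have h3 : 0 < 2 / p := by positivity
  have h4 : 2 / p * z ^ (p - 2) < 1 := by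
    calc 2 / p * z ^ (p - 2) < 2 / p * (p / 2) := mul_lt_mul_of_pos_left h2 h3
      _ = 1 := by field_simp
  have h5 : √(1 - 2 / p * z ^ (p - 2)) < √(1 - 2 / p * y ^ (p - 2)) :=
    Real.sqrt_lt_sqrt (by linarith) (by linarith [mul_lt_mul_of_pos_left h1 h3])
  rw [sqrt_two_mul_potential hy, sqrt_two_mul_potential hz0]
  calc y * (z * √(1 - 2 / p * z ^ (p - 2))) = y * z * √(1 - 2 / p * z ^ (p - 2)) := by ring
    _ < y * z * √(1 - 2 / p * y ^ (p - 2)) := mul_lt_mul_of_pos_left h5 (mul_pos hy hz0)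
    _ = _ := by ring

end Growth

/-! ### Right and left arcs -/

/-- An increasing trajectory which starts at `z = u 0` with slope `θ √(2 f(z))` and ends at
rest. -/
structure IsRightArc (p θ ℓ : ℝ) (u v : ℝ → ℝ) : Prop where
  traj : IsTraj p ℓ u v
  len : 0 < ℓ
  mem : u 0 ∈ Ioo 0 (solitonMax p)
  left : v 0 = θ * √(2 * potential p (u 0))
  right : v ℓ = 0
  vel : ∀ x ∈ Ioo 0 ℓ, 0 < v x

/-- An increasing trajectory which starts at rest and ends at `z = u ℓ` with slope
`θ √(2 f(z))`. -/
structure IsLeftArc (p θ ℓ : ℝ) (u v : ℝ → ℝ) : Prop where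
  traj : IsTraj p ℓ u v
  len : 0 < ℓ
  mem : u ℓ ∈ Ioo 0 (solitonMax p)
  left : v 0 = 0
  right : v ℓ = θ * √(2 * potential p (u ℓ))
  vel : ∀ x ∈ Ioo 0 ℓ, 0 < v x

/-- The end-point of the right arc with parameter `θ` which starts at `z`. -/
def rightEnd (p θ z : ℝ) : ℝ := rightRoot p ((1 - θ ^ 2) * potential p z)

/-- The starting point of the left arc with parameter `θ` which ends at `z`. -/
def leftEnd (p θ z : ℝ) : ℝ := leftRoot p ((1 - θ ^ 2) * potential p z)

section Arcs

variable {p θ ℓ z : ℝ} {u v : ℝ → ℝ}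

lemma mul_potential_lt (hp : 2 < p) (hθ : 0 < θ) (hz : z ∈ Ioo 0 (solitonMax p)) :
    (1 - θ ^ 2) * potential p z < potential p z := by
  have := mul_pos (pow_pos hθ 2) (potential_pos hp hz)
  linarith

lemma mul_potential_lt_potential_one (hp : 2 < p) (hθ : 0 < θ) (hz : z ∈ Ioo 0 (solitonMax p)) :
    (1 - θ ^ 2) * potential p z < potential p 1 :=
  (mul_potential_lt hp hθ hz).trans_le (potential_le_potential_one hp hz.1.le)

lemma potential_rightEnd (hp : 2 < p) (hθ : 0 < θ) (hz : z ∈ Ioo 0 (solitonMax p)) :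
    potential p (rightEnd p θ z) = (1 - θ ^ 2) * potential p z :=
  potential_rightRoot hp (mul_potential_lt_potential_one hp hθ hz).le

lemma one_lt_rightEnd (hp : 2 < p) (hθ : 0 < θ) (hz : z ∈ Ioo 0 (solitonMax p)) :
    1 < rightEnd p θ z :=
  one_lt_rightRoot hp (mul_potential_lt_potential_one hp hθ hz)

lemma potential_rightEnd_lt (hp : 2 < p) (hθ : 0 < θ) (hz : z ∈ Ioo 0 (solitonMax p)) {w : ℝ}
    (hw : w ∈ Ico z (rightEnd p θ z)) : potential p (rightEnd p θ z) < potential p w := by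
  rcases le_total 1 w with h1 | h1
  · exact strictAntiOn_potential hp h1 (one_lt_rightEnd hp hθ hz).le hw.2
  · rw [potential_rightEnd hp hθ hz]
    exact (mul_potential_lt hp hθ hz).trans_le ((strictMonoOn_potential hp).monotoneOn
      ⟨hz.1.le, hw.1.trans h1⟩ ⟨hz.1.le.trans hw.1, h1⟩ hw.1)

lemma lt_rightEnd (hp : 2 < p) (hθ : 0 < θ) (hz : z ∈ Ioo 0 (solitonMax p)) :
    z < rightEnd p θ z := by
  by_contra! hle
  have h1 := (strictAntiOn_potential hp).antitoneOn (one_lt_rightEnd hp hθ hz).le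
    ((one_lt_rightEnd hp hθ hz).le.trans hle) hle
  rw [potential_rightEnd hp hθ hz] at h1
  exact absurd h1 (not_le.2 (mul_potential_lt hp hθ hz))

lemma sqrt_sub_mul_potential (hθ : 0 < θ) (c : ℝ) :
    √(2 * (c - (1 - θ ^ 2) * c)) = θ * √(2 * c) := by
  rw [show 2 * (c - (1 - θ ^ 2) * c) = θ ^ 2 * (2 * c) by ring, Real.sqrt_mul (sq_nonneg θ),
    Real.sqrt_sq hθ.le]

/-- The length of the right arc with parameter `θ` which starts at `z`. -/
def rightLen (p θ z : ℝ) : ℝ := rightTime p z (rightEnd p θ z)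

/-- The length of the left arc with parameter `θ` which ends at `z`. -/
def leftLen (p θ z : ℝ) : ℝ := leftTime p (leftEnd p θ z) z

theorem exists_isRightArc (hp : 2 < p) (hθ : 0 < θ) (hz : z ∈ Ioo 0 (solitonMax p)) :
    ∃ u v, IsRightArc p θ (rightLen p θ z) u v ∧ u 0 = z := by
  obtain ⟨h0, u, v, h1, h2, -, h4, h5, h6⟩ := exists_rightArc hp hz.1 (lt_rightEnd hp hθ hz)
    (one_lt_rightEnd hp hθ hz) fun w hw => potential_rightEnd_lt hp hθ hz hw
  refine ⟨u, v, ⟨h1, h0, h2 ▸ hz, ?_, h5, fun x hx => h6 x ⟨hx.1.le, hx.2⟩⟩, h2⟩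
  rw [h4, h2, potential_rightEnd hp hθ hz, sqrt_sub_mul_potential hθ]

lemma continuousOn_rightLen (hp : 2 < p) (hθ : 0 < θ) :
    ContinuousOn (rightLen p θ) (Ioo 0 (solitonMax p)) := by
  rw [continuousOn_iff_continuous_domRestrict]
  exact continuous_rightTime hp continuous_subtype_val
    ((continuous_rightRoot hp).comp (continuous_const.mul
      ((continuous_potential hp).comp continuous_subtype_val)))
    (fun z => lt_rightEnd hp hθ z.2) (fun z => one_lt_rightEnd hp hθ z.2)
    fun z w hw => potential_rightEnd_lt hp hθ z.2 hw

lemma one_sub_sq_pos (hθ : θ ∈ Ioo (0 : ℝ) 1) : 0 < 1 - θ ^ 2 := by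
  nlinarith [hθ.1, hθ.2]

lemma mul_potential_pos (hp : 2 < p) (hθ : θ ∈ Ioo (0 : ℝ) 1) (hz : z ∈ Ioo 0 (solitonMax p)) :
    0 < (1 - θ ^ 2) * potential p z :=
  mul_pos (one_sub_sq_pos hθ) (potential_pos hp hz)

lemma potential_leftEnd (hp : 2 < p) (hθ : θ ∈ Ioo (0 : ℝ) 1) (hz : z ∈ Ioo 0 (solitonMax p)) :
    potential p (leftEnd p θ z) = (1 - θ ^ 2) * potential p z :=
  potential_leftRoot hp (mul_potential_pos hp hθ hz).le
    (mul_potential_lt_potential_one hp hθ.1 hz).le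

lemma leftEnd_pos (hp : 2 < p) (hθ : θ ∈ Ioo (0 : ℝ) 1) (hz : z ∈ Ioo 0 (solitonMax p)) :
    0 < leftEnd p θ z :=
  leftRoot_pos hp (mul_potential_pos hp hθ hz) (mul_potential_lt_potential_one hp hθ.1 hz).le

lemma leftEnd_lt_one (hp : 2 < p) (hθ : θ ∈ Ioo (0 : ℝ) 1) (hz : z ∈ Ioo 0 (solitonMax p)) :
    leftEnd p θ z < 1 :=
  leftRoot_lt_one hp (mul_potential_pos hp hθ hz).le (mul_potential_lt_potential_one hp hθ.1 hz)

lemma potential_leftEnd_lt (hp : 2 < p) (hθ : θ ∈ Ioo (0 : ℝ) 1) (hz : z ∈ Ioo 0 (solitonMax p))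
    {w : ℝ} (hw : w ∈ Ioc (leftEnd p θ z) z) :
    potential p (leftEnd p θ z) < potential p w := by
  have hn := leftEnd_pos hp hθ hz
  rcases le_total w 1 with h1 | h1
  · exact strictMonoOn_potential hp ⟨hn.le, (leftEnd_lt_one hp hθ hz).le⟩
      ⟨hn.le.trans hw.1.le, h1⟩ hw.1
  · rw [potential_leftEnd hp hθ hz]
    exact (mul_potential_lt hp hθ.1 hz).trans_le
      ((strictAntiOn_potential hp).antitoneOn h1 (h1.trans hw.2) hw.2)

lemma leftEnd_lt (hp : 2 < p) (hθ : θ ∈ Ioo (0 : ℝ) 1) (hz : z ∈ Ioo 0 (solitonMax p)) :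
    leftEnd p θ z < z := by
  by_contra! hle
  have h1 := (strictMonoOn_potential hp).monotoneOn
    ⟨hz.1.le, hle.trans (leftEnd_lt_one hp hθ hz).le⟩
    ⟨(leftEnd_pos hp hθ hz).le, (leftEnd_lt_one hp hθ hz).le⟩ hle
  rw [potential_leftEnd hp hθ hz] at h1
  exact absurd h1 (not_le.2 (mul_potential_lt hp hθ.1 hz))

theorem exists_isLeftArc (hp : 2 < p) (hθ : θ ∈ Ioo (0 : ℝ) 1)
    (hz : z ∈ Ioo 0 (solitonMax p)) :
    ∃ u v, IsLeftArc p θ (leftLen p θ z) u v ∧ u (leftLen p θ z) = z := by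
  obtain ⟨h0, u, v, h1, -, h3, h4, h5, h6⟩ := exists_leftArc hp (leftEnd_pos hp hθ hz)
    (leftEnd_lt hp hθ hz) (leftEnd_lt_one hp hθ hz) fun w hw => potential_leftEnd_lt hp hθ hz hw
  refine ⟨u, v, ⟨h1, h0, ?_, h4, ?_, fun x hx => h6 x ⟨hx.1, hx.2.le⟩⟩, h3⟩
  · rw [leftLen, h3]
    exact hz
  · rw [leftLen, h5, h3, potential_leftEnd hp hθ hz, sqrt_sub_mul_potential hθ.1]

lemma continuousOn_leftLen (hp : 2 < p) (hθ : θ ∈ Ioo (0 : ℝ) 1) :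
    ContinuousOn (leftLen p θ) (Ioo 0 (solitonMax p)) := by
  rw [continuousOn_iff_continuous_domRestrict]
  exact continuous_leftTime hp
    ((continuous_leftRoot hp).comp (continuous_const.mul
      ((continuous_potential hp).comp continuous_subtype_val))) continuous_subtype_val
    (fun z => leftEnd_pos hp hθ z.2) (fun z => leftEnd_lt_one hp hθ z.2)
    (fun z => leftEnd_lt hp hθ z.2) fun z w hw => potential_leftEnd_lt hp hθ z.2 hw

end Arcs

namespace IsRightArc

variable {p θ ℓ ℓ₁ ℓ₂ : ℝ} {u v u₁ v₁ u₂ v₂ : ℝ → ℝ}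

lemma left_mem (h : IsRightArc p θ ℓ u v) : (0 : ℝ) ∈ Icc 0 ℓ := ⟨le_rfl, h.len.le⟩

lemma right_mem (h : IsRightArc p θ ℓ u v) : ℓ ∈ Icc 0 ℓ := ⟨h.len.le, le_rfl⟩

lemma strictMonoOn (h : IsRightArc p θ ℓ u v) : StrictMonoOn u (Icc 0 ℓ) :=
  h.traj.strictMonoOn h.vel

lemma left_sq (hp : 2 < p) (h : IsRightArc p θ ℓ u v) :
    v 0 ^ 2 = θ ^ 2 * (2 * potential p (u 0)) := by
  rw [h.left, mul_pow, Real.sq_sqrt (mul_pos two_pos (potential_pos hp h.mem)).le]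

lemma left_pos (hp : 2 < p) (h : IsRightArc p θ ℓ u v) (hθ : 0 < θ) : 0 < v 0 := by
  rw [h.left]
  exact mul_pos hθ (Real.sqrt_pos.2 (mul_pos two_pos (potential_pos hp h.mem)))

lemma potential_right (hp : 2 < p) (h : IsRightArc p θ ℓ u v) :
    potential p (u ℓ) = (1 - θ ^ 2) * potential p (u 0) := by
  have h1 := h.traj.energy hp h.right_mem
  rw [h.right, h.left_sq hp] at h1
  linarith

lemma sq_eq (hp : 2 < p) (h : IsRightArc p θ ℓ u v) {x : ℝ} (hx : x ∈ Icc 0 ℓ) :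
    v x ^ 2 = 2 * potential p (u x) - 2 * (1 - θ ^ 2) * potential p (u 0) := by
  have h1 := h.traj.energy hp hx
  rw [h.left_sq hp] at h1
  linarith

lemma one_lt (hp : 2 < p) (h : IsRightArc p θ ℓ u v) (hθ : 0 < θ) : 1 < u ℓ := by
  by_contra! hle
  have h1 := h.strictMonoOn h.left_mem h.right_mem h.len
  have h2 := strictMonoOn_potential hp ⟨h.mem.1.le, h1.le.trans hle⟩
    ⟨h.mem.1.le.trans h1.le, hle⟩ h1
  rw [h.potential_right hp] at h2
  exact absurd h2 (not_lt.2 (mul_potential_lt hp hθ h.mem).le)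

lemma vel_nonneg (hp : 2 < p) (h : IsRightArc p θ ℓ u v) (hθ : 0 < θ) :
    ∀ x ∈ Icc 0 ℓ, 0 ≤ v x := fun x hx => by
  rcases hx.1.eq_or_lt with rfl | h0
  · exact (h.left_pos hp hθ).le
  rcases hx.2.eq_or_lt with rfl | h1
  · exact h.right.ge
  · exact (h.vel x ⟨h0, h1⟩).le

lemma eq_of_left_eq (hp : 2 < p) (h₁ : IsRightArc p θ ℓ u₁ v₁) (h₂ : IsRightArc p θ ℓ u₂ v₂)
    (h : u₁ 0 = u₂ 0) : EqOn u₁ u₂ (Icc 0 ℓ) :=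
  (h₁.traj.eqOn hp h₂.traj h (by rw [h₁.left, h₂.left, h])).1

/-- The Picone comparison applies as soon as the energies are ordered. -/
lemma time_lt_of_energy (hp : 2 < p) (hθ : 0 < θ) (h₁ : IsRightArc p θ ℓ₁ u₁ v₁)
    (h₂ : IsRightArc p θ ℓ₂ u₂ v₂) (hu : u₁ 0 < u₂ 0)
    (hE : (1 - θ ^ 2) * potential p (u₂ 0) < (1 - θ ^ 2) * potential p (u₁ 0)) : ℓ₂ < ℓ₁ := by
  refine rightArc_time_lt hp h₁.len h₁.traj h₂.traj (h₂.vel_nonneg hp hθ) h₁.right hu ?_ ?_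
  · rw [h₁.left_sq hp, h₂.left_sq hp]
    linarith
  · rw [h₁.left, h₂.left]
    have := mul_lt_mul_of_pos_left (sqrt_potential_div_lt hp h₁.mem.1 hu h₂.mem.2) hθ
    linarith

end IsRightArc

namespace IsLeftArc

variable {p θ ℓ ℓ₁ ℓ₂ : ℝ} {u v u₁ v₁ u₂ v₂ : ℝ → ℝ}

lemma left_mem (h : IsLeftArc p θ ℓ u v) : (0 : ℝ) ∈ Icc 0 ℓ := ⟨le_rfl, h.len.le⟩

lemma right_mem (h : IsLeftArc p θ ℓ u v) : ℓ ∈ Icc 0 ℓ := ⟨h.len.le, le_rfl⟩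

lemma strictMonoOn (h : IsLeftArc p θ ℓ u v) : StrictMonoOn u (Icc 0 ℓ) :=
  h.traj.strictMonoOn h.vel

lemma zero_lt (h : IsLeftArc p θ ℓ u v) : 0 < u 0 := h.traj.pos 0 h.left_mem

lemma lt (h : IsLeftArc p θ ℓ u v) : u 0 < u ℓ := h.strictMonoOn h.left_mem h.right_mem h.len

lemma right_sq (hp : 2 < p) (h : IsLeftArc p θ ℓ u v) :
    v ℓ ^ 2 = θ ^ 2 * (2 * potential p (u ℓ)) := by
  rw [h.right, mul_pow, Real.sq_sqrt (mul_pos two_pos (potential_pos hp h.mem)).le]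

lemma right_pos (hp : 2 < p) (h : IsLeftArc p θ ℓ u v) (hθ : 0 < θ) : 0 < v ℓ := by
  rw [h.right]
  exact mul_pos hθ (Real.sqrt_pos.2 (mul_pos two_pos (potential_pos hp h.mem)))

lemma vel_pos (hp : 2 < p) (h : IsLeftArc p θ ℓ u v) (hθ : 0 < θ) : ∀ x ∈ Ioc 0 ℓ, 0 < v x :=
  fun x hx => by
    rcases hx.2.eq_or_lt with rfl | h1
    · exact h.right_pos hp hθ
    · exact h.vel x ⟨hx.1, h1⟩

lemma sq_eq (hp : 2 < p) (h : IsLeftArc p θ ℓ u v) {x : ℝ} (hx : x ∈ Icc 0 ℓ) :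
    v x ^ 2 = 2 * (potential p (u x) - potential p (u 0)) := by
  have := h.traj.energy hp hx
  rw [h.left] at this
  linarith

lemma potential_left (hp : 2 < p) (h : IsLeftArc p θ ℓ u v) :
    potential p (u 0) = (1 - θ ^ 2) * potential p (u ℓ) := by
  have h1 := h.sq_eq hp h.right_mem
  rw [h.right_sq hp] at h1
  linarith

lemma lt_one (hp : 2 < p) (h : IsLeftArc p θ ℓ u v) (hθ : 0 < θ) : u 0 < 1 := by
  by_contra! hle
  have h2 := strictAntiOn_potential hp hle (hle.trans h.lt.le) h.lt
  rw [h.potential_left hp] at h2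
  exact absurd h2 (not_lt.2 (mul_potential_lt hp hθ h.mem).le)

/-- A left arc followed by a right arc is an arc from rest to rest. -/
lemma exists_isRestArc (hp : 2 < p) (hθ : 0 < θ) (h₁ : IsLeftArc p θ ℓ₁ u₁ v₁)
    (h₂ : IsRightArc p θ ℓ₂ u₂ v₂) (h : u₁ ℓ₁ = u₂ 0) :
    ∃ u v, IsRestArc p (ℓ₁ + ℓ₂) u v ∧ u 0 = u₁ 0 := by
  obtain ⟨u, v, h3, ⟨h4, h5⟩, h6⟩ := h₁.traj.concat h₁.len.le h₂.len.le h₂.traj h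
    (by rw [h₁.right, h₂.left, h])
  have hl₁ := h₁.len
  have hl₂ := h₂.len
  refine ⟨u, v, ⟨h3, by linarith, (h5 h₁.left_mem).trans h₁.left, ?_, fun x hx => ?_⟩,
    h4 h₁.left_mem⟩
  · rw [(h6 _ ⟨by linarith, le_rfl⟩).2, add_sub_cancel_left, h₂.right]
  · rcases le_or_gt x ℓ₁ with hle | hlt
    · rw [h5 ⟨hx.1.le, hle⟩]
      exact h₁.vel_pos hp hθ x ⟨hx.1, hle⟩
    · rw [(h6 x ⟨hlt.le, hx.2.le⟩).2]
      exact h₂.vel _ ⟨by linarith, by linarith [hx.2]⟩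

lemma left_lt_left (hp : 2 < p) (hθ : θ ∈ Ioo (0 : ℝ) 1) (h₁ : IsLeftArc p θ ℓ₁ u₁ v₁)
    (h₂ : IsLeftArc p θ ℓ₂ u₂ v₂) (h : potential p (u₁ ℓ₁) < potential p (u₂ ℓ₂)) :
    u₁ 0 < u₂ 0 := by
  by_contra! hle
  have h1 := (strictMonoOn_potential hp).monotoneOn ⟨h₂.zero_lt.le, (h₂.lt_one hp hθ.1).le⟩
    ⟨h₁.zero_lt.le, (h₁.lt_one hp hθ.1).le⟩ hle
  rw [h₁.potential_left hp, h₂.potential_left hp] at h1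
  exact absurd h (not_lt.2 (le_of_mul_le_mul_left h1 (one_sub_sq_pos hθ)))

lemma time_lt_of_le_one (hp : 2 < p) (hθ : θ ∈ Ioo (0 : ℝ) 1) (h₁ : IsLeftArc p θ ℓ₁ u₁ v₁)
    (h₂ : IsLeftArc p θ ℓ₂ u₂ v₂) (h : u₁ ℓ₁ < u₂ ℓ₂) (h1 : u₂ ℓ₂ ≤ 1) : ℓ₁ < ℓ₂ := by
  refine leftArc_time_lt hp h₁.len h₂.len h₁.traj h₂.traj (h₁.vel_pos hp hθ.1)
    (h₂.vel_pos hp hθ.1) h₁.left h₂.left ?_ h h1 ?_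
  · exact left_lt_left hp hθ h₁ h₂ (strictMonoOn_potential hp ⟨h₁.mem.1.le, h.le.trans h1⟩
      ⟨h₂.mem.1.le, h1⟩ h)
  · rw [h₁.potential_left hp, h₂.potential_left hp]
    ring

lemma eq_of_right_eq (hp : 2 < p) (h₁ : IsLeftArc p θ ℓ u₁ v₁) (h₂ : IsLeftArc p θ ℓ u₂ v₂)
    (h : u₁ ℓ = u₂ ℓ) : EqOn u₁ u₂ (Icc 0 ℓ) :=
  (h₁.traj.eqOn_of_right hp h₂.traj h (by rw [h₁.right, h₂.right, h])).1

end IsLeftArc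

/-! ### Strict monotonicity of the arc lengths. -/

section Monotonicity

variable {p θ ℓ ℓ₁ ℓ₂ : ℝ} {u v u₁ v₁ u₂ v₂ : ℝ → ℝ}

lemma one_mem_Ioo_solitonMax (hp : 2 < p) : (1 : ℝ) ∈ Ioo 0 (solitonMax p) :=
  ⟨one_pos, one_lt_solitonMax hp⟩

/-- Up to level `1`, the right arc is an arc from rest to rest minus a left arc: as `z` grows the
full orbit shrinks and its half-period decreases, while the left part gets longer. From level `1`
on, the energies are ordered as the Wronskian comparison requires. The arc starting at `1` links the
two ranges. -/
theorem IsRightArc.time_lt_of_lt_one (hp : 2 < p) (hθ : θ ∈ Ioo (0 : ℝ) 1)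
    (h₁ : IsRightArc p θ ℓ₁ u₁ v₁) (h₂ : IsRightArc p θ ℓ₂ u₂ v₂) (hu : u₁ 0 < u₂ 0) :
    ℓ₂ < ℓ₁ := by
  have inner : ∀ {ℓ₁ ℓ₂ u₁ v₁ u₂ v₂}, IsRightArc p θ ℓ₁ u₁ v₁ → IsRightArc p θ ℓ₂ u₂ v₂ →
      u₁ 0 < u₂ 0 → u₂ 0 ≤ 1 → ℓ₂ < ℓ₁ := fun {ℓ₁ ℓ₂ u₁ v₁ u₂ v₂} h₁ h₂ hu h1 => by
    obtain ⟨a₁, b₁, k₁, e₁⟩ := exists_isLeftArc hp hθ h₁.mem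
    obtain ⟨a₂, b₂, k₂, e₂⟩ := exists_isLeftArc hp hθ h₂.mem
    obtain ⟨_, _, r₁, f₁⟩ := k₁.exists_isRestArc hp hθ.1 h₁ e₁
    obtain ⟨_, _, r₂, f₂⟩ := k₂.exists_isRestArc hp hθ.1 h₂ e₂
    have h3 := k₁.time_lt_of_le_one hp hθ k₂ (by rwa [e₁, e₂]) (by rwa [e₂])
    have h4 := r₁.time_lt hp r₂ (by
      rw [f₁, f₂]
      exact k₁.left_lt_left hp hθ k₂ (by
        rw [e₁, e₂]
        exact strictMonoOn_potential hp ⟨h₁.mem.1.le, hu.le.trans h1⟩ ⟨h₂.mem.1.le, h1⟩ hu))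
    linarith
  have outer : ∀ {ℓ₁ ℓ₂ u₁ v₁ u₂ v₂}, IsRightArc p θ ℓ₁ u₁ v₁ → IsRightArc p θ ℓ₂ u₂ v₂ →
      u₁ 0 < u₂ 0 → 1 ≤ u₁ 0 → ℓ₂ < ℓ₁ := fun h₁ h₂ hu h1 =>
    h₁.time_lt_of_energy hp hθ.1 h₂ hu (mul_lt_mul_of_pos_left
      (strictAntiOn_potential hp h1 (h1.trans hu.le) hu) (one_sub_sq_pos hθ))
  rcases le_or_gt (u₂ 0) 1 with h1 | h1
  · exact inner h₁ h₂ hu h1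
  rcases le_or_gt 1 (u₁ 0) with h2 | h2
  · exact outer h₁ h₂ hu h2
  obtain ⟨a, b, k, e⟩ := exists_isRightArc hp hθ.1 (one_mem_Ioo_solitonMax hp)
  exact (outer k h₂ (by rwa [e]) e.ge).trans (inner h₁ k (by rwa [e]) e.le)

/-- Up to level `1` the direct comparison applies. Beyond it, `f(z)` decreases, so the full orbit
grows and its half-period increases, while the right part shortens. -/
theorem IsLeftArc.time_lt (hp : 2 < p) (hθ : θ ∈ Ioo (0 : ℝ) 1)
    (h₁ : IsLeftArc p θ ℓ₁ u₁ v₁) (h₂ : IsLeftArc p θ ℓ₂ u₂ v₂) (hu : u₁ ℓ₁ < u₂ ℓ₂) :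
    ℓ₁ < ℓ₂ := by
  have outer : ∀ {ℓ₁ ℓ₂ u₁ v₁ u₂ v₂}, IsLeftArc p θ ℓ₁ u₁ v₁ → IsLeftArc p θ ℓ₂ u₂ v₂ →
      u₁ ℓ₁ < u₂ ℓ₂ → 1 ≤ u₁ ℓ₁ → ℓ₁ < ℓ₂ := fun {ℓ₁ ℓ₂ u₁ v₁ u₂ v₂} h₁ h₂ hu h1 => by
    obtain ⟨a₁, b₁, k₁, e₁⟩ := exists_isRightArc hp hθ.1 h₁.mem
    obtain ⟨a₂, b₂, k₂, e₂⟩ := exists_isRightArc hp hθ.1 h₂.mem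
    obtain ⟨_, _, r₁, f₁⟩ := h₁.exists_isRestArc hp hθ.1 k₁ e₁.symm
    obtain ⟨_, _, r₂, f₂⟩ := h₂.exists_isRestArc hp hθ.1 k₂ e₂.symm
    have h3 := k₁.time_lt_of_lt_one hp hθ k₂ (by rwa [e₁, e₂])
    have h4 := r₂.time_lt hp r₁ (by
      rw [f₁, f₂]
      exact h₂.left_lt_left hp hθ h₁ (strictAntiOn_potential hp h1 (h1.trans hu.le) hu))
    linarith
  rcases le_or_gt (u₂ ℓ₂) 1 with h1 | h1
  · exact h₁.time_lt_of_le_one hp hθ h₂ hu h1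
  rcases le_or_gt 1 (u₁ ℓ₁) with h2 | h2
  · exact outer h₁ h₂ hu h2
  obtain ⟨a, b, k, e⟩ := exists_isLeftArc hp hθ (one_mem_Ioo_solitonMax hp)
  exact (h₁.time_lt_of_le_one hp hθ k (by rwa [e]) e.le).trans (outer k h₂ (by rwa [e]) e.ge)

/-- Now `1 - θ² < 0`, so the energies are favourably ordered where `f` increases, that is up to
level `1`. Beyond it `outerArc_time_lt` is used with `K = θ² - 1 ≤ 3`. -/
theorem IsRightArc.time_lt_of_one_lt (hp : 2 < p) (hθ : θ ∈ Ioc (1 : ℝ) 2)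
    (h₁ : IsRightArc p θ ℓ₁ u₁ v₁) (h₂ : IsRightArc p θ ℓ₂ u₂ v₂) (hu : u₁ 0 < u₂ 0) :
    ℓ₂ < ℓ₁ := by
  have hθ0 : 0 < θ := one_pos.trans hθ.1
  have hK : 0 < θ ^ 2 - 1 := by nlinarith [hθ.1]
  have inner : ∀ {ℓ₁ ℓ₂ u₁ v₁ u₂ v₂}, IsRightArc p θ ℓ₁ u₁ v₁ → IsRightArc p θ ℓ₂ u₂ v₂ →
      u₁ 0 < u₂ 0 → u₂ 0 ≤ 1 → ℓ₂ < ℓ₁ := fun h₁ h₂ hu h1 =>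
    h₁.time_lt_of_energy hp hθ0 h₂ hu (mul_lt_mul_of_neg_left
      (strictMonoOn_potential hp ⟨h₁.mem.1.le, hu.le.trans h1⟩ ⟨h₂.mem.1.le, h1⟩ hu)
      (by linarith))
  have outer : ∀ {ℓ₁ ℓ₂ u₁ v₁ u₂ v₂}, IsRightArc p θ ℓ₁ u₁ v₁ → IsRightArc p θ ℓ₂ u₂ v₂ →
      u₁ 0 < u₂ 0 → 1 ≤ u₁ 0 → ℓ₂ < ℓ₁ := fun h₁ h₂ hu h1 =>
    outerArc_time_lt hp hK (by nlinarith [hθ.2]) h₁.len h₂.len h₁.traj h₂.traj h₁.vel h₂.vel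
      h₁.right h₂.right h1 hu h₂.mem.2 (by rw [h₁.potential_right hp]; ring)
      (by rw [h₂.potential_right hp]; ring)
  rcases le_or_gt (u₂ 0) 1 with h1 | h1
  · exact inner h₁ h₂ hu h1
  rcases le_or_gt 1 (u₁ 0) with h2 | h2
  · exact outer h₁ h₂ hu h2
  obtain ⟨a, b, k, e⟩ := exists_isRightArc hp hθ0 (one_mem_Ioo_solitonMax hp)
  exact (outer k h₂ (by rwa [e]) e.ge).trans (inner h₁ k (by rwa [e]) e.le)

end Monotonicity

/-! ### Bounds for the lengths of the arcs -/

section Lengths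

variable {p θ ℓ z : ℝ} {u v : ℝ → ℝ}

lemma two_mul_potential_le (hp : 2 < p) {x : ℝ} (hx : 0 < x) : 2 * potential p x ≤ x ^ 2 := by
  rw [potential_of_nonneg hx.le]
  have : 0 < x ^ p / p := div_pos (Real.rpow_pos_of_pos hx p) (by linarith)
  linarith

/-- Energy and `2 f(x) ≤ x²` give `v² ≤ (1 + θ²) u²`, so `u` grows at most exponentially, yet it has
to pass level `1`. Hence the length tends to `∞` as `z → 0`. -/
lemma IsRightArc.one_lt_mul_exp (hp : 2 < p) (hθ : 0 < θ) (h : IsRightArc p θ ℓ u v) :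
    1 < u 0 * Real.exp (√(1 + θ ^ 2) * ℓ) := by
  refine (h.one_lt hp hθ).trans_le (h.traj.le_mul_exp h.len.le fun x hx => ?_)
  have hxI := Ioo_subset_Icc_self hx
  have h1 := h.sq_eq hp hxI
  have h2 := two_mul_potential_le hp (h.traj.pos x hxI)
  have h3 := two_mul_potential_le hp h.mem.1
  have h4 := h.strictMonoOn h.left_mem hxI hx.1
  have h5 := potential_pos hp h.mem
  have h6 : u 0 ^ 2 ≤ u x ^ 2 := pow_le_pow_left₀ h.mem.1.le h4.le 2
  have h7 : θ ^ 2 * (2 * potential p (u 0)) ≤ θ ^ 2 * u x ^ 2 :=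
    mul_le_mul_of_nonneg_left (h3.trans h6) (sq_nonneg θ)
  refine le_of_sq_le_sq ?_ (mul_pos (Real.sqrt_pos.2 (by positivity)) (h.traj.pos x hxI)).le
  rw [mul_pow, Real.sq_sqrt (by positivity)]
  linarith

/-- Above `1` the deceleration is at least its initial value. Since the initial speed vanishes as `z
→ solitonMax p`, so does the length. -/
lemma IsRightArc.len_mul_le (hp : 2 < p) (h : IsRightArc p θ ℓ u v)
    (h1 : 1 ≤ u 0) : ℓ * (u 0 ^ (p - 1) - u 0) ≤ θ * √(2 * potential p (u 0)) := by
  have hanti : AntitoneOn (fun x => v x + x * (u 0 ^ (p - 1) - u 0)) (Icc 0 ℓ) := by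
    refine antitoneOn_of_deriv_nonpos (convex_Icc 0 ℓ)
      (h.traj.continuousOn_snd.add (by fun_prop)) (fun x hx => ?_) fun x hx => ?_
    all_goals
      rw [interior_Icc] at hx
      have h2 := (h.traj.hasDerivAt_snd hx).add
        ((hasDerivAt_id x).mul_const (u 0 ^ (p - 1) - u 0))
    · exact h2.differentiableAt.differentiableWithinAt
    · rw [show deriv (fun x => v x + x * (u 0 ^ (p - 1) - u 0)) x = _ from h2.deriv]
      have h3 := h.strictMonoOn h.left_mem (Ioo_subset_Icc_self hx) hx.1
      have h4 := strictMonoOn_rpow_sub_self hp h1 (h1.trans h3.le) h3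
      simp only at h4
      linarith
  have h2 := hanti h.left_mem h.right_mem h.len.le
  simp only [zero_mul, add_zero, h.right, zero_add, h.left] at h2
  exact h2

lemma exists_le_rightLen (hp : 2 < p) (hθ : 0 < θ) (L : ℝ) :
    ∃ z ∈ Ioo (0 : ℝ) 1, L ≤ rightLen p θ z := by
  set z : ℝ := min (1 / 2) (Real.exp (-(√(1 + θ ^ 2) * L))) with hz
  have hz0 : 0 < z := lt_min (by norm_num) (Real.exp_pos _)
  have hz1 : z < 1 := (min_le_left _ _).trans_lt (by norm_num)
  refine ⟨z, ⟨hz0, hz1⟩, ?_⟩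
  by_contra! hlt
  obtain ⟨u, v, h, hu⟩ := exists_isRightArc hp hθ ⟨hz0, hz1.trans (one_lt_solitonMax hp)⟩
  have h1 := h.one_lt_mul_exp hp hθ
  rw [hu] at h1
  refine absurd h1 (not_lt.2 ?_)
  calc z * Real.exp (√(1 + θ ^ 2) * rightLen p θ z)
      ≤ Real.exp (-(√(1 + θ ^ 2) * L)) * Real.exp (√(1 + θ ^ 2) * L) :=
        mul_le_mul (min_le_right _ _)
          (Real.exp_le_exp.2 (mul_le_mul_of_nonneg_left hlt.le (Real.sqrt_nonneg _)))
          (Real.exp_pos _).le (Real.exp_pos _).le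
    _ = 1 := by rw [← Real.exp_add]; simp

lemma exists_rightLen_le (hp : 2 < p) (hθ : 0 < θ) {z₀ ε : ℝ} (hz₀ : z₀ < solitonMax p)
    (hε : 0 < ε) : ∃ z ∈ Ioo z₀ (solitonMax p), 1 < z ∧ rightLen p θ z ≤ ε := by
  have hm := one_lt_solitonMax hp
  have h1 : ∀ᶠ z in 𝓝 (solitonMax p),
      θ * √(2 * potential p z) < ε * (z ^ (p - 1) - z) := by
    refine ContinuousAt.eventually_lt ?_ ?_ ?_
    · exact (continuous_const.mul
        ((continuous_const.mul (continuous_potential hp)).sqrt)).continuousAt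
    · exact continuousAt_const.mul ((hasDerivAt_rpow_sub_self (solitonMax_pos hp)).continuousAt)
    · rw [potential_solitonMax hp]
      simpa using mul_pos hε (rpow_sub_self_pos hp hm)
  obtain ⟨z, h2, h3⟩ := ((h1.filter_mono nhdsWithin_le_nhds).and
    (Ioo_mem_nhdsLT (max_lt hz₀ hm))).exists
  have hz1 : 1 < z := (le_max_right _ _).trans_lt h3.1
  refine ⟨z, ⟨(le_max_left _ _).trans_lt h3.1, h3.2⟩, hz1, ?_⟩
  obtain ⟨u, v, h, hu⟩ := exists_isRightArc hp hθ ⟨one_pos.trans hz1, h3.2⟩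
  have h4 := h.len_mul_le hp (hu ▸ hz1.le)
  rw [hu] at h4
  exact le_of_mul_le_mul_right (h4.trans h2.le) (rpow_sub_self_pos hp hz1)

lemma exists_isRightArc_of_mem (hp : 2 < p) (hθ : 0 < θ) {s : Set ℝ}
    (hs : s ⊆ Ioo 0 (solitonMax p)) (hc : IsPreconnected s) {a b : ℝ} (ha : a ∈ s) (hb : b ∈ s)
    (hl : ℓ ∈ Icc (rightLen p θ a) (rightLen p θ b)) :
    ∃ u v, IsRightArc p θ ℓ u v ∧ u 0 ∈ s := by
  obtain ⟨z, hz, he⟩ := hc.intermediate_value ha hb ((continuousOn_rightLen hp hθ).mono hs) hl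
  obtain ⟨u, v, h, hu⟩ := exists_isRightArc hp hθ (hs hz)
  rw [he] at h
  exact ⟨u, v, h, hu ▸ hz⟩

theorem exists_isRightArc_len (hp : 2 < p) (hθ : 0 < θ) (hl : 0 < ℓ) :
    ∃ u v, IsRightArc p θ ℓ u v := by
  obtain ⟨b, hb, h1⟩ := exists_le_rightLen hp hθ ℓ
  obtain ⟨a, ha, -, h2⟩ := exists_rightLen_le hp hθ (solitonMax_pos hp) hl
  obtain ⟨u, v, h, -⟩ := exists_isRightArc_of_mem hp hθ Subset.rfl isPreconnected_Ioo ha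
    ⟨hb.1, hb.2.trans (one_lt_solitonMax hp)⟩ ⟨h2, h1⟩
  exact ⟨u, v, h⟩

/-- The curve `n cosh(√A x)`, which starts at rest and reaches `z`. -/
lemma cosh_arc {n A : ℝ} (hn : 0 < n) (hnz : n < z) (hA : 0 < A) :
    0 < Real.arsinh √((z / n) ^ 2 - 1) / √A ∧
    (∀ x, HasDerivAt (fun x => n * Real.cosh (√A * x)) (n * (√A * Real.sinh (√A * x))) x) ∧
    (∀ x, 0 < x → 0 < n * (√A * Real.sinh (√A * x))) ∧
    (∀ x, (n * (√A * Real.sinh (√A * x))) ^ 2 = A * ((n * Real.cosh (√A * x)) ^ 2 - n ^ 2)) ∧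
    n * Real.cosh (√A * 0) = n ∧
    n * Real.cosh (√A * (Real.arsinh √((z / n) ^ 2 - 1) / √A)) = z := by
  have hs := Real.sqrt_pos.2 hA
  have h1 : 1 < z / n := (one_lt_div hn).2 hnz
  have h2 : 0 < (z / n) ^ 2 - 1 := by nlinarith
  refine ⟨div_pos (Real.arsinh_pos_iff.2 (Real.sqrt_pos.2 h2)) hs, fun x => ?_, fun x hx => ?_,
    fun x => ?_, by simp, ?_⟩
  · have h3 : HasDerivAt (fun x : ℝ => √A * x) (√A) x := by
      simpa using (hasDerivAt_id x).const_mul (√A)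
    exact (h3.cosh.const_mul n).congr_deriv (by ring)
  · exact mul_pos hn (mul_pos hs (Real.sinh_pos_iff.2 (mul_pos hs hx)))
  · rw [mul_pow, mul_pow, mul_pow, Real.sq_sqrt hA.le, Real.cosh_sq]
    ring
  · rw [mul_div_cancel₀ _ hs.ne', Real.cosh_arsinh, Real.sq_sqrt h2.le,
      show 1 + ((z / n) ^ 2 - 1) = (z / n) ^ 2 by ring, Real.sqrt_sq (one_pos.trans h1).le,
      mul_div_cancel₀ _ hn.ne']

lemma div_sqrt_one_sub_sq (hθ : θ ∈ Ioo (0 : ℝ) 1) :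
    θ / √(1 - θ ^ 2) = √((1 - θ ^ 2)⁻¹ - 1) := by
  have h1 := one_sub_sq_pos hθ
  rw [show (1 - θ ^ 2)⁻¹ - 1 = θ ^ 2 / (1 - θ ^ 2) by field_simp; ring,
    Real.sqrt_div (sq_nonneg θ), Real.sqrt_sq hθ.1.le]

/-- Dropping the nonlinear term only increases the speed, so the arc takes longer than `n cosh x`
does to reach `z`. Since `f(x) / x²` decreases, `f(n) = (1 - θ²) f(z)` yields `(z / n)² ≥ 1 / (1 -
θ²)`. -/
theorem IsLeftArc.lt_len (hp : 2 < p) (hθ : θ ∈ Ioo (0 : ℝ) 1) (h : IsLeftArc p θ ℓ u v) :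
    Real.arsinh (θ / √(1 - θ ^ 2)) < ℓ := by
  have hn := h.zero_lt
  have hk := one_sub_sq_pos hθ
  obtain ⟨g1, g2, g3, g4, g5, g6⟩ := cosh_arc hn h.lt one_pos
  have h1 : Real.arsinh √((u ℓ / u 0) ^ 2 - 1) / √1 < ℓ := by
    refine time_lt_of_speed_lt h.len g1 h.traj.continuousOn_fst
      (fun x _ => (g2 x).continuousAt.continuousWithinAt) (fun x hx => h.traj.hasDerivAt_fst hx)
      (fun x _ => g2 x) h.vel (fun x hx => g3 x hx.1) rfl g5 rfl g6 fun x hx y hy hxy => ?_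
    refine lt_of_pow_lt_pow_left₀ 2 (g3 y hy.1).le ?_
    rw [g4, ← hxy, h.sq_eq hp (Ioo_subset_Icc_self hx), potential_of_nonneg hn.le,
      potential_of_nonneg (h.traj.pos x (Ioo_subset_Icc_self hx)).le]
    have h2 : u 0 ^ p < u x ^ p := Real.rpow_lt_rpow hn.le
      (h.strictMonoOn h.left_mem (Ioo_subset_Icc_self hx) hx.1) (by linarith)
    have h3 : u 0 ^ p / p < u x ^ p / p := div_lt_div_of_pos_right h2 (by linarith)
    linarith
  rw [Real.sqrt_one, div_one] at h1
  refine lt_of_le_of_lt (Real.arsinh_le_arsinh.2 ?_) h1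
  rw [div_sqrt_one_sub_sq hθ]
  refine Real.sqrt_le_sqrt (sub_le_sub_right ?_ 1)
  rw [div_pow, inv_eq_one_div, div_le_div_iff₀ hk (pow_pos hn 2), one_mul]
  have h4 := h.potential_left hp
  rw [potential_eq hn, potential_eq h.mem.1] at h4
  have h5 : u 0 ^ (p - 2) < u ℓ ^ (p - 2) := Real.rpow_lt_rpow hn.le h.lt (by linarith)
  have h6 : u 0 ^ (p - 2) / p < u ℓ ^ (p - 2) / p := div_lt_div_of_pos_right h5 (by linarith)
  have h7 : u 0 ^ (p - 2) < 1 := by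
    have := Real.rpow_lt_rpow hn.le (h.lt_one hp hθ.1) (show (0 : ℝ) < p - 2 by linarith)
    rwa [Real.one_rpow] at this
  have h8 : u 0 ^ (p - 2) / p < 1 / 2 := by
    rw [div_lt_div_iff₀ (by linarith) two_pos]
    linarith
  refine le_of_mul_le_mul_right ?_ (sub_pos.2 h8)
  calc u 0 ^ 2 * (1 / 2 - u 0 ^ (p - 2) / p)
      = (1 - θ ^ 2) * u ℓ ^ 2 * (1 / 2 - u ℓ ^ (p - 2) / p) := by rw [h4]; ring
    _ ≤ (1 - θ ^ 2) * u ℓ ^ 2 * (1 / 2 - u 0 ^ (p - 2) / p) :=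
        mul_le_mul_of_nonneg_left (by linarith) (mul_nonneg hk.le (sq_nonneg _))
    _ = _ := by ring

/-- While `u^(p-2) < 1 - A`, the function `2 f(w) - A w²` increases, so the arc is faster than `n
cosh (√A x)`. Letting `z → 0` and `A → 1`, the bound tends to that of `IsLeftArc.lt_len`. -/
theorem IsLeftArc.len_lt (hp : 2 < p) (hθ : θ ∈ Ioo (0 : ℝ) 1) (h : IsLeftArc p θ ℓ u v) {A : ℝ}
    (hA : 0 < A) (hz : u ℓ ^ (p - 2) < 1 - A) :
    ℓ < Real.arsinh √(((1 - θ ^ 2) * A)⁻¹ - 1) / √A := by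
  have hn := h.zero_lt
  have hk := one_sub_sq_pos hθ
  obtain ⟨g1, g2, g3, g4, g5, g6⟩ := cosh_arc hn h.lt hA
  have hmono : StrictMonoOn (fun w => 2 * potential p w - A * w ^ 2) (Icc (u 0) (u ℓ)) := by
    refine strictMonoOn_of_hasDerivWithinAt_pos
      (f' := fun w => 2 * (w - w ^ (p - 1)) - A * (2 * w)) (convex_Icc _ _)
      ((continuous_const.mul (continuous_potential hp)).sub (by fun_prop)).continuousOn
      (fun w hw => ?_) fun w hw => ?_
    all_goals rw [interior_Icc] at hw
    · have h1 := (hasDerivAt_pow 2 w).const_mul A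
      refine ((((hasDerivAt_potential_of_pos hp (hn.trans hw.1)).const_mul 2).sub
        h1).congr_deriv ?_).hasDerivWithinAt
      simp
    · have hw0 := hn.trans hw.1
      have h1 : w ^ (p - 2) < u ℓ ^ (p - 2) := Real.rpow_lt_rpow hw0.le hw.2 (by linarith)
      rw [rpow_sub_one_eq hw0]
      have := mul_pos hw0 (sub_pos.2 (h1.trans hz))
      linarith
  refine lt_of_lt_of_le (b := Real.arsinh √((u ℓ / u 0) ^ 2 - 1) / √A) ?_ ?_
  · refine time_lt_of_speed_lt g1 h.len (fun x _ => (g2 x).continuousAt.continuousWithinAt)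
      h.traj.continuousOn_fst (fun x _ => g2 x) (fun x hx => h.traj.hasDerivAt_fst hx)
      (fun x hx => g3 x hx.1) h.vel g5 rfl g6 rfl fun y hy x hx hxy => ?_
    have hxI := Ioo_subset_Icc_self hx
    refine lt_of_pow_lt_pow_left₀ 2 (h.vel x hx).le ?_
    rw [g4, hxy, h.sq_eq hp hxI]
    have h1 := h.strictMonoOn h.left_mem hxI hx.1
    have h2 := hmono (left_mem_Icc.2 h.lt.le)
      ⟨h1.le, (h.strictMonoOn hxI h.right_mem hx.2).le⟩ h1
    simp only at h2
    linarith
  · refine div_le_div_of_nonneg_right (Real.arsinh_le_arsinh.2 (Real.sqrt_le_sqrt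
      (sub_le_sub_right ?_ 1))) (Real.sqrt_nonneg A)
    rw [div_pow, inv_eq_one_div, div_le_div_iff₀ (pow_pos hn 2) (mul_pos hk hA), one_mul]
    have h4 := h.potential_left hp
    have h5 := two_mul_potential_le hp hn
    rw [h4, potential_eq h.mem.1] at h5
    have h6 : u ℓ ^ (p - 2) / p ≤ u ℓ ^ (p - 2) / 2 :=
      div_le_div_of_nonneg_left (Real.rpow_nonneg h.mem.1.le _) two_pos hp.le
    have h7 : (1 - θ ^ 2) * u ℓ ^ 2 * A ≤
        (1 - θ ^ 2) * u ℓ ^ 2 * (2 * (1 / 2 - u ℓ ^ (p - 2) / p)) :=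
      mul_le_mul_of_nonneg_left (by linarith) (mul_nonneg hk.le (sq_nonneg _))
    linarith

lemma leftRoot_zero (hp : 2 < p) : leftRoot p 0 = 0 := by
  have h1 := (potential_one_pos hp).le
  refine (strictMonoOn_potential hp).injOn
    ⟨leftRoot_nonneg hp le_rfl h1, leftRoot_le_one hp le_rfl h1⟩ ⟨le_rfl, zero_le_one⟩ ?_
  rw [potential_leftRoot hp le_rfl h1, potential_zero hp]

/-- From `v² ≤ 2 f(u) ≤ u²`. An arc that starts near `0` and ends far from it must be long. -/
lemma IsLeftArc.le_mul_exp (hp : 2 < p) (hθ : 0 < θ) (h : IsLeftArc p θ ℓ u v) :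
    u ℓ ≤ u 0 * Real.exp ℓ := by
  have h1 := h.traj.le_mul_exp h.len.le (K := 1) fun x hx => by
    have hxI := Ioo_subset_Icc_self hx
    have hx0 := h.traj.pos x hxI
    rw [one_mul]
    refine le_of_sq_le_sq ?_ hx0.le
    have h2 := two_mul_potential_le hp hx0
    have h3 : 0 ≤ potential p (u 0) := by
      have := (strictMonoOn_potential hp).monotoneOn ⟨le_rfl, zero_le_one⟩
        ⟨h.zero_lt.le, (h.lt_one hp hθ).le⟩ h.zero_lt.le
      rwa [potential_zero hp] at this
    rw [h.sq_eq hp hxI]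
    linarith
  rwa [one_mul] at h1

lemma IsLeftArc.left_eq (hp : 2 < p) (hθ : θ ∈ Ioo (0 : ℝ) 1) (h : IsLeftArc p θ ℓ u v) :
    u 0 = leftEnd p θ (u ℓ) := by
  refine (strictMonoOn_potential hp).injOn ⟨h.zero_lt.le, (h.lt_one hp hθ.1).le⟩
    ⟨(leftEnd_pos hp hθ h.mem).le, (leftEnd_lt_one hp hθ h.mem).le⟩ ?_
  rw [h.potential_left hp, potential_leftEnd hp hθ h.mem]

theorem exists_isLeftArc_len (hp : 2 < p) (hθ : θ ∈ Ioo (0 : ℝ) 1)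
    (hl : Real.arsinh (θ / √(1 - θ ^ 2)) < ℓ) : ∃ u v, IsLeftArc p θ ℓ u v := by
  have hk := one_sub_sq_pos hθ
  have hm := one_lt_solitonMax hp
  -- Short arcs: `z` small, with `A < 1` so close to `1` that the bound of `len_lt` is below `ℓ`.
  -- The witness satisfies `z^(p-2) = (1 - A) / 2 < 1 - A`.
  obtain ⟨a, ha, h1⟩ : ∃ a ∈ Ioo 0 (solitonMax p), leftLen p θ a ≤ ℓ := by
    have h1 : ∀ᶠ A in 𝓝 (1 : ℝ), Real.arsinh √(((1 - θ ^ 2) * A)⁻¹ - 1) / √A < ℓ := by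
      have hc : ContinuousAt
          (fun A : ℝ => Real.arsinh √(((1 - θ ^ 2) * A)⁻¹ - 1) / √A) 1 := by
        refine ContinuousAt.div (Real.continuous_arsinh.continuousAt.comp
          (Real.continuous_sqrt.continuousAt.comp (ContinuousAt.sub (ContinuousAt.inv₀
          (continuousAt_const.mul continuousAt_id) ?_) continuousAt_const)))
          Real.continuous_sqrt.continuousAt ?_
        · simpa using hk.ne'
        · simp
      refine hc.tendsto.eventually (gt_mem_nhds ?_)
      rw [mul_one, Real.sqrt_one, div_one, ← div_sqrt_one_sub_sq hθ]
      exact hl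
    obtain ⟨A, h2, h3⟩ := ((h1.filter_mono nhdsWithin_le_nhds).and
      (Ioo_mem_nhdsLT (show (0 : ℝ) < 1 from one_pos))).exists
    have hδ : 0 < (1 - A) / 2 := by linarith [h3.2]
    have hp2 : 0 < p - 2 := by linarith
    refine ⟨((1 - A) / 2) ^ (1 / (p - 2)), ⟨Real.rpow_pos_of_pos hδ _,
      (Real.rpow_lt_one hδ.le (by linarith [h3.1]) (one_div_pos.2 hp2)).trans hm⟩, ?_⟩
    obtain ⟨u, v, h, hu⟩ := exists_isLeftArc hp hθ (z := ((1 - A) / 2) ^ (1 / (p - 2)))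
      ⟨Real.rpow_pos_of_pos hδ _,
        (Real.rpow_lt_one hδ.le (by linarith [h3.1]) (one_div_pos.2 hp2)).trans hm⟩
    refine ((h.len_lt hp hθ h3.1 ?_).trans h2).le
    rw [hu, ← Real.rpow_mul hδ.le, one_div, inv_mul_cancel₀ hp2.ne', Real.rpow_one]
    linarith [h3.2]
  -- Long arcs: as `z → solitonMax p`, `f(z) → 0`, so the starting point tends to `0`.
  obtain ⟨b, hb, h2⟩ : ∃ b ∈ Ioo 0 (solitonMax p), ℓ ≤ leftLen p θ b := by
    have h1 : ∀ᶠ z in 𝓝 (solitonMax p), leftEnd p θ z * Real.exp ℓ < z := by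
      refine ContinuousAt.eventually_lt ?_ continuousAt_id ?_
      · exact (((continuous_leftRoot hp).comp
          (continuous_const.mul (continuous_potential hp))).mul continuous_const).continuousAt
      · rw [leftEnd, potential_solitonMax hp, mul_zero, leftRoot_zero hp, zero_mul]
        exact solitonMax_pos hp
    obtain ⟨z, h2, h3⟩ := ((h1.filter_mono nhdsWithin_le_nhds).and
      (Ioo_mem_nhdsLT (solitonMax_pos hp))).exists
    refine ⟨z, h3, ?_⟩
    by_contra! hlt
    obtain ⟨u, v, h, hu⟩ := exists_isLeftArc hp hθ h3
    have h4 := h.le_mul_exp hp hθ.1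
    rw [h.left_eq hp hθ, hu] at h4
    exact absurd (h4.trans (mul_le_mul_of_nonneg_left (Real.exp_le_exp.2 hlt.le)
      (leftEnd_pos hp hθ h3).le)) (not_le.2 h2)
  obtain ⟨z, hz, he⟩ := isPreconnected_Ioo.intermediate_value ha hb
    (continuousOn_leftLen hp hθ) ⟨h1, h2⟩
  obtain ⟨u, v, h, -⟩ := exists_isLeftArc hp hθ hz
  rw [he] at h
  exact ⟨u, v, h⟩

/-- Orbits around `1` are parametrised by the number `θ ∈ (0, 1)` such that they cross level `1`
with slope `θ √(2 f(1))`. As `θ → 0` the orbit shrinks to the equilibrium and `len_lt` bounds the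
length by quantities tending to `π / √(p - 2)`; as `θ → 1` it starts ever closer to `0` and the
length is unbounded. -/
theorem exists_isRestArc_len (hp : 2 < p) (hl : Real.pi / √(p - 2) < ℓ) :
    ∃ u v, IsRestArc p ℓ u v := by
  have hm := one_mem_Ioo_solitonMax hp
  have key : ∀ θ ∈ Ioo (0 : ℝ) 1, ∃ u v, IsRestArc p (leftLen p θ 1 + rightLen p θ 1) u v ∧
      u 0 = leftEnd p θ 1 ∧ 1 ≤ leftEnd p θ 1 * Real.exp (leftLen p θ 1 + rightLen p θ 1) := by
    intro θ hθ
    obtain ⟨u₁, v₁, h₁, e₁⟩ := exists_isLeftArc hp hθ hm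
    obtain ⟨u₂, v₂, h₂, e₂⟩ := exists_isRightArc hp hθ.1 hm
    obtain ⟨u, v, h, e⟩ := h₁.exists_isRestArc hp hθ.1 h₂ (e₁.trans e₂.symm)
    have h3 := h₁.left_eq hp hθ
    have h4 := h₁.le_mul_exp hp hθ.1
    rw [h3, e₁] at h4
    rw [e₁] at h3
    exact ⟨u, v, h, e.trans h3, h4.trans (mul_le_mul_of_nonneg_left
      (Real.exp_le_exp.2 (by linarith [h₂.len])) (leftEnd_pos hp hθ hm).le)⟩
  have hcl : Continuous fun θ => leftEnd p θ 1 :=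
    (continuous_leftRoot hp).comp (by fun_prop)
  have hcont : ContinuousOn (fun θ => leftLen p θ 1 + rightLen p θ 1) (Ioo 0 1) := by
    rw [continuousOn_iff_continuous_domRestrict]
    refine Continuous.add ?_ ?_
    · exact continuous_leftTime hp (hcl.comp continuous_subtype_val) continuous_const
        (fun θ => leftEnd_pos hp θ.2 hm) (fun θ => leftEnd_lt_one hp θ.2 hm)
        (fun θ => leftEnd_lt hp θ.2 hm) fun θ w hw => potential_leftEnd_lt hp θ.2 hm hw
    · exact continuous_rightTime hp continuous_const
        ((continuous_rightRoot hp).comp (by fun_prop))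
        (fun θ => lt_rightEnd hp θ.2.1 hm) (fun θ => one_lt_rightEnd hp θ.2.1 hm)
        fun θ w hw => potential_rightEnd_lt hp θ.2.1 hm hw
  obtain ⟨a, ha, h1⟩ : ∃ θ ∈ Ioo (0 : ℝ) 1, leftLen p θ 1 + rightLen p θ 1 ≤ ℓ := by
    have hc : ContinuousAt (fun w : ℝ => (p - 1) * w ^ (p - 2) - 1) 1 :=
      (continuousAt_const.mul (Real.continuousAt_rpow_const _ _ (Or.inl one_ne_zero))).sub
        continuousAt_const
    have h0 : leftEnd p 0 1 = 1 := by
      have h1 := (potential_one_pos hp).le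
      refine (strictMonoOn_potential hp).injOn ?_ ⟨zero_le_one, le_rfl⟩ ?_
      · simp only [leftEnd, ne_eq, OfNat.ofNat_ne_zero, not_false_eq_true, zero_pow, sub_zero,
          one_mul]
        exact ⟨leftRoot_nonneg hp h1 le_rfl, leftRoot_le_one hp h1 le_rfl⟩
      · simp only [leftEnd, ne_eq, OfNat.ofNat_ne_zero, not_false_eq_true, zero_pow, sub_zero,
          one_mul]
        exact potential_leftRoot hp h1 le_rfl
    have hc' : ContinuousAt (fun θ : ℝ => (p - 1) * leftEnd p θ 1 ^ (p - 2) - 1) 0 :=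
      ContinuousAt.comp (g := fun w : ℝ => (p - 1) * w ^ (p - 2) - 1) (by rwa [h0])
        hcl.continuousAt
    have hp2 : 0 < p - 2 := by linarith
    have e0 : (p - 1) * leftEnd p 0 1 ^ (p - 2) - 1 = p - 2 := by
      rw [h0, Real.one_rpow]
      ring
    have h2 : ∀ᶠ θ in 𝓝 (0 : ℝ), 0 < (p - 1) * leftEnd p θ 1 ^ (p - 2) - 1 :=
      hc'.eventually (lt_mem_nhds (by simpa only [e0] using hp2))
    have h3 : ∀ᶠ θ in 𝓝 (0 : ℝ),
        Real.pi / √((p - 1) * leftEnd p θ 1 ^ (p - 2) - 1) < ℓ := by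
      have : ContinuousAt
          (fun θ : ℝ => Real.pi / √((p - 1) * leftEnd p θ 1 ^ (p - 2) - 1)) 0 :=
        continuousAt_const.div (Real.continuous_sqrt.continuousAt.comp hc')
          (by simpa only [Function.comp, e0] using (Real.sqrt_pos.2 hp2).ne')
      exact this.eventually (gt_mem_nhds (by simpa only [e0] using hl))
    obtain ⟨θ, ⟨h4, h5⟩, h6⟩ := (((h2.and h3).filter_mono nhdsWithin_le_nhds).and
      (Ioo_mem_nhdsGT (show (0 : ℝ) < 1 from one_pos))).exists
    obtain ⟨u, v, h, e, -⟩ := key θ h6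
    rw [← e] at h4 h5
    exact ⟨θ, h6, ((h.len_lt hp h4).trans h5).le⟩
  obtain ⟨b, hb, h2⟩ : ∃ θ ∈ Ioo (0 : ℝ) 1, ℓ ≤ leftLen p θ 1 + rightLen p θ 1 := by
    have h1 : ∀ᶠ θ in 𝓝 (1 : ℝ), leftEnd p θ 1 * Real.exp ℓ < 1 := by
      refine (hcl.mul continuous_const).continuousAt.eventually (gt_mem_nhds ?_)
      simp [leftEnd, leftRoot_zero hp]
    obtain ⟨θ, h2, h3⟩ := ((h1.filter_mono nhdsWithin_le_nhds).and
      (Ioo_mem_nhdsLT (show (0 : ℝ) < 1 from one_pos))).exists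
    refine ⟨θ, h3, ?_⟩
    by_contra! hlt
    obtain ⟨-, -, -, -, h4⟩ := key θ h3
    exact absurd (h4.trans (mul_le_mul_of_nonneg_left (Real.exp_le_exp.2 hlt.le)
      (leftEnd_pos hp h3 hm).le)) (not_le.2 h2)
  obtain ⟨θ, hθ, he⟩ := isPreconnected_Ioo.intermediate_value ha hb hcont ⟨h1, h2⟩
  obtain ⟨u, v, h, -⟩ := key θ hθ
  simp only at he
  rw [he] at h
  exact ⟨u, v, h⟩

end Lengths

/-! ### Solutions of the overdetermined problem -/

section Solutions

variable {p θ ℓ : ℝ} {u v w : ℝ → ℝ}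

lemma IsRightArc.isODESolution (h : IsRightArc p θ ℓ u v) : IsODESolution p θ ℓ u :=
  ⟨v, h.traj.hu, h.traj.hv, h.mem, h.left, h.right, h.traj.pos⟩

lemma IsLeftArc.isODESolution (h : IsLeftArc p θ ℓ u v) :
    IsODESolution p (-θ) ℓ fun x => u (ℓ - x) := by
  have hr := h.traj.reverse
  exact ⟨_, hr.hu, hr.hv, by simpa using h.mem, by simp [h.right], by simp [h.left], hr.pos⟩

lemma IsLeftArc.strictAntiOn (h : IsLeftArc p θ ℓ u v) :
    StrictAntiOn (fun x => u (ℓ - x)) (Icc 0 ℓ) := fun x hx y hy hxy =>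
  h.strictMonoOn ⟨by linarith [hy.2], by linarith [hy.1]⟩ ⟨by linarith [hx.2], by linarith [hx.1]⟩
    (by linarith)

lemma IsRestArc.mem_left (hp : 2 < p) (h : IsRestArc p ℓ u v) : u 0 ∈ Ioo 0 (solitonMax p) :=
  ⟨h.zero_lt, (h.lt_one hp).trans (one_lt_solitonMax hp)⟩

lemma IsRestArc.mem_right (hp : 2 < p) (h : IsRestArc p ℓ u v) : u ℓ ∈ Ioo 0 (solitonMax p) :=
  ⟨h.traj.pos _ h.right_mem, lt_solitonMax_of_potential_pos hp (by
    rw [h.potential_eq hp]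
    exact potential_pos hp (h.mem_left hp))⟩

lemma IsRestArc.isODESolution (hp : 2 < p) (h : IsRestArc p ℓ u v) : IsODESolution p 0 ℓ u :=
  ⟨v, h.traj.hu, h.traj.hv, h.mem_left hp, by simp [h.left], h.right, h.traj.pos⟩

lemma IsRestArc.isODESolution_reverse (hp : 2 < p) (h : IsRestArc p ℓ u v) :
    IsODESolution p 0 ℓ fun x => u (ℓ - x) := by
  have hr := h.traj.reverse
  exact ⟨_, hr.hu, hr.hv, by simpa using h.mem_right hp, by simp [h.right], by simp [h.left],
    hr.pos⟩

lemma IsRestArc.strictAntiOn_reverse (h : IsRestArc p ℓ u v) :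
    StrictAntiOn (fun x => u (ℓ - x)) (Icc 0 ℓ) := fun x hx y hy hxy =>
  h.strictMonoOn ⟨by linarith [hy.2], by linarith [hy.1]⟩ ⟨by linarith [hx.2], by linarith [hx.1]⟩
    (by linarith)

lemma IsODESolution.exists_isRightArc (hp : 2 < p) (hl : 0 < ℓ) (h : IsODESolution p θ ℓ u)
    (hm : StrictMonoOn u (Icc 0 ℓ)) : ∃ v, IsRightArc p θ ℓ u v := by
  obtain ⟨v, h1, h2, h3, h4, h5, h6⟩ := h
  have ht : IsTraj p ℓ u v := ⟨h1, h2, h6⟩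
  exact ⟨v, ht, hl, h3, h4, h5, ht.snd_pos_of_strictMonoOn hp hm⟩

lemma IsODESolution.exists_isLeftArc (hp : 2 < p) (hl : 0 < ℓ) (h : IsODESolution p θ ℓ u)
    (hm : StrictAntiOn u (Icc 0 ℓ)) : ∃ v, IsLeftArc p (-θ) ℓ (fun x => u (ℓ - x)) v := by
  obtain ⟨v, h1, h2, h3, h4, h5, h6⟩ := h
  have ht : IsTraj p ℓ u v := ⟨h1, h2, h6⟩
  refine ⟨fun x => -v (ℓ - x), ht.reverse, hl, by simpa using h3, by simp [h5], by simp [h4],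
    fun x hx => neg_pos.2 (ht.snd_neg_of_strictAntiOn hp hm _ ⟨by linarith [hx.2],
      by linarith [hx.1]⟩)⟩

lemma IsODESolution.exists_isRestArc (hp : 2 < p) (hl : 0 < ℓ) (h : IsODESolution p 0 ℓ u)
    (hm : StrictMonoOn u (Icc 0 ℓ)) : ∃ v, IsRestArc p ℓ u v := by
  obtain ⟨v, h1⟩ := h.exists_isRightArc hp hl hm
  exact ⟨v, h1.traj, h1.len, by simpa using h1.left, h1.right, h1.vel⟩

lemma IsODESolution.exists_isRestArc_reverse (hp : 2 < p) (hl : 0 < ℓ)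
    (h : IsODESolution p 0 ℓ u) (hm : StrictAntiOn u (Icc 0 ℓ)) :
    ∃ v, IsRestArc p ℓ (fun x => u (ℓ - x)) v := by
  obtain ⟨v, h1⟩ := h.exists_isLeftArc hp hl hm
  exact ⟨v, h1.traj, h1.len, h1.left, by simpa using h1.right, h1.vel⟩

lemma IsRestArc.eqOn (hp : 2 < p) {u₁ v₁ u₂ v₂ : ℝ → ℝ} (h₁ : IsRestArc p ℓ u₁ v₁)
    (h₂ : IsRestArc p ℓ u₂ v₂) : EqOn u₁ u₂ (Icc 0 ℓ) := by
  refine (h₁.traj.eqOn hp h₂.traj ?_ (by rw [h₁.left, h₂.left])).1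
  rcases lt_trichotomy (u₁ 0) (u₂ 0) with h | h | h
  · exact absurd (h₁.time_lt hp h₂ h) (lt_irrefl _)
  · exact h
  · exact absurd (h₂.time_lt hp h₁ h) (lt_irrefl _)

lemma IsODESolution.not_strictAntiOn (hp : 2 < p) (hl : 0 < ℓ) (hθ : 0 < θ)
    (h : IsODESolution p θ ℓ u) : ¬ StrictAntiOn u (Icc 0 ℓ) := fun hm => by
  obtain ⟨v, h1, -, h3, h4, -⟩ := h
  have h5 := (h1 0 ⟨le_rfl, hl.le⟩).derivWithin (uniqueDiffOn_Icc hl 0 ⟨le_rfl, hl.le⟩)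
  have h6 := hm.antitoneOn.derivWithin_nonpos (x := 0)
  rw [h5, h4] at h6
  exact absurd h6 (not_le.2 (mul_pos hθ (Real.sqrt_pos.2 (mul_pos two_pos (potential_pos hp h3)))))

lemma IsODESolution.not_strictMonoOn (hp : 2 < p) (hl : 0 < ℓ) (hθ : θ < 0)
    (h : IsODESolution p θ ℓ u) : ¬ StrictMonoOn u (Icc 0 ℓ) := fun hm => by
  obtain ⟨v, h1, -, h3, h4, -⟩ := h
  have h5 := (h1 0 ⟨le_rfl, hl.le⟩).derivWithin (uniqueDiffOn_Icc hl 0 ⟨le_rfl, hl.le⟩)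
  have h6 := hm.monotoneOn.derivWithin_nonneg (x := 0)
  rw [h5, h4] at h6
  exact absurd h6 (not_le.2 (mul_neg_of_neg_of_pos hθ
    (Real.sqrt_pos.2 (mul_pos two_pos (potential_pos hp h3)))))

theorem existsUniqueOn_constant (hp : 2 < p) (hl : 0 < ℓ) :
    ExistsUniqueOn ℓ (fun u => IsODESolution p 0 ℓ u ∧ ∃ c : ℝ, ∀ x ∈ Icc 0 ℓ, u x = c)
      (fun u => ∀ x ∈ Icc 0 ℓ, u x = 1) := by
  refine ⟨fun _ => 1, ⟨⟨fun _ => 0, fun x _ => hasDerivWithinAt_const _ _ _, fun x _ => ?_,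
    one_mem_Ioo_solitonMax hp, by simp, rfl, fun _ _ => one_pos⟩, 1, fun _ _ => rfl⟩,
    fun _ _ => rfl, ?_⟩
  · simpa using hasDerivWithinAt_const x (Icc 0 ℓ) (0 : ℝ)
  rintro u ⟨⟨v, h1, h2, -, -, -, h6⟩, c, hc⟩ x hx
  have ht : IsTraj p ℓ u v := ⟨h1, h2, h6⟩
  have hv : EqOn v 0 (Ioo 0 ℓ) := fun y hy => by
    refine (ht.hasDerivAt_fst hy).unique ((hasDerivAt_const y c).congr_of_eventuallyEq ?_)
    filter_upwards [Ioo_mem_nhds hy.1 hy.2] with t ht' using hc t (Ioo_subset_Icc_self ht')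
  have hy : ℓ / 2 ∈ Ioo 0 ℓ := ⟨by linarith, by linarith⟩
  have h7 := (ht.hasDerivAt_snd hy).unique ((hasDerivAt_const (ℓ / 2) (0 : ℝ)).congr_of_eventuallyEq
    (by filter_upwards [Ioo_mem_nhds hy.1 hy.2] with t ht' using hv ht'))
  have h8 := h6 _ (Ioo_subset_Icc_self hy)
  rw [hc _ (Ioo_subset_Icc_self hy)] at h7 h8
  rw [hc x hx]
  rcases lt_trichotomy c 1 with h | h | h
  · linarith [rpow_lt_self hp h8 h]
  · exact h
  · linarith [self_lt_rpow hp h]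

theorem not_exists_monotone_of_le (hp : 2 < p) (hl : 0 < ℓ) (hle : ℓ ≤ Real.pi / √(p - 2)) :
    ¬ ∃ u, IsODESolution p 0 ℓ u ∧ IsMonotoneOn ℓ u := by
  rintro ⟨u, h, hm | hm⟩
  · obtain ⟨v, h1⟩ := h.exists_isRestArc hp hl hm
    exact absurd (h1.lt_len hp) (not_lt.2 hle)
  · obtain ⟨v, h1⟩ := h.exists_isRestArc_reverse hp hl hm
    exact absurd (h1.lt_len hp) (not_lt.2 hle)

theorem existsUniqueOn_increasing_zero (hp : 2 < p) (hl : Real.pi / √(p - 2) < ℓ) :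
    ExistsUniqueOn ℓ (fun u => IsODESolution p 0 ℓ u ∧ StrictMonoOn u (Icc 0 ℓ))
      (fun u => u 0 ∈ Ioo 0 1) := by
  obtain ⟨u, v, h⟩ := exists_isRestArc_len hp hl
  refine ⟨u, ⟨h.isODESolution hp, h.strictMonoOn⟩, ⟨h.zero_lt, h.lt_one hp⟩, ?_⟩
  rintro w ⟨hw, hm⟩
  obtain ⟨v', h1⟩ := hw.exists_isRestArc hp h.len hm
  exact h1.eqOn hp h

theorem existsUniqueOn_decreasing_zero (hp : 2 < p) (hl : Real.pi / √(p - 2) < ℓ) :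
    ExistsUniqueOn ℓ (fun u => IsODESolution p 0 ℓ u ∧ StrictAntiOn u (Icc 0 ℓ))
      (fun u => 1 < u 0) := by
  obtain ⟨u, v, h⟩ := exists_isRestArc_len hp hl
  refine ⟨fun x => u (ℓ - x), ⟨h.isODESolution_reverse hp, h.strictAntiOn_reverse⟩,
    by simpa using h.one_lt hp, ?_⟩
  rintro w ⟨hw, hm⟩ x hx
  obtain ⟨v', h1⟩ := hw.exists_isRestArc_reverse hp h.len hm
  have := h1.eqOn hp h (x := ℓ - x) ⟨by linarith [hx.2], by linarith [hx.1]⟩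
  simpa using this

lemma IsRightArc.eqOn_of_time_lt (hp : 2 < p)
    (ht : ∀ {ℓ₁ ℓ₂ u₁ v₁ u₂ v₂}, IsRightArc p θ ℓ₁ u₁ v₁ → IsRightArc p θ ℓ₂ u₂ v₂ →
      u₁ 0 < u₂ 0 → ℓ₂ < ℓ₁) {u₁ v₁ u₂ v₂ : ℝ → ℝ} (h₁ : IsRightArc p θ ℓ u₁ v₁)
    (h₂ : IsRightArc p θ ℓ u₂ v₂) : EqOn u₁ u₂ (Icc 0 ℓ) := by
  refine h₁.eq_of_left_eq hp h₂ ?_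
  rcases lt_trichotomy (u₁ 0) (u₂ 0) with h | h | h
  · exact absurd (ht h₁ h₂ h) (lt_irrefl _)
  · exact h
  · exact absurd (ht h₂ h₁ h) (lt_irrefl _)

theorem existsUniqueOn_of_mem_Ioo_zero_one (hp : 2 < p) (hl : 0 < ℓ) (hθ : θ ∈ Ioo (0 : ℝ) 1) :
    ExistsUniqueOn ℓ (fun u => IsODESolution p θ ℓ u ∧ IsMonotoneOn ℓ u)
      (fun u => StrictMonoOn u (Icc 0 ℓ)) := by
  obtain ⟨u, v, h⟩ := exists_isRightArc_len hp hθ.1 hl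
  refine ⟨u, ⟨h.isODESolution, Or.inl h.strictMonoOn⟩, h.strictMonoOn, ?_⟩
  rintro w ⟨hw, hm⟩
  obtain ⟨v', h1⟩ := hw.exists_isRightArc hp hl
    (hm.resolve_right (hw.not_strictAntiOn hp hl hθ.1))
  exact h1.eqOn_of_time_lt hp (fun k₁ k₂ => k₁.time_lt_of_lt_one hp hθ k₂) h

lemma neg_mem_Ioo (hθ : θ ∈ Ioo (-1 : ℝ) 0) : -θ ∈ Ioo (0 : ℝ) 1 :=
  ⟨by linarith [hθ.2], by linarith [hθ.1]⟩

theorem not_exists_monotone_of_le_arsinh (hp : 2 < p) (hl : 0 < ℓ) (hθ : θ ∈ Ioo (-1 : ℝ) 0)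
    (hle : ℓ ≤ Real.arsinh (|θ| / √(1 - θ ^ 2))) :
    ¬ ∃ u, IsODESolution p θ ℓ u ∧ IsMonotoneOn ℓ u := by
  rintro ⟨u, h, hm⟩
  obtain ⟨v, h1⟩ := h.exists_isLeftArc hp hl (hm.resolve_left (h.not_strictMonoOn hp hl hθ.2))
  have h2 := h1.lt_len hp (neg_mem_Ioo hθ)
  rw [neg_sq, ← abs_of_neg hθ.2] at h2
  exact absurd h2 (not_lt.2 hle)

theorem existsUniqueOn_of_mem_Ioo_neg_one_zero (hp : 2 < p) (hl : 0 < ℓ)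
    (hθ : θ ∈ Ioo (-1 : ℝ) 0) (hlt : Real.arsinh (|θ| / √(1 - θ ^ 2)) < ℓ) :
    ExistsUniqueOn ℓ (fun u => IsODESolution p θ ℓ u ∧ IsMonotoneOn ℓ u)
      (fun u => StrictAntiOn u (Icc 0 ℓ)) := by
  have hθ' := neg_mem_Ioo hθ
  obtain ⟨u, v, h⟩ := exists_isLeftArc_len hp hθ' (ℓ := ℓ) (by
    rwa [neg_sq, ← abs_of_neg hθ.2])
  have h0 := h.isODESolution
  rw [neg_neg] at h0
  refine ⟨fun x => u (ℓ - x), ⟨h0, Or.inr h.strictAntiOn⟩, h.strictAntiOn, ?_⟩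
  rintro w ⟨hw, hm⟩ x hx
  obtain ⟨v', h1⟩ := hw.exists_isLeftArc hp hl (hm.resolve_left (hw.not_strictMonoOn hp hl hθ.2))
  have h2 : w (ℓ - ℓ) = u ℓ := by
    rcases lt_trichotomy (w (ℓ - ℓ)) (u ℓ) with h | h | h
    · exact absurd (h1.time_lt hp hθ' ‹_› h) (lt_irrefl _)
    · exact h
    · exact absurd (IsLeftArc.time_lt hp hθ' ‹_› h1 h) (lt_irrefl _)
  have := h1.eq_of_right_eq hp h h2 (x := ℓ - x) ⟨by linarith [hx.2], by linarith [hx.1]⟩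
  simpa using this

/-- For `θ = 1` the energy is zero, so a solution comes to rest at `solitonMax p`, and the final
data determine it. -/
theorem existsUniqueOn_one (hp : 2 < p) (hl : 0 < ℓ) :
    ExistsUniqueOn ℓ (fun u => IsODESolution p 1 ℓ u)
      (fun u => StrictMonoOn u (Icc 0 ℓ) ∧
        ∃ a : ℝ, ∀ x ∈ Icc 0 ℓ, u x = soliton p (x + a)) := by
  have ht := soliton_isTraj hp (-ℓ) ℓ
  refine ⟨fun x => soliton p (x + -ℓ), ⟨_, ht.hu, ht.hv, ?_, ?_, ?_, ht.pos⟩, ⟨?_, -ℓ,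
    fun _ _ => rfl⟩, ?_⟩
  · exact ⟨soliton_pos hp _, soliton_lt_solitonMax hp (by linarith)⟩
  · simp only [zero_add]
    rw [solitonVel_neg, soliton_neg, solitonVel_eq hp hl.le, neg_neg, one_mul]
  · simp [solitonVel_zero]
  · refine ht.strictMonoOn fun x hx => ?_
    have := solitonVel_neg_of_pos hp (show 0 < ℓ - x by linarith [hx.2])
    rw [show x + -ℓ = -(ℓ - x) by ring, solitonVel_neg]
    linarith
  · rintro u ⟨v, h1, h2, h3, h4, h5, h6⟩
    have hu : IsTraj p ℓ u v := ⟨h1, h2, h6⟩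
    have hr : ℓ ∈ Icc 0 ℓ := ⟨hl.le, le_rfl⟩
    refine (hu.eqOn_of_right hp ht ?_ (by simp [h5, solitonVel_zero])).1
    have he := hu.energy hp hr
    rw [h4, h5, mul_pow, Real.sq_sqrt (mul_pos two_pos (potential_pos hp h3)).le] at he
    rw [add_neg_cancel, soliton_zero]
    have h7 : potential p (u ℓ) = 0 := by linarith
    rcases lt_trichotomy (u ℓ) (solitonMax p) with h | h | h
    · exact absurd h7 (potential_pos hp ⟨h6 ℓ hr, h⟩).ne'
    · exact h
    · have := strictAntiOn_potential hp (one_lt_solitonMax hp).le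
        ((one_lt_solitonMax hp).trans h).le h
      rw [potential_solitonMax hp] at this
      exact absurd h7 this.ne

/-- The solution decreases up to its first critical point, at a level below `z`, where `f` is
positive. But the energy gives it the value `(1 - θ²) f(z) ≤ 0` there. -/
theorem not_exists_of_le_neg_one (hp : 2 < p) (hl : 0 < ℓ) (hθ : θ ≤ -1) :
    ¬ ∃ u, IsODESolution p θ ℓ u := by
  rintro ⟨u, v, h1, h2, h3, h4, h5, h6⟩
  have ht : IsTraj p ℓ u v := ⟨h1, h2, h6⟩
  have hf := potential_pos hp h3
  have hv0 : v 0 < 0 := by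
    rw [h4]
    exact mul_neg_of_neg_of_pos (by linarith) (Real.sqrt_pos.2 (mul_pos two_pos hf))
  obtain ⟨c, hc, hvc, hneg⟩ := exists_first_zero hl.le ht.continuousOn_snd hv0.ne h5
  have hcI : c ∈ Icc 0 ℓ := ⟨hc.1.le, hc.2⟩
  have hanti := (ht.restrict hc.2).strictAntiOn fun x hx =>
    neg_of_mul_pos_right (hneg x ⟨hx.1.le, hx.2⟩) hv0.le
  have hlt : u c < u 0 := hanti ⟨le_rfl, hc.1.le⟩ ⟨hc.1.le, le_rfl⟩ hc.1
  have he := ht.energy hp hcI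
  rw [h4, hvc, mul_pow, Real.sq_sqrt (mul_pos two_pos hf).le] at he
  have hfc := potential_pos hp ⟨h6 c hcI, hlt.trans h3.2⟩
  have := mul_le_mul_of_nonneg_right (show 1 ≤ θ ^ 2 by nlinarith) (mul_pos two_pos hf).le
  linarith

theorem exists_increasing (hp : 2 < p) (hl : 0 < ℓ) (hθ : 0 < θ) :
    ∃ u, IsODESolution p θ ℓ u ∧ StrictMonoOn u (Icc 0 ℓ) := by
  obtain ⟨u, v, h⟩ := exists_isRightArc_len hp hθ hl
  exact ⟨u, h.isODESolution, h.strictMonoOn⟩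

/-- For `θ > 1` all solutions are increasing: all critical values coincide. -/
theorem IsODESolution.exists_isRightArc_of_one_lt (hp : 2 < p) (hl : 0 < ℓ) (hθ : 1 < θ)
    (h : IsODESolution p θ ℓ u) : ∃ v, IsRightArc p θ ℓ u v := by
  obtain ⟨v, h1, h2, h3, h4, h5, h6⟩ := h
  have ht : IsTraj p ℓ u v := ⟨h1, h2, h6⟩
  have hf := potential_pos hp h3
  have hv0 : 0 < v 0 := by
    rw [h4]
    exact mul_pos (by linarith) (Real.sqrt_pos.2 (mul_pos two_pos hf))
  obtain ⟨c, hc, hvc, hpos⟩ := exists_first_zero hl.le ht.continuousOn_snd hv0.ne' h5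
  have ha : IsRightArc p θ c u v := ⟨ht.restrict hc.2, hc.1, h3, h4, hvc, fun x hx =>
    pos_of_mul_pos_right (hpos x ⟨hx.1.le, hx.2⟩) hv0.le⟩
  rcases hc.2.eq_or_lt with rfl | hcl
  · exact ⟨v, ha⟩
  exfalso
  have hm := ha.one_lt hp (one_pos.trans hθ)
  have hcI : c ∈ Icc 0 ℓ := ⟨hc.1.le, hc.2⟩
  have hfc : potential p (u c) < 0 := by
    rw [ha.potential_right hp]
    exact mul_neg_of_neg_of_pos (by nlinarith) hf
  -- At every critical point `f(u) = (1 - θ²) f(z) < 0`, which forces `u > 1`, where `f` is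
  -- injective.
  have hcrit : ∀ y ∈ Icc 0 ℓ, v y = 0 → u y = u c := fun y hy hvy => by
    have he := ht.energy_eq hp hy hcI
    rw [hvy, hvc] at he
    have hy1 : 1 ≤ u y := by
      by_contra! hlt
      have := potential_pos hp ⟨h6 y hy, hlt.trans (one_lt_solitonMax hp)⟩
      linarith
    exact (strictAntiOn_potential hp).injOn hy1 hm.le (by linarith)
  have hmax : ∀ y ∈ Icc 0 ℓ, u y ≤ u c := fun y hy => by
    by_contra! hlt
    have h7 := strictAntiOn_potential hp hm.le (hm.trans hlt).le hlt
    have he := ht.energy_eq hp hy hcI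
    rw [hvc] at he
    nlinarith [sq_nonneg (v y)]
  have hs : Icc c ℓ ⊆ Icc 0 ℓ := Icc_subset_Icc_left hc.1.le
  -- The minimum of `u` on `[c, ℓ]` is taken at a critical point, so it equals the maximum `u c`.
  -- Then `u` is constant there at a level above `1`, which is no equilibrium.
  obtain ⟨y, hy, hmin⟩ := isCompact_Icc.exists_isMinOn (nonempty_Icc.2 hcl.le)
    (ht.continuousOn_fst.mono hs)
  have hyc : u y = u c := by
    rcases hy.1.eq_or_lt with rfl | h7
    · rfl
    rcases hy.2.eq_or_lt with rfl | h8
    · exact hcrit _ (hs hy) h5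
    · refine hcrit y (hs hy) ?_
      exact (hmin.isLocalMin (Icc_mem_nhds h7 h8)).hasDerivAt_eq_zero
        (ht.hasDerivAt_fst ⟨hc.1.trans h7, h8⟩)
  have hconst : ∀ x ∈ Icc c ℓ, u x = u c := fun x hx =>
    le_antisymm (hmax x (hs hx)) (hyc ▸ hmin hx)
  have hI : Ioo c ℓ ⊆ Ioo 0 ℓ := Ioo_subset_Ioo_left hc.1.le
  have hv : ∀ x ∈ Ioo c ℓ, v x = 0 := fun x hx =>
    (ht.hasDerivAt_fst (hI hx)).unique ((hasDerivAt_const x (u c)).congr_of_eventuallyEq (by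
      filter_upwards [Ioo_mem_nhds hx.1 hx.2] with t ht' using hconst t (Ioo_subset_Icc_self ht')))
  have hx : (c + ℓ) / 2 ∈ Ioo c ℓ := ⟨by linarith, by linarith⟩
  have h7 := (ht.hasDerivAt_snd (hI hx)).unique
    ((hasDerivAt_const _ (0 : ℝ)).congr_of_eventuallyEq (by
      filter_upwards [Ioo_mem_nhds hx.1 hx.2] with t ht' using hv t ht'))
  rw [hconst _ (Ioo_subset_Icc_self hx)] at h7
  linarith [self_lt_rpow hp hm]

theorem existsUniqueOn_of_mem_Ioc_one_two (hp : 2 < p) (hl : 0 < ℓ) (hθ : θ ∈ Ioc (1 : ℝ) 2) :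
    ExistsUniqueOn ℓ (fun u => IsODESolution p θ ℓ u) (fun u => StrictMonoOn u (Icc 0 ℓ)) := by
  obtain ⟨u, v, h⟩ := exists_isRightArc_len hp (one_pos.trans hθ.1) hl
  refine ⟨u, h.isODESolution, h.strictMonoOn, fun w hw => ?_⟩
  obtain ⟨v', h1⟩ := hw.exists_isRightArc_of_one_lt hp hl hθ.1
  exact h1.eqOn_of_time_lt hp (fun k₁ k₂ => k₁.time_lt_of_one_lt hp hθ k₂) h

end Solutions

/-! ### Multiplicity for large `θ` -/

section Multiplicity

variable {p θ ℓ : ℝ} {u v : ℝ → ℝ}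

/-- The curve `m sin(κ x + α)` that goes from `1` to `m`. -/
lemma sine_arc {m κ : ℝ} (hm : 1 < m) (hκ : 0 < κ) :
    0 < Real.arccos (1 / m) / κ ∧ Real.arccos (1 / m) / κ ≤ Real.pi / 2 / κ ∧
    (∀ x, HasDerivAt (fun x => m * Real.cos (Real.arccos (1 / m) - κ * x))
      (m * (κ * Real.sin (Real.arccos (1 / m) - κ * x))) x) ∧
    (∀ x ∈ Ioo 0 (Real.arccos (1 / m) / κ),
      0 < m * (κ * Real.sin (Real.arccos (1 / m) - κ * x))) ∧
    (∀ x, (m * (κ * Real.sin (Real.arccos (1 / m) - κ * x))) ^ 2 =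
      κ ^ 2 * (m ^ 2 - (m * Real.cos (Real.arccos (1 / m) - κ * x)) ^ 2)) ∧
    m * Real.cos (Real.arccos (1 / m) - κ * 0) = 1 ∧
    m * Real.cos (Real.arccos (1 / m) - κ * (Real.arccos (1 / m) / κ)) = m := by
  have hm0 : 0 < m := one_pos.trans hm
  have h1 : 1 / m < 1 := (div_lt_one hm0).2 hm
  have h0 : 0 < 1 / m := one_div_pos.2 hm0
  have ha : 0 < Real.arccos (1 / m) := Real.arccos_pos.2 h1
  refine ⟨div_pos ha hκ, div_le_div_of_nonneg_right (Real.arccos_le_pi_div_two.2 h0.le) hκ.le,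
    fun x => ?_, fun x hx => ?_, fun x => ?_, ?_, ?_⟩
  · have h2 : HasDerivAt (fun x : ℝ => Real.arccos (1 / m) - κ * x) (-κ) x := by
      simpa using ((hasDerivAt_id x).const_mul κ).const_sub (Real.arccos (1 / m))
    exact (h2.cos.const_mul m).congr_deriv (by ring)
  · have h2 := (lt_div_iff₀ hκ).1 hx.2
    have h3 := mul_pos hκ hx.1
    have h4 := Real.arccos_le_pi (1 / m)
    exact mul_pos hm0 (mul_pos hκ (Real.sin_pos_of_pos_of_lt_pi (by linarith) (by linarith)))
  · rw [mul_pow, mul_pow, mul_pow, Real.sin_sq]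
    ring
  · rw [mul_zero, sub_zero, Real.cos_arccos (by linarith) h1.le, mul_one_div_cancel hm0.ne']
  · rw [mul_div_cancel₀ _ hκ.ne', sub_self, Real.cos_zero, mul_one]

/-- Since `u ≤ m`, the energy relation gives `v² ≥ κ² (m² - u²)`, the squared speed of a sine of
amplitude `m` and frequency `κ`. For large `θ` both `m` and `κ` are large, and the arc from level
`1` is short. -/
theorem IsRightArc.len_lt_of_eq_one (hp : 2 < p) (hθ : 1 < θ) (h : IsRightArc p θ ℓ u v)
    (h1 : u 0 = 1) {κ : ℝ} (hκ : 0 < κ) (he : κ ^ 2 = 2 / p * u ℓ ^ (p - 2) - 1) :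
    ℓ < Real.pi / 2 / κ := by
  have hm := h.one_lt hp (one_pos.trans hθ)
  have hm0 := one_pos.trans hm
  obtain ⟨g0, g1, g2, g3, g4, g5, g6⟩ := sine_arc hm hκ
  refine lt_of_lt_of_le ?_ g1
  refine time_lt_of_speed_lt (a := 1) (b := u ℓ) g0 h.len
    (fun x _ => (g2 x).continuousAt.continuousWithinAt)
    h.traj.continuousOn_fst (fun x _ => g2 x) (fun x hx => h.traj.hasDerivAt_fst hx)
    g3 h.vel g5 h1 g6 rfl fun y hy x hx hxy => ?_
  have hxI := Ioo_subset_Icc_self hx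
  have hx0 := h.traj.pos x hxI
  refine lt_of_pow_lt_pow_left₀ 2 (h.vel x hx).le ?_
  have e1 := h.traj.energy_eq hp hxI h.right_mem
  rw [h.right, potential_eq hx0, potential_eq hm0] at e1
  have h2 : u x ^ (p - 2) < u ℓ ^ (p - 2) :=
    Real.rpow_lt_rpow hx0.le (h.strictMonoOn hxI h.right_mem hx.2) (by linarith)
  have h3 := mul_lt_mul_of_pos_left h2 (show 0 < u x ^ 2 * (2 / p) by positivity)
  rw [g4, hxy, he]
  linear_combination h3 - e1

/-- For this `z` the end level is the root of `f = -f(1)` and the speed is at most `2 √f(1)`, both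
independent of `θ`. As `z < solitonMax p`, the distance to cover is bounded below, and so is the
length. -/
theorem IsRightArc.le_len (hp : 2 < p) (hθ : 1 < θ) (h : IsRightArc p θ ℓ u v)
    (hf : (θ ^ 2 - 1) * potential p (u 0) = potential p 1) :
    (rightRoot p (-potential p 1) - solitonMax p) / (2 * √(potential p 1)) ≤ ℓ := by
  have hf1 := potential_one_pos hp
  have hm := h.one_lt hp (one_pos.trans hθ)
  have hle : -potential p 1 ≤ potential p 1 := by linarith
  have e1 : u ℓ = rightRoot p (-potential p 1) := by
    refine (strictAntiOn_potential hp).injOn hm.le (one_le_rightRoot hp hle) ?_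
    rw [potential_rightRoot hp hle, h.potential_right hp]
    linarith
  have hbound : ∀ x ∈ interior (Icc 0 ℓ), deriv u x ≤ 2 * √(potential p 1) := fun x hx => by
    rw [interior_Icc] at hx
    have hxI := Ioo_subset_Icc_self hx
    rw [(h.traj.hasDerivAt_fst hx).deriv]
    refine le_of_sq_le_sq ?_ (by positivity)
    rw [mul_pow, Real.sq_sqrt hf1.le]
    have := h.sq_eq hp hxI
    have := potential_le_potential_one hp (h.traj.pos x hxI).le
    linarith
  have h2 := (convex_Icc 0 ℓ).image_sub_le_mul_sub_of_deriv_le h.traj.continuousOn_fst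
    (fun x hx => by
      rw [interior_Icc] at hx
      exact (h.traj.hasDerivAt_fst hx).differentiableAt.differentiableWithinAt) hbound
    0 h.left_mem ℓ h.right_mem h.len.le
  rw [div_le_iff₀ (by positivity), ← e1]
  linarith [h.mem.2]

/-- Let `z` be the level with `(θ² - 1) f(z) = f(1)`. The length is below `τ` at level `1` and at
least `τ` at `z`, while it is arbitrarily large near `0` and arbitrarily small near `solitonMax p`.
Each value between the lengths at `1` and at `z` is therefore taken on `(0, 1]` and again on `[z,
solitonMax p)`. -/
theorem exists_multiplicity_threshold (hp : 2 < p) : ∃ θstar : ℝ, 2 < θstar ∧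
    ∀ θ : ℝ, θstar < θ → ∃ ℓ₁ ℓ₂ : ℝ, 0 < ℓ₁ ∧ ℓ₁ < ℓ₂ ∧ ∀ ℓ ∈ Icc ℓ₁ ℓ₂, ∃ u w,
      (IsODESolution p θ ℓ u ∧ StrictMonoOn u (Icc 0 ℓ)) ∧
      (IsODESolution p θ ℓ w ∧ StrictMonoOn w (Icc 0 ℓ)) ∧ u 0 < w 0 := by
  have hf1 := potential_one_pos hp
  have hle : -potential p 1 < potential p 1 := by linarith
  set τ := (rightRoot p (-potential p 1) - solitonMax p) / (2 * √(potential p 1)) with hτ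
  have hτ0 : 0 < τ := by
    refine div_pos (sub_pos.2 ?_) (by positivity)
    by_contra! h
    have := (strictAntiOn_potential hp).antitoneOn (one_le_rightRoot hp hle.le)
      (one_lt_solitonMax hp).le h
    rw [potential_solitonMax hp, potential_rightRoot hp hle.le] at this
    linarith
  -- An end level of at least `M` makes the bound `π / (2 κ)` of `len_lt_of_eq_one` smaller than
  -- `τ`.
  obtain ⟨M, hM1, hM⟩ : ∃ M : ℝ, 1 < M ∧ (Real.pi / 2 / τ) ^ 2 + 1 < 2 / p * M ^ (p - 2) := by
    have h1 : Tendsto (fun M : ℝ => 2 / p * M ^ (p - 2)) atTop atTop :=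
      (tendsto_rpow_atTop (by linarith)).const_mul_atTop (by positivity)
    obtain ⟨M, h2, h3⟩ := ((h1.eventually_gt_atTop _).and (eventually_gt_atTop 1)).exists
    exact ⟨M, h3, h2⟩
  -- Above this threshold `(θ² - 1) f(1) ≥ |f(M)|`, so the arc from level `1` ends at `M` or higher.
  refine ⟨3 + |potential p M| / potential p 1, ?_, fun θ hθ => ?_⟩
  · have : 0 ≤ |potential p M| / potential p 1 := by positivity
    linarith
  have hq : 0 ≤ |potential p M| / potential p 1 := by positivity
  have hθ1 : 1 < θ := by linarith
  have hθ0 : 0 < θ := by linarith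
  have hK : 2 < θ ^ 2 - 1 := by nlinarith
  have hone := one_mem_Ioo_solitonMax hp
  have hKM : (1 - θ ^ 2) * potential p 1 ≤ potential p M := by
    have h1 : |potential p M| / potential p 1 ≤ θ ^ 2 - 1 := by nlinarith
    rw [div_le_iff₀ hf1] at h1
    linarith [neg_abs_le (potential p M)]
  set z := rightRoot p (potential p 1 / (θ ^ 2 - 1)) with hz
  have hc : potential p 1 / (θ ^ 2 - 1) < potential p 1 := div_lt_self hf1 (by linarith)
  have hfz : potential p z = potential p 1 / (θ ^ 2 - 1) := potential_rightRoot hp hc.le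
  have hz1 : 1 < z := one_lt_rightRoot hp hc
  have hzm : z < solitonMax p := lt_solitonMax_of_potential_pos hp (by
    rw [hfz]
    exact div_pos hf1 (by linarith))
  have hlen1 : 0 < rightLen p θ 1 ∧ rightLen p θ 1 < τ := by
    obtain ⟨u, v, h, hu⟩ := exists_isRightArc hp hθ0 hone
    refine ⟨h.len, ?_⟩
    have hm := h.one_lt hp hθ0
    have hMm : M ≤ u (rightLen p θ 1) := by
      by_contra! hlt
      have h1 := strictAntiOn_potential hp hm.le hM1.le hlt
      rw [h.potential_right hp, hu] at h1
      linarith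
    have h1 : M ^ (p - 2) ≤ u (rightLen p θ 1) ^ (p - 2) :=
      Real.rpow_le_rpow (by linarith) hMm (by linarith)
    have h2 := mul_le_mul_of_nonneg_left h1 (show 0 ≤ 2 / p by positivity)
    have h3 : (Real.pi / 2 / τ) ^ 2 < 2 / p * u (rightLen p θ 1) ^ (p - 2) - 1 := by linarith
    have h5 : 0 < Real.pi / 2 / τ := by positivity
    have h4 : Real.pi / 2 / τ < √(2 / p * u (rightLen p θ 1) ^ (p - 2) - 1) :=
      Real.lt_sqrt_of_sq_lt h3
    refine (h.len_lt_of_eq_one hp hθ1 hu (h5.trans h4)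
      (Real.sq_sqrt ((sq_nonneg _).trans h3.le))).trans ?_
    rw [div_lt_iff₀ (h5.trans h4)]
    rw [div_lt_iff₀ hτ0] at h4
    linarith
  have hlen2 : τ ≤ rightLen p θ z := by
    obtain ⟨u, v, h, hu⟩ := exists_isRightArc hp hθ0 ⟨one_pos.trans hz1, hzm⟩
    refine h.le_len hp hθ1 ?_
    rw [hu, hfz, mul_div_cancel₀ _ (by linarith)]
  refine ⟨rightLen p θ 1, rightLen p θ z, hlen1.1, hlen1.2.trans_le hlen2, fun ℓ hℓ => ?_⟩
  obtain ⟨b, hb, h1⟩ := exists_le_rightLen hp hθ0 ℓ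
  obtain ⟨a, ha, -, h2⟩ := exists_rightLen_le hp hθ0 hzm (hlen1.1.trans_le hℓ.1)
  obtain ⟨u, v, h, hu⟩ := exists_isRightArc_of_mem hp hθ0 (s := Ioc 0 1)
    (fun x hx => ⟨hx.1, hx.2.trans_lt hone.2⟩) isPreconnected_Ioc ⟨one_pos, le_rfl⟩
    ⟨hb.1, hb.2.le⟩ ⟨hℓ.1, h1⟩
  obtain ⟨u', v', h', hu'⟩ := exists_isRightArc_of_mem hp hθ0 (s := Ico z (solitonMax p))
    (fun x hx => ⟨one_pos.trans (hz1.trans_le hx.1), hx.2⟩) isPreconnected_Ico ⟨ha.1.le, ha.2⟩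
    ⟨le_rfl, hzm⟩ ⟨h2, hℓ.2⟩
  exact ⟨u, u', ⟨h.isODESolution, h.strictMonoOn⟩, ⟨h'.isODESolution, h'.strictMonoOn⟩,
    hu.2.trans_lt (hz1.trans_le hu'.1)⟩

end Multiplicity

/-! ### Weak derivatives on intervals -/

section WeakDeriv

variable {I D : Set ℝ} {a b : ℝ} {u g w η V : ℝ → ℝ}

lemma exists_Icc_of_isCompact (hI : IsOpen I) (hc : I.OrdConnected) {K : Set ℝ}
    (hK : IsCompact K) (hKI : K ⊆ I) (hne : K.Nonempty) :
    ∃ c d, c < d ∧ K ⊆ Ioo c d ∧ Icc c d ⊆ I := by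
  have h1 := hKI (hK.sInf_mem hne)
  have h2 := hKI (hK.sSup_mem hne)
  obtain ⟨ε, hε, h3⟩ := Metric.isOpen_iff.1 hI _ h1
  obtain ⟨δ, hδ, h4⟩ := Metric.isOpen_iff.1 hI _ h2
  have h5 : sInf K - ε / 2 ∈ I := h3 (by
    rw [Metric.mem_ball, Real.dist_eq, sub_sub_cancel_left, abs_neg, abs_of_pos (half_pos hε)]
    exact half_lt_self hε)
  have h6 : sSup K + δ / 2 ∈ I := h4 (by
    rw [Metric.mem_ball, Real.dist_eq, add_sub_cancel_left, abs_of_pos (half_pos hδ)]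
    exact half_lt_self hδ)
  have h7 : ∀ x ∈ K, sInf K ≤ x ∧ x ≤ sSup K := fun x hx =>
    ⟨csInf_le hK.bddBelow hx, le_csSup hK.bddAbove hx⟩
  obtain ⟨y, hy⟩ := hne
  refine ⟨_, _, ?_, fun x hx => ⟨?_, ?_⟩, hc.out h5 h6⟩
  · linarith [(h7 y hy).1, (h7 y hy).2]
  · linarith [(h7 x hx).1]
  · linarith [(h7 x hx).2]

lemma setIntegral_eq_intervalIntegral {c d : ℝ} {h : ℝ → ℝ} (hsub : Icc c d ⊆ I)
    (h0 : ∀ x ∉ Ioo c d, h x = 0) : ∫ x in I, h x = ∫ x in c..d, h x := by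
  rw [setIntegral_eq_integral_of_forall_compl_eq_zero fun x hx =>
    h0 x fun hx' => hx (hsub (Ioo_subset_Icc_self hx')),
    intervalIntegral.integral_eq_integral_of_support_subset fun x hx => ?_]
  by_contra hn
  exact hx (h0 x fun hx' => hn (Ioo_subset_Ioc_self hx'))

/-- Integration by parts for two primitives of integrable functions. -/
lemma integral_parts_of_primitive {F G f g : ℝ → ℝ} (hab : a ≤ b)
    (hf : IntervalIntegrable f volume a b) (hg : IntervalIntegrable g volume a b)
    (hF : ∀ x ∈ Icc a b, F x = F a + ∫ t in a..x, f t)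
    (hG : ∀ x ∈ Icc a b, G x = G a + ∫ t in a..x, g t) :
    ∫ x in a..b, (f x * G x + F x * g x) = F b * G b - F a * G a := by
  have ac : ∀ {f : ℝ → ℝ} (c : ℝ), IntervalIntegrable f volume a b →
      AbsolutelyContinuousOnInterval (fun x => c + ∫ t in a..x, f t) a b := fun c hf =>
    (LipschitzOnWith.absolutelyContinuousOnInterval
      (LipschitzWith.const c).lipschitzOnWith).fun_add
        (hf.absolutelyContinuousOnInterval_intervalIntegral left_mem_uIcc)
  have h1 := (ac (F a) hf).integral_deriv_mul_eq_sub (ac (G a) hg)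
  rw [← hF b ⟨hab, le_rfl⟩, ← hF a ⟨le_rfl, hab⟩, ← hG b ⟨hab, le_rfl⟩,
    ← hG a ⟨le_rfl, hab⟩] at h1
  rw [← h1]
  refine intervalIntegral.integral_congr_ae ?_
  filter_upwards [hf.ae_hasDerivAt_integral, hg.ae_hasDerivAt_integral] with x h2 h3 h4
  have h5 := uIoc_subset_uIcc h4
  have h6 : x ∈ Icc a b := by rwa [uIcc_of_le hab] at h5
  rw [((h2 h5 a left_mem_uIcc).const_add (F a)).deriv,
    ((h3 h5 a left_mem_uIcc).const_add (G a)).deriv, hF x h6, hG x h6]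

lemma contDiff_eq_add_integral {χ : ℝ → ℝ} (hχ : ContDiff ℝ ∞ χ) (a x : ℝ) :
    χ x = χ a + ∫ t in a..x, deriv χ t := by
  rw [intervalIntegral.integral_deriv_eq_sub
    (fun y _ => (hχ.differentiable (by simp)).differentiableAt)
    ((hχ.continuous_deriv (by simp)).intervalIntegrable _ _)]
  ring

lemma MeasureTheory.LocallyIntegrableOn.intervalIntegrable (h : LocallyIntegrableOn g I)
    (hab : uIcc a b ⊆ I) : IntervalIntegrable g volume a b :=
  (h.integrableOn_compact_subset hab isCompact_uIcc).intervalIntegrable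

lemma eq_zero_of_notMem_tsupport {χ : ℝ → ℝ} {x : ℝ} (hx : x ∉ tsupport χ) :
    χ x = 0 ∧ deriv χ x = 0 := by
  refine ⟨image_eq_zero_of_notMem_tsupport hx, ?_⟩
  by_contra h
  exact hx (support_deriv_subset h)

theorem isWeakDerivOn_of_primitive (hI : IsOpen I) (hc : I.OrdConnected)
    (hg : LocallyIntegrableOn g I) (h : ∀ x ∈ I, ∀ y ∈ I, u y = u x + ∫ t in x..y, g t) :
    IsWeakDerivOn I u g := by
  intro χ h1 h2 h3
  rcases (tsupport χ).eq_empty_or_nonempty with h4 | h4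
  · have h5 : ∀ x, χ x = 0 ∧ deriv χ x = 0 := fun x => eq_zero_of_notMem_tsupport (by simp [h4])
    simp [fun x => (h5 x).1, fun x => (h5 x).2]
  obtain ⟨c, d, hcd, h5, h6⟩ := exists_Icc_of_isCompact hI hc h2 h3 h4
  have h7 : ∀ x ∉ Ioo c d, χ x = 0 ∧ deriv χ x = 0 := fun x hx =>
    eq_zero_of_notMem_tsupport fun hx' => hx (h5 hx')
  have hcI : c ∈ Icc c d := ⟨le_rfl, hcd.le⟩
  have hgi : IntervalIntegrable g volume c d :=
    hg.intervalIntegrable (by rwa [uIcc_of_le hcd.le])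
  have h8 := integral_parts_of_primitive hcd.le hgi
    ((h1.continuous_deriv (by simp)).intervalIntegrable c d)
    (fun x hx => h c (h6 hcI) x (h6 hx)) (fun x _ => contDiff_eq_add_integral h1 c x)
  have hu : ContinuousOn u (uIcc c d) := by
    refine ((continuousOn_const (c := u c)).add
      (intervalIntegral.continuousOn_primitive_interval' hgi left_mem_uIcc)).congr fun x hx => ?_
    rw [uIcc_of_le hcd.le] at hx
    exact h c (h6 hcI) x (h6 hx)
  rw [(h7 c (by simp)).1, (h7 d (by simp)).1, intervalIntegral.integral_add] at h8
  · rw [setIntegral_eq_intervalIntegral h6 fun x hx => by rw [(h7 x hx).2, mul_zero],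
      setIntegral_eq_intervalIntegral h6 fun x hx => by rw [(h7 x hx).1, mul_zero]]
    linarith
  · exact hgi.mul_continuousOn h1.continuous.continuousOn
  · exact (hu.mul (h1.continuous_deriv (by simp)).continuousOn).intervalIntegrable

lemma integrableOn_mul_test (hw : LocallyIntegrableOn w I) {χ : ℝ → ℝ} (h1 : Continuous χ)
    (h2 : HasCompactSupport χ) (h3 : tsupport χ ⊆ I) (hI : MeasurableSet I) :
    IntegrableOn (fun x => w x * χ x) I := by
  have h4 : IntegrableOn (fun x => w x * χ x) (tsupport χ) :=
    (hw.integrableOn_compact_subset h3 h2).mul_continuousOn h1.continuousOn h2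
  exact h4.of_forall_sdiff_eq_zero hI fun x hx => by
    rw [image_eq_zero_of_notMem_tsupport hx.2, mul_zero]

lemma exists_test_function (hI : IsOpen I) {x : ℝ} (hx : x ∈ I) :
    ∃ χ : ℝ → ℝ, ContDiff ℝ ∞ χ ∧ HasCompactSupport χ ∧ tsupport χ ⊆ I ∧ ∫ t, χ t = 1 := by
  obtain ⟨ε, hε, h⟩ := Metric.isOpen_iff.1 hI x hx
  let f : ContDiffBump x := ⟨ε / 4, ε / 2, by positivity, by linarith⟩
  refine ⟨f.normed volume, f.contDiff_normed, f.hasCompactSupport_normed, ?_, f.integral_normed⟩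
  rw [f.tsupport_normed_eq]
  exact (Metric.closedBall_subset_ball (half_lt_self hε)).trans h

/-- The primitive vanishes to the left of the support, and to the right of it because the mean is
zero; hence it is again a test function. -/
lemma exists_primitive_test {κ : ℝ → ℝ} (hI : IsOpen I) (hc : I.OrdConnected)
    (h1 : ContDiff ℝ ∞ κ) (h2 : HasCompactSupport κ) (h3 : tsupport κ ⊆ I)
    (h0 : ∫ t, κ t = 0) :
    ∃ ψ : ℝ → ℝ, ContDiff ℝ ∞ ψ ∧ HasCompactSupport ψ ∧ tsupport ψ ⊆ I ∧ deriv ψ = κ := by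
  rcases (tsupport κ).eq_empty_or_nonempty with h4 | h4
  · have h5 : κ = 0 := tsupport_eq_empty_iff.1 h4
    subst h5
    exact ⟨0, contDiff_const, HasCompactSupport.zero, by simp [tsupport], by simp⟩
  obtain ⟨c, d, hcd, h5, h6⟩ := exists_Icc_of_isCompact hI hc h2 h3 h4
  have hd : ∀ x, HasDerivAt (fun x => ∫ t in c..x, κ t) (κ x) x := fun x =>
    intervalIntegral.integral_hasDerivAt_right (h1.continuous.intervalIntegrable _ _)
      (h1.continuous.stronglyMeasurableAtFilter _ _) h1.continuous.continuousAt
  have hz : ∀ x ∉ Icc c d, ∫ t in c..x, κ t = 0 := fun x hx => by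
    rcases lt_or_ge x c with h7 | h7
    · rw [intervalIntegral.integral_congr (g := fun _ => 0)]
      · simp
      · intro y hy
        rw [uIcc_of_ge h7.le] at hy
        exact image_eq_zero_of_notMem_tsupport fun h => absurd (h5 h).1 (not_lt.2 hy.2)
    · have h8 : d < x := by
        by_contra! h9
        exact hx ⟨h7, h9⟩
      rw [intervalIntegral.integral_eq_integral_of_support_subset, h0]
      intro y hy
      have := h5 (subset_tsupport κ hy)
      exact ⟨this.1, (this.2.trans h8).le⟩
  have hs : tsupport (fun x => ∫ t in c..x, κ t) ⊆ Icc c d :=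
    closure_minimal (fun x hx => by
      by_contra h
      exact hx (hz x h)) isClosed_Icc
  have hderiv : deriv (fun x => ∫ t in c..x, κ t) = κ := funext fun x => (hd x).deriv
  refine ⟨_, contDiff_infty_iff_deriv.2 ⟨fun x => (hd x).differentiableAt, ?_⟩,
    isCompact_Icc.of_isClosed_subset (isClosed_tsupport _) hs, hs.trans h6, hderiv⟩
  rwa [hderiv]

/-- The lemma of du Bois-Reymond. -/
theorem exists_ae_eq_const_of_weakDeriv_zero (hI : IsOpen I) (hc : I.OrdConnected)
    (hw : LocallyIntegrableOn w I) (h : IsWeakDerivOn I w fun _ => 0) :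
    ∃ C, ∀ᵐ x, x ∈ I → w x = C := by
  rcases I.eq_empty_or_nonempty with rfl | ⟨x₀, hx₀⟩
  · exact ⟨0, by simp⟩
  obtain ⟨χ₀, a1, a2, a3, a4⟩ := exists_test_function hI hx₀
  refine ⟨∫ x in I, w x * χ₀ x, ?_⟩
  set C := ∫ x in I, w x * χ₀ x with hC
  have key : ∀ᵐ x, x ∈ I → w x - C = 0 := by
    refine hI.ae_eq_zero_of_integral_contDiff_smul_eq_zero
      (hw.sub (locallyIntegrableOn_const C)) fun χ b1 b2 b3 => ?_
    -- Subtracting `m χ₀` from `χ` makes the mean zero; the hypothesis is then tested with the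
    -- primitive of the difference.
    set m := ∫ t, χ t with hm
    have hts : tsupport (fun x => χ x - m * χ₀ x) ⊆ tsupport χ ∪ tsupport χ₀ := by
      refine closure_minimal (fun x hx => ?_) ((isClosed_tsupport χ).union (isClosed_tsupport χ₀))
      by_contra hn
      rw [mem_union, not_or] at hn
      refine hx ?_
      simp [image_eq_zero_of_notMem_tsupport hn.1, image_eq_zero_of_notMem_tsupport hn.2]
    have hi : Integrable χ := b1.continuous.integrable_of_hasCompactSupport b2
    have hi₀ : Integrable χ₀ := a1.continuous.integrable_of_hasCompactSupport a2
    obtain ⟨ψ, c1, c2, c3, c4⟩ := exists_primitive_test (κ := fun x => χ x - m * χ₀ x) hI hc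
      (b1.sub (contDiff_const.mul a1))
      ((b2.isCompact.union a2.isCompact).of_isClosed_subset (isClosed_tsupport _) hts)
      (hts.trans (union_subset b3 a3))
      (by rw [integral_sub hi (hi₀.const_mul m), integral_const_mul, a4, mul_one, sub_self])
    have h1 := h ψ c1 c2 c3
    have e1 : ∀ x, w x * (χ x - m * χ₀ x) = w x * χ x - m * (w x * χ₀ x) := fun x => by ring
    simp only [c4, zero_mul, integral_zero, neg_zero, e1] at h1
    have h2 := integrableOn_mul_test hw b1.continuous b2 b3 hI.measurableSet
    have h3 := integrableOn_mul_test hw a1.continuous a2 a3 hI.measurableSet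
    rw [integral_sub h2 (h3.const_mul m), integral_const_mul, ← hC] at h1
    have e2 : ∫ x, χ x • (w x - C) = ∫ x in I, (w x * χ x - C * χ x) := by
      rw [setIntegral_eq_integral_of_forall_compl_eq_zero fun x hx => ?_]
      · refine integral_congr_ae (ae_of_all _ fun x => ?_)
        simp only [smul_eq_mul]
        ring
      · simp [image_eq_zero_of_notMem_tsupport fun hx' => hx (b3 hx')]
    have e3 : ∫ x in I, χ x = m :=
      setIntegral_eq_integral_of_forall_compl_eq_zero fun x hx =>
        image_eq_zero_of_notMem_tsupport fun hx' => hx (b3 hx')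
    rw [e2, integral_sub h2 (hi.integrableOn.const_mul C), integral_const_mul, e3]
    linarith
  filter_upwards [key] with x hx hxI
  linarith [hx hxI]

lemma continuousOn_primitive_of_locallyIntegrableOn (hI : IsOpen I) (hc : I.OrdConnected)
    (hg : LocallyIntegrableOn g I) {x₀ : ℝ} (hx₀ : x₀ ∈ I) :
    ContinuousOn (fun x => ∫ t in x₀..x, g t) I := fun x hx => by
  obtain ⟨c, d, hcd, h1, h2⟩ := exists_Icc_of_isCompact hI hc
    (K := {x₀, x}) (toFinite _).isCompact (by
      rintro y (rfl | rfl)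
      exacts [hx₀, hx]) ⟨x, by simp⟩
  have h3 := h1 (show x₀ ∈ ({x₀, x} : Set ℝ) by simp)
  have h4 := h1 (show x ∈ ({x₀, x} : Set ℝ) by simp)
  have h5 := intervalIntegral.continuousOn_primitive_interval' (a := x₀)
    (hg.intervalIntegrable (a := c) (b := d) (by rwa [uIcc_of_le hcd.le]))
    (by rw [uIcc_of_le hcd.le]; exact Ioo_subset_Icc_self h3)
  rw [uIcc_of_le hcd.le] at h5
  exact (h5.continuousAt (Icc_mem_nhds h4.1 h4.2)).continuousWithinAt

/-- `w` minus the primitive of `g` has weak derivative zero. -/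
theorem ae_eq_primitive_of_weakDeriv (hI : IsOpen I) (hc : I.OrdConnected)
    (hw : LocallyIntegrableOn w I) (hg : LocallyIntegrableOn g I) (h : IsWeakDerivOn I w g)
    {x₀ : ℝ} (hx₀ : x₀ ∈ I) : ∃ C, ∀ᵐ x, x ∈ I → w x = C + ∫ t in x₀..x, g t := by
  have hG := continuousOn_primitive_of_locallyIntegrableOn hI hc hg hx₀
  have hGl := hG.locallyIntegrableOn (μ := volume) hI.measurableSet
  have h1 : IsWeakDerivOn I (fun x => ∫ t in x₀..x, g t) g :=
    isWeakDerivOn_of_primitive hI hc hg fun x hx y hy => by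
      rw [intervalIntegral.integral_add_adjacent_intervals]
      · exact hg.intervalIntegrable (hc.uIcc_subset hx₀ hx)
      · exact hg.intervalIntegrable (hc.uIcc_subset hx hy)
  obtain ⟨C, hC⟩ := exists_ae_eq_const_of_weakDeriv_zero hI hc (hw.sub hGl) (by
    intro χ c1 c2 c3
    have e : ∀ x, (w x - ∫ t in x₀..x, g t) * deriv χ x =
        w x * deriv χ x - (∫ t in x₀..x, g t) * deriv χ x := fun x => by ring
    have hts : tsupport (deriv χ) ⊆ tsupport χ :=
      closure_minimal support_deriv_subset (isClosed_tsupport χ)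
    have c5 := c1.continuous_deriv (by simp)
    simp only [Pi.sub_apply, e]
    rw [integral_sub (integrableOn_mul_test hw c5 c2.deriv (hts.trans c3) hI.measurableSet)
      (integrableOn_mul_test hGl c5 c2.deriv (hts.trans c3) hI.measurableSet),
      h χ c1 c2 c3, h1 χ c1 c2 c3]
    simp)
  refine ⟨C, ?_⟩
  filter_upwards [hC] with x hx hxI
  have := hx hxI
  simp only [Pi.sub_apply] at this
  linarith

lemma eq_add_integral_of_weakDeriv (hI : IsOpen I) (hc : I.OrdConnected)
    (hu : ContinuousOn u I) (hg : LocallyIntegrableOn g I) (h : IsWeakDerivOn I u g)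
    {x y : ℝ} (hx : x ∈ I) (hy : y ∈ I) : u y = u x + ∫ t in x..y, g t := by
  obtain ⟨C, hC⟩ := ae_eq_primitive_of_weakDeriv hI hc
    (hu.locallyIntegrableOn hI.measurableSet) hg h hx
  have h1 : EqOn u (fun y => C + ∫ t in x..y, g t) I :=
    Measure.eqOn_open_of_ae_eq ((ae_restrict_iff' hI.measurableSet).2 hC) hI hu
      (continuousOn_const.add (continuousOn_primitive_of_locallyIntegrableOn hI hc hg hx))
  have h2 := h1 hx
  simp only [intervalIntegral.integral_same, add_zero] at h2
  rw [h1 hy, h2]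

/-- Regularity: a continuous function with a weak derivative which has a continuous weak
derivative is of class `C²`. -/
theorem exists_classical_of_weakDeriv (hI : IsOpen I) (hc : I.OrdConnected) (hne : I.Nonempty)
    (hID : I ⊆ D) (hDI : D ⊆ closure I) (hu : ContinuousOn u D) (hw : LocallyIntegrableOn w I)
    (hg : Continuous g) (h1 : IsWeakDerivOn I u w) (h2 : IsWeakDerivOn I w g) :
    ∃ v : ℝ → ℝ, (∀ x ∈ D, HasDerivWithinAt u (v x) D x) ∧ (∀ x, HasDerivAt v (g x) x) ∧
      ∀ᵐ x, x ∈ I → w x = v x := by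
  obtain ⟨x₀, hx₀⟩ := hne
  obtain ⟨C, hC⟩ := ae_eq_primitive_of_weakDeriv hI hc hw
    (hg.locallyIntegrable.locallyIntegrableOn I) h2 hx₀
  set v : ℝ → ℝ := fun x => C + ∫ t in x₀..x, g t with hv
  have hvd : ∀ x, HasDerivAt v (g x) x := fun x =>
    (intervalIntegral.integral_hasDerivAt_right (hg.intervalIntegrable _ _)
      (hg.stronglyMeasurableAtFilter _ _) hg.continuousAt).const_add C
  have hvc : Continuous v := continuous_iff_continuousAt.2 fun x => (hvd x).continuousAt
  have hVd : ∀ x, HasDerivAt (fun x => u x₀ + ∫ t in x₀..x, v t) (v x) x := fun x =>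
    (intervalIntegral.integral_hasDerivAt_right (hvc.intervalIntegrable _ _)
      (hvc.stronglyMeasurableAtFilter _ _) hvc.continuousAt).const_add (u x₀)
  have h3 : EqOn u (fun x => u x₀ + ∫ t in x₀..x, v t) I := fun x hx => by
    rw [eq_add_integral_of_weakDeriv hI hc (hu.mono hID) hw h1 hx₀ hx]
    congr 1
    refine intervalIntegral.integral_congr_ae ?_
    filter_upwards [hC] with t ht ht'
    exact ht (hc.uIcc_subset hx₀ hx (uIoc_subset_uIcc ht'))
  have h4 : EqOn u (fun x => u x₀ + ∫ t in x₀..x, v t) D :=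
    h3.of_subset_closure hu (fun x _ => (hVd x).continuousAt.continuousWithinAt) hID hDI
  exact ⟨v, fun x hx => (hVd x).hasDerivWithinAt.congr h4 (h4 hx), hvd, hC⟩

lemma eq_add_integral_of_weakDeriv_Icc (hab : a < b) (hu : ContinuousOn u (Icc a b))
    (hg : IntegrableOn g (Ioo a b)) (h : IsWeakDerivOn (Ioo a b) u g) :
    ∀ x ∈ Icc a b, u x = u a + ∫ t in a..x, g t := by
  have hgi : IntervalIntegrable g volume a b :=
    (intervalIntegrable_iff_integrableOn_Ioo_of_le hab.le).2 hg
  have hG : ContinuousOn (fun x => ∫ t in a..x, g t) (Icc a b) := by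
    have := intervalIntegral.continuousOn_primitive_interval' hgi left_mem_uIcc
    rwa [uIcc_of_le hab.le] at this
  have hx₀ : (a + b) / 2 ∈ Ioo a b := ⟨by linarith, by linarith⟩
  have hsub : ∀ x ∈ Icc a b, ∀ y ∈ Icc a b, IntervalIntegrable g volume x y := fun x hx y hy =>
    hgi.mono_set (by
      rw [uIcc_of_le hab.le]
      exact ordConnected_Icc.uIcc_subset hx hy)
  have h1 : EqOn u (fun x => u ((a + b) / 2) - (∫ t in a..((a + b) / 2), g t) +
      ∫ t in a..x, g t) (Ioo a b) := fun x hx => by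
    rw [eq_add_integral_of_weakDeriv isOpen_Ioo ordConnected_Ioo (hu.mono Ioo_subset_Icc_self)
      hg.locallyIntegrableOn h hx₀ hx]
    have := intervalIntegral.integral_add_adjacent_intervals
      (hsub a (left_mem_Icc.2 hab.le) _ (Ioo_subset_Icc_self hx₀))
      (hsub _ (Ioo_subset_Icc_self hx₀) x (Ioo_subset_Icc_self hx))
    simp only
    rw [← this]
    ring
  have h2 := h1.of_subset_closure hu (continuousOn_const.add hG) Ioo_subset_Icc_self
    (closure_Ioo hab.ne).ge
  intro x hx
  have h3 := h2 (left_mem_Icc.2 hab.le)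
  simp only [intervalIntegral.integral_same, add_zero] at h3
  rw [h2 hx, h3]

lemma eq_add_integral_of_hasDerivWithinAt {V V' : ℝ → ℝ} (hab : a ≤ b)
    (hV : ∀ x ∈ Icc a b, HasDerivWithinAt V (V' x) (Icc a b) x)
    (hV' : ContinuousOn V' (Icc a b)) : V b = V a + ∫ t in a..b, V' t := by
  rw [intervalIntegral.integral_eq_sub_of_hasDerivAt_of_le hab
    (fun x hx => (hV x hx).continuousWithinAt)
    (fun x hx => (hV x (Ioo_subset_Icc_self hx)).hasDerivAt_of_Icc hx)
    (hV'.intervalIntegrable_of_Icc hab)]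
  ring

theorem integral_parts_Ioo {V V' : ℝ → ℝ} (hab : a < b) (hη : ContinuousOn η (Icc a b))
    (hg : IntegrableOn g (Ioo a b)) (h : IsWeakDerivOn (Ioo a b) η g)
    (hV : ∀ x ∈ Icc a b, HasDerivWithinAt V (V' x) (Icc a b) x)
    (hV' : ContinuousOn V' (Icc a b)) :
    ∫ x in Ioo a b, (V x * g x + V' x * η x) = V b * η b - V a * η a := by
  have h1 := integral_parts_of_primitive hab.le (hV'.intervalIntegrable_of_Icc hab.le)
    ((intervalIntegrable_iff_integrableOn_Ioo_of_le hab.le).2 hg)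
    (fun x hx => eq_add_integral_of_hasDerivWithinAt hx.1
      (fun y hy => (hV y ⟨hy.1, hy.2.trans hx.2⟩).mono (Icc_subset_Icc_right hx.2))
      (hV'.mono (Icc_subset_Icc_right hx.2)))
    (eq_add_integral_of_weakDeriv_Icc hab hη hg h)
  rw [← h1, intervalIntegral.integral_of_le hab.le, integral_Ioc_eq_integral_Ioo]
  refine integral_congr_ae (ae_of_all _ fun x => ?_)
  simp only
  ring

lemma IsWeakDerivOn.mono {J : Set ℝ} (h : IsWeakDerivOn I u g) (hJ : J ⊆ I) :
    IsWeakDerivOn J u g := fun χ h1 h2 h3 => by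
  have h4 : ∀ x ∉ J, χ x = 0 ∧ deriv χ x = 0 := fun x hx =>
    eq_zero_of_notMem_tsupport fun hx' => hx (h3 hx')
  have h5 := h χ h1 h2 (h3.trans hJ)
  rw [setIntegral_eq_integral_of_forall_compl_eq_zero fun x hx => by
      rw [(h4 x fun h => hx (hJ h)).2, mul_zero],
    setIntegral_eq_integral_of_forall_compl_eq_zero fun x hx => by
      rw [(h4 x fun h => hx (hJ h)).1, mul_zero]] at h5
  rwa [setIntegral_eq_integral_of_forall_compl_eq_zero fun x hx => by rw [(h4 x hx).2, mul_zero],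
    setIntegral_eq_integral_of_forall_compl_eq_zero fun x hx => by rw [(h4 x hx).1, mul_zero]]

/-- The integrals over `(0, b)` converge, so the boundary term `V b η b` has a limit; being a
product of two square-integrable functions, it is integrable, and its limit must be `0`. -/
theorem integral_parts_Ioi {V V' : ℝ → ℝ} (hη : ContinuousOn η (Ici 0))
    (hη2 : MemLp η 2 (volume.restrict (Ioi 0))) (hg : MemLp g 2 (volume.restrict (Ioi 0)))
    (h : IsWeakDerivOn (Ioi 0) η g) (hV : ∀ x, HasDerivAt V (V' x) x) (hV' : Continuous V')
    (hV2 : MemLp V 2 (volume.restrict (Ioi 0)))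
    (hV'2 : MemLp V' 2 (volume.restrict (Ioi 0))) :
    ∫ x in Ioi 0, (V x * g x + V' x * η x) = -(V 0 * η 0) := by
  have hi : IntegrableOn (fun x => V x * g x + V' x * η x) (Ioi 0) :=
    (hV2.integrable_mul hg).add (hV'2.integrable_mul hη2)
  have h1 := intervalIntegral_tendsto_integral_Ioi 0 hi tendsto_id
  have hp : ∀ b > 0, ∫ x in (0 : ℝ)..b, (V x * g x + V' x * η x) = V b * η b - V 0 * η 0 :=
    fun b hb => by
      rw [intervalIntegral.integral_of_le hb.le, integral_Ioc_eq_integral_Ioo]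
      refine integral_parts_Ioo hb (hη.mono Icc_subset_Ici_self) ?_ (h.mono Ioo_subset_Ioi_self)
        (fun x _ => (hV x).hasDerivWithinAt) hV'.continuousOn
      have : MemLp g 2 (volume.restrict (Ioo 0 b)) :=
        hg.mono_measure (Measure.restrict_mono Ioo_subset_Ioi_self le_rfl)
      exact this.integrable one_le_two
  have h2 : Tendsto (fun b => V b * η b) atTop
      (𝓝 ((∫ x in Ioi 0, (V x * g x + V' x * η x)) + V 0 * η 0)) := by
    refine (h1.add_const (V 0 * η 0)).congr' ?_
    filter_upwards [eventually_gt_atTop 0] with b hb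
    simp only [id]
    rw [hp b hb]
    ring
  have h3 : IntegrableOn (fun b => V b * η b) (Ioi 0) := hV2.integrable_mul hη2
  have h4 := IntegrableAtFilter.eq_zero_of_tendsto (l := atTop) ⟨Ioi 0, Ioi_mem_atTop 0, h3⟩
    (fun s hs => by
      obtain ⟨c, hc⟩ := mem_atTop_sets.1 hs
      exact measure_mono_top (fun x hx => hc x hx) (Real.volume_Ici (a := c))) h2
  linarith

lemma isWeakDerivOn_of_hasDerivWithinAt {V' : ℝ → ℝ} (hI : IsOpen I) (hc : I.OrdConnected)
    (hV : ∀ x ∈ I, HasDerivAt V (V' x) x) (hV' : ContinuousOn V' I) : IsWeakDerivOn I V V' := by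
  refine isWeakDerivOn_of_primitive hI hc (hV'.locallyIntegrableOn hI.measurableSet)
    fun x hx y hy => ?_
  rw [intervalIntegral.integral_eq_sub_of_hasDerivAt (fun t ht => hV t (hc.uIcc_subset hx hy ht))
    (hV'.mono (hc.uIcc_subset hx hy)).intervalIntegrable]
  ring

end WeakDeriv

/-! ### Square-integrability -/

section MemLp

variable {p a b : ℝ} {f : ℝ → ℝ}

lemma memLp_Ioo_of_continuousOn (hf : ContinuousOn f (Icc a b)) :
    MemLp f 2 (volume.restrict (Ioo a b)) := by
  obtain ⟨C, hC⟩ := isCompact_Icc.exists_bound_of_continuousOn hf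
  exact MemLp.of_bound ((hf.mono Ioo_subset_Icc_self).aestronglyMeasurable measurableSet_Ioo) C
    ((ae_restrict_iff' measurableSet_Ioo).2 (ae_of_all _ fun x hx => hC x (Ioo_subset_Icc_self hx)))

lemma memLp_exp_neg : MemLp (fun x : ℝ => Real.exp (-x)) 2 (volume.restrict (Ioi 0)) := by
  rw [memLp_two_iff_integrable_sq (by fun_prop)]
  refine (exp_neg_integrableOn_Ioi 0 (b := 2) two_pos).congr (ae_of_all _ fun x => ?_)
  simp only
  rw [← Real.exp_nat_mul]
  congr 1
  push_cast
  ring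

lemma memLp_soliton (hp : 2 < p) (y : ℝ) :
    MemLp (fun x => soliton p (x + y)) 2 (volume.restrict (Ioi 0)) := by
  refine memLp_exp_neg.of_le_mul (c := solitonMax p * 2 ^ (2 / (p - 2)) * Real.exp (-y))
    ((continuous_soliton hp).comp (by fun_prop)).aestronglyMeasurable (ae_of_all _ fun x => ?_)
  rw [Real.norm_of_nonneg (soliton_pos hp _).le, Real.norm_of_nonneg (Real.exp_pos _).le]
  refine (soliton_le_mul_exp hp _).trans_eq ?_
  rw [mul_assoc _ (Real.exp (-y)), ← Real.exp_add]
  congr 2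
  ring

lemma memLp_solitonVel (hp : 2 < p) (y : ℝ) :
    MemLp (fun x => solitonVel p (x + y)) 2 (volume.restrict (Ioi 0)) := by
  refine (memLp_soliton hp y).of_le
    ((continuous_solitonVel hp).comp (by fun_prop)).aestronglyMeasurable (ae_of_all _ fun x => ?_)
  rw [Real.norm_of_nonneg (soliton_pos hp _).le]
  exact abs_solitonVel_le hp _

lemma continuous_soliton_force (hp : 2 < p) (y : ℝ) :
    Continuous fun x => soliton p (x + y) - soliton p (x + y) ^ (p - 1) := by
  have h : Continuous fun x => soliton p (x + y) := (continuous_soliton hp).comp (by fun_prop)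
  exact h.sub (h.rpow_const fun x => Or.inl (soliton_pos hp _).ne')

lemma memLp_soliton_force (hp : 2 < p) (y : ℝ) :
    MemLp (fun x => soliton p (x + y) - soliton p (x + y) ^ (p - 1)) 2
      (volume.restrict (Ioi 0)) := by
  refine (memLp_soliton hp y).of_le_mul (c := 1 + p / 2)
    (continuous_soliton_force hp y).aestronglyMeasurable (ae_of_all _ fun x => ?_)
  have h0 := soliton_pos hp (x + y)
  have h1 : soliton p (x + y) ^ (p - 2) ≤ p / 2 := by
    rw [← solitonMax_rpow hp]
    exact Real.rpow_le_rpow h0.le (soliton_le_solitonMax hp _) (by linarith)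
  have h2 : 0 < soliton p (x + y) ^ (p - 2) := Real.rpow_pos_of_pos h0 _
  rw [Real.norm_of_nonneg h0.le, rpow_sub_one_eq h0, Real.norm_eq_abs, abs_le]
  constructor <;> nlinarith

end MemLp

/-! ### Edges -/

section EdgeIntegral

variable {p b y : ℝ} {u v w η g : ℝ → ℝ}

lemma IsTraj.continuousOn_force (h : IsTraj p b u v) :
    ContinuousOn (fun x => u x - u x ^ (p - 1)) (Icc 0 b) :=
  h.continuousOn_fst.sub (h.continuousOn_fst.rpow_const fun x hx => Or.inl (h.pos x hx).ne')

lemma abs_rpow_mul_self {x : ℝ} (hx : 0 < x) : |x| ^ (p - 2) * x = x ^ (p - 1) := by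
  rw [abs_of_pos hx, rpow_sub_one_eq hx]

lemma IsTraj.integral_edge (hb : 0 < b) (h : IsTraj p b u v)
    (hw : ∀ᵐ x, x ∈ Ioo 0 b → w x = v x) (hη : ContinuousOn η (Icc 0 b))
    (hg : MemLp g 2 (volume.restrict (Ioo 0 b))) (hηg : IsWeakDerivOn (Ioo 0 b) η g) :
    ∫ x in Ioo 0 b, (w x * g x + u x * η x - |u x| ^ (p - 2) * u x * η x) =
      v b * η b - v 0 * η 0 := by
  rw [← integral_parts_Ioo hb hη (hg.integrable one_le_two) hηg h.hv h.continuousOn_force]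
  refine setIntegral_congr_ae measurableSet_Ioo ?_
  filter_upwards [hw] with x hx hxI
  rw [hx hxI, abs_rpow_mul_self (h.pos x (Ioo_subset_Icc_self hxI))]
  ring

lemma integral_halfLine (hp : 2 < p)
    (h : ∀ x ∈ Ici (0 : ℝ), u x = soliton p (x + y) ∧ v x = solitonVel p (x + y))
    (hw : ∀ᵐ x, x ∈ Ioi (0 : ℝ) → w x = v x) (hη : ContinuousOn η (Ici 0))
    (hη2 : MemLp η 2 (volume.restrict (Ioi 0))) (hg : MemLp g 2 (volume.restrict (Ioi 0)))
    (hηg : IsWeakDerivOn (Ioi 0) η g) :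
    ∫ x in Ioi 0, (w x * g x + u x * η x - |u x| ^ (p - 2) * u x * η x) = -(v 0 * η 0) := by
  have h1 := integral_parts_Ioi hη hη2 hg hηg
    (fun x => (hasDerivAt_solitonVel hp _).comp_add_const x y) (continuous_soliton_force hp y)
    (memLp_solitonVel hp y) (memLp_soliton_force hp y)
  rw [(h 0 self_mem_Ici).2, ← h1]
  refine setIntegral_congr_ae measurableSet_Ioi ?_
  filter_upwards [hw] with x hx hxI
  rw [hx hxI, (h x (Ioi_subset_Ici_self hxI)).1, (h x (Ioi_subset_Ici_self hxI)).2,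
    abs_rpow_mul_self (soliton_pos hp _)]
  ring

end EdgeIntegral

namespace RegularSingleKnot

variable {G : RegularSingleKnot} {p : ℝ} {u v du η dη : G.Fun} {y : Fin G.H → ℝ}

lemma isOpen_openDom (e : G.Edge) : IsOpen (G.openDom e) := by
  rcases e with h | i | j
  exacts [isOpen_Ioi, isOpen_Ioo, isOpen_Ioo]

lemma ordConnected_openDom (e : G.Edge) : (G.openDom e).OrdConnected := by
  rcases e with h | i | j
  exacts [ordConnected_Ioi, ordConnected_Ioo, ordConnected_Ioo]

lemma two_mul_ℓ_pos (G : RegularSingleKnot) : 0 < 2 * G.ℓ := mul_pos two_pos G.ℓ_pos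

lemma nonempty_openDom (e : G.Edge) : (G.openDom e).Nonempty := by
  rcases e with h | i | j
  exacts [nonempty_Ioi, nonempty_Ioo.2 G.ℓ_pos, nonempty_Ioo.2 G.two_mul_ℓ_pos]

lemma openDom_subset_dom (e : G.Edge) : G.openDom e ⊆ G.dom e := by
  rcases e with h | i | j
  exacts [Ioi_subset_Ici_self, Ioo_subset_Icc_self, Ioo_subset_Icc_self]

lemma dom_subset_closure (e : G.Edge) : G.dom e ⊆ closure (G.openDom e) := by
  rcases e with h | i | j
  exacts [(closure_Ioi 0).ge, (closure_Ioo G.ℓ_pos.ne).ge, (closure_Ioo G.two_mul_ℓ_pos.ne).ge]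

lemma exists_retraction (e : G.Edge) :
    ∃ r : ℝ → ℝ, Continuous r ∧ (∀ x, r x ∈ G.dom e) ∧ ∀ x ∈ G.dom e, r x = x := by
  rcases e with h | i | j
  · exact ⟨fun x => max 0 x, by fun_prop, fun x => le_max_left 0 x, fun x hx => max_eq_right hx⟩
  · exact ⟨fun x => max 0 (min G.ℓ x), by fun_prop,
      fun x => ⟨le_max_left _ _, max_le G.ℓ_pos.le (min_le_left _ _)⟩,
      fun x hx => (congrArg (max 0) (min_eq_right hx.2)).trans (max_eq_right hx.1)⟩
  · exact ⟨fun x => max 0 (min (2 * G.ℓ) x), by fun_prop,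
      fun x => ⟨le_max_left _ _, max_le G.two_mul_ℓ_pos.le (min_le_left _ _)⟩,
      fun x hx => (congrArg (max 0) (min_eq_right hx.2)).trans (max_eq_right hx.1)⟩

/-- Edge by edge, `u` is a classical positive solution with derivative `v`; on the half-line `h`
it is the soliton translated by `y h`. -/
structure IsClassical (G : RegularSingleKnot) (p : ℝ) (u v : G.Fun) (y : Fin G.H → ℝ) : Prop where
  pendant : ∀ i, IsTraj p G.ℓ (u (G.pendant i)) (v (G.pendant i))
  loop : ∀ j, IsTraj p (2 * G.ℓ) (u (G.loop j)) (v (G.loop j))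
  half : ∀ h, ∀ x ∈ Ici (0 : ℝ), u (G.halfLine h) x = soliton p (x + y h) ∧
    v (G.halfLine h) x = solitonVel p (x + y h)

/-- The balance of the derivatives at the vertices. -/
structure IsBalanced (G : RegularSingleKnot) (v : G.Fun) : Prop where
  pendant : ∀ i, v (G.pendant i) G.ℓ = 0
  knot : ∑ h, v (G.halfLine h) 0 + ∑ i, v (G.pendant i) 0 +
    ∑ j, (v (G.loop j) 0 - v (G.loop j) (2 * G.ℓ)) = 0

/-- Integration by parts on every edge cancels the bulk because of the equation and leaves boundary
terms. This serves both to verify the weak form and to extract the conditions at the vertices from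
it. -/
lemma IsClassical.sum_integral (hp : 2 < p) (hu : G.IsClassical p u v y)
    (hdu : ∀ e, ∀ᵐ x, x ∈ G.openDom e → du e x = v e x) (hη : G.MemH1 η)
    (hdη : G.IsWeakGradient η dη) :
    ∑ e, ∫ x in G.openDom e,
      (du e x * dη e x + u e x * η e x - |u e x| ^ (p - 2) * u e x * η e x) =
    ∑ i, v (G.pendant i) G.ℓ * η (G.pendant i) G.ℓ - (∑ h, v (G.halfLine h) 0 * η (G.halfLine h) 0 +
      ∑ i, v (G.pendant i) 0 * η (G.pendant i) 0 +
      ∑ j, (v (G.loop j) 0 * η (G.loop j) 0 -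
        v (G.loop j) (2 * G.ℓ) * η (G.loop j) (2 * G.ℓ))) := by
  rw [Fintype.sum_sum_type, Fintype.sum_sum_type]
  have h1 : ∀ h : Fin G.H, _ := fun h => integral_halfLine hp (hu.half h) (hdu (G.halfLine h))
    (hη.1.1 (G.halfLine h)) (hη.2.1 (G.halfLine h)) (hdη (G.halfLine h)).1 (hdη (G.halfLine h)).2
  have h2 : ∀ i : Fin G.P, _ := fun i => (hu.pendant i).integral_edge G.ℓ_pos (hdu (G.pendant i))
    (hη.1.1 (G.pendant i)) (hdη (G.pendant i)).1 (hdη (G.pendant i)).2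
  have h3 : ∀ j : Fin G.L, _ := fun j => (hu.loop j).integral_edge G.two_mul_ℓ_pos
    (hdu (G.loop j)) (hη.1.1 (G.loop j)) (hdη (G.loop j)).1 (hdη (G.loop j)).2
  refine (congrArg₂ (· + ·) (Finset.sum_congr rfl fun h _ => h1 h)
    (congrArg₂ (· + ·) (Finset.sum_congr rfl fun i _ => h2 i)
      (Finset.sum_congr rfl fun j _ => h3 j))).trans ?_
  simp only [Finset.sum_sub_distrib, Finset.sum_neg_distrib]
  ring

lemma IsClassical.isPositive (hp : 2 < p) (hu : G.IsClassical p u v y) : G.IsPositive u := by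
  rintro (h | i | j) x hx
  · rw [(hu.half h x hx).1]
    exact soliton_pos hp _
  · exact (hu.pendant i).pos x hx
  · exact (hu.loop j).pos x hx

lemma IsClassical.continuousOn (hp : 2 < p) (hu : G.IsClassical p u v y) (e : G.Edge) :
    ContinuousOn (u e) (G.dom e) := by
  rcases e with h | i | j
  · have : Continuous fun x => soliton p (x + y h) := (continuous_soliton hp).comp (by fun_prop)
    exact this.continuousOn.congr fun x hx => (hu.half h x hx).1
  · exact (hu.pendant i).continuousOn_fst
  · exact (hu.loop j).continuousOn_fst

lemma IsClassical.memLp (hp : 2 < p) (hu : G.IsClassical p u v y) (e : G.Edge) :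
    MemLp (u e) 2 (volume.restrict (G.openDom e)) := by
  rcases e with h | i | j
  · refine (memLp_congr_ae ((ae_restrict_iff' measurableSet_Ioi).2 (ae_of_all _ fun x hx => ?_))).2
      (memLp_soliton hp (y h))
    exact (hu.half h x (Ioi_subset_Ici_self hx)).1
  · exact memLp_Ioo_of_continuousOn (hu.pendant i).continuousOn_fst
  · exact memLp_Ioo_of_continuousOn (hu.loop j).continuousOn_fst

lemma IsTraj.isWeakDerivOn {b : ℝ} {u v : ℝ → ℝ} (h : IsTraj p b u v) :
    IsWeakDerivOn (Ioo 0 b) u v :=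
  isWeakDerivOn_of_hasDerivWithinAt isOpen_Ioo ordConnected_Ioo (fun _ hx => h.hasDerivAt_fst hx)
    (h.continuousOn_snd.mono Ioo_subset_Icc_self)

lemma IsClassical.isWeakGradient (hp : 2 < p) (hu : G.IsClassical p u v y) :
    G.IsWeakGradient u v := by
  rintro (h | i | j)
  · refine ⟨(memLp_congr_ae ((ae_restrict_iff' measurableSet_Ioi).2 (ae_of_all _
      fun x hx => ?_))).2 (memLp_solitonVel hp (y h)), ?_⟩
    · exact (hu.half h x (Ioi_subset_Ici_self hx)).2
    · refine isWeakDerivOn_of_hasDerivWithinAt isOpen_Ioi ordConnected_Ioi (fun x hx => ?_)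
        (Continuous.continuousOn (f := fun x => solitonVel p (x + y h))
          ((continuous_solitonVel hp).comp (by fun_prop)) |>.congr
          fun x hx => (hu.half h x (Ioi_subset_Ici_self hx)).2)
      have h1 := (hasDerivAt_soliton hp (x + y h)).comp_add_const x (y h)
      rw [← (hu.half h x (Ioi_subset_Ici_self hx)).2] at h1
      refine h1.congr_of_eventuallyEq ?_
      filter_upwards [Ioi_mem_nhds hx] with t ht using (hu.half h t (Ioi_subset_Ici_self ht)).1
  · exact ⟨memLp_Ioo_of_continuousOn (hu.pendant i).continuousOn_snd,
      IsTraj.isWeakDerivOn (hu.pendant i)⟩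
  · exact ⟨memLp_Ioo_of_continuousOn (hu.loop j).continuousOn_snd, IsTraj.isWeakDerivOn (hu.loop j)⟩

theorem IsClassical.isBoundState (hp : 2 < p) (hu : G.IsClassical p u v y) {c : ℝ}
    (hc : (∀ e, u e 0 = c) ∧ ∀ j, u (G.loop j) (2 * G.ℓ) = c) (hv : G.IsBalanced v) :
    G.IsBoundState p u := by
  have hcont : G.IsContinuous u := ⟨hu.continuousOn hp, c, hc⟩
  have hw := hu.isWeakGradient hp
  refine ⟨⟨hcont, hu.memLp hp, v, hw⟩, ⟨G.halfLine ⟨0, G.one_le_H⟩, 0, self_mem_Ici,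
    (hu.isPositive hp _ 0 self_mem_Ici).ne'⟩, v, hw, fun η dη hη hdη => ?_⟩
  rw [hu.sum_integral hp (fun e => ae_of_all _ fun x _ => rfl) hη hdη]
  obtain ⟨k, hk1, hk2⟩ := hη.1.2
  have h1 := hv.knot
  simp only [hk1, hk2, hv.pendant, zero_mul, Finset.sum_const_zero, ← Finset.sum_mul, ← sub_mul,
    ← add_mul, h1, sub_self]

lemma memH1_single {e₀ : G.Edge} {ξ dξ : ℝ → ℝ} (hc : ContinuousOn ξ (G.dom e₀)) (h0 : ξ 0 = 0)
    (h1 : ∀ j, e₀ = G.loop j → ξ (2 * G.ℓ) = 0) (h2 : MemLp ξ 2 (volume.restrict (G.openDom e₀)))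
    (h3 : MemLp dξ 2 (volume.restrict (G.openDom e₀))) (h4 : IsWeakDerivOn (G.openDom e₀) ξ dξ) :
    G.MemH1 (Pi.single e₀ ξ) ∧ G.IsWeakGradient (Pi.single e₀ ξ) (Pi.single e₀ dξ) := by
  have hw : G.IsWeakGradient (Pi.single e₀ ξ) (Pi.single e₀ dξ) := fun e => by
    rcases eq_or_ne e e₀ with rfl | hne
    · simpa using ⟨h3, h4⟩
    · simp only [Pi.single_eq_of_ne hne]
      exact ⟨MemLp.zero, fun χ _ _ _ => by simp⟩
  refine ⟨⟨⟨fun e => ?_, 0, fun e => ?_, fun j => ?_⟩, fun e => ?_, _, hw⟩, hw⟩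
  · rcases eq_or_ne e e₀ with rfl | hne
    · simpa using hc
    · simp only [Pi.single_eq_of_ne hne]
      exact continuousOn_const
  · rcases eq_or_ne e e₀ with rfl | hne
    · simpa using h0
    · simp [Pi.single_eq_of_ne hne]
  · rcases eq_or_ne (G.loop j) e₀ with rfl | hne
    · simpa using h1 j rfl
    · simp [Pi.single_eq_of_ne hne]
  · rcases eq_or_ne e e₀ with rfl | hne
    · simpa using h2
    · simp only [Pi.single_eq_of_ne hne]
      exact MemLp.zero

/-- The derivative of a bound-state has a weak derivative, given by the equation. -/
lemma isWeakDerivOn_of_boundState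
    (h : ∀ η dη, G.MemH1 η → G.IsWeakGradient η dη → ∑ e, ∫ x in G.openDom e,
      (du e x * dη e x + u e x * η e x - |u e x| ^ (p - 2) * u e x * η e x) = 0)
    (hdu : ∀ e, LocallyIntegrableOn (du e) (G.openDom e)) (hp : 2 < p)
    (hu : ∀ e, ContinuousOn (u e) (G.dom e)) (e : G.Edge) :
    IsWeakDerivOn (G.openDom e) (du e) fun x => u e x - |u e x| ^ (p - 2) * u e x := by
  intro χ h1 h2 h3
  have hI := (isOpen_openDom e).measurableSet
  have hz : ∀ x ∉ G.openDom e, χ x = 0 := fun x hx =>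
    image_eq_zero_of_notMem_tsupport fun hx' => hx (h3 hx')
  have h4 : ∀ x, HasDerivAt χ (deriv χ x) x := fun x =>
    (h1.differentiable (by simp)).differentiableAt.hasDerivAt
  have h5 : Continuous (deriv χ) := h1.continuous_deriv (by simp)
  have h0 : χ 0 = 0 := hz 0 (by rcases e with h | i | j <;> simp [openDom])
  obtain ⟨a, b⟩ := memH1_single (e₀ := e) (ξ := χ) (dξ := deriv χ) h1.continuous.continuousOn h0
    (by rintro j rfl; exact hz _ (by simp [openDom]))
    ((h1.continuous.memLp_of_hasCompactSupport h2).restrict _)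
    ((h5.memLp_of_hasCompactSupport h2.deriv).restrict _)
    (isWeakDerivOn_of_hasDerivWithinAt (isOpen_openDom e) (ordConnected_openDom e)
      (fun x _ => h4 x) h5.continuousOn)
  have h6 := h _ _ a b
  rw [Finset.sum_eq_single e (fun e' _ hne => by simp [Pi.single_eq_of_ne hne]) (by simp)] at h6
  simp only [Pi.single_eq_same] at h6
  have hts : tsupport (deriv χ) ⊆ tsupport χ :=
    closure_minimal support_deriv_subset (isClosed_tsupport χ)
  have hg : ContinuousOn (fun x => u e x - |u e x| ^ (p - 2) * u e x) (G.openDom e) := by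
    have := (hu e).mono (openDom_subset_dom e)
    exact this.sub ((this.abs.rpow_const fun x _ => Or.inr (by linarith)).mul this)
  have i1 := integrableOn_mul_test (hdu e) h5 h2.deriv (hts.trans h3) hI
  have i2 := integrableOn_mul_test (hg.locallyIntegrableOn (μ := volume) hI) h1.continuous h2 h3 hI
  rw [← sub_eq_zero, sub_neg_eq_add, ← integral_add i1 i2, ← h6]
  refine integral_congr_ae (ae_of_all _ fun x => ?_)
  simp only
  ring

lemma IsTraj.of_dom {e : G.Edge} {w z g : ℝ → ℝ} {b : ℝ} (hb : Icc 0 b ⊆ G.dom e)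
    (h1 : ∀ x ∈ G.dom e, HasDerivWithinAt w (z x) (G.dom e) x)
    (h2 : ∀ x, HasDerivAt z (g x) x) (h3 : ∀ x ∈ G.dom e, 0 < w x ∧ g x = w x - w x ^ (p - 1)) :
    IsTraj p b w z :=
  ⟨fun x hx => (h1 x (hb hx)).mono hb,
    fun x hx => (h3 x (hb hx)).2 ▸ (h2 x).hasDerivWithinAt, fun x hx => (h3 x (hb hx)).1⟩

/-- Positive bound-states are classical. -/
theorem IsBoundState.exists_isClassical (hp : 2 < p) (h : G.IsBoundState p u)
    (hpos : G.IsPositive u) : ∃ v y, G.IsClassical p u v y ∧ G.IsBalanced v := by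
  obtain ⟨⟨⟨hc, c, hc0, hc1⟩, hL, -⟩, -, du, hdu, ht⟩ := h
  have hloc : ∀ e, LocallyIntegrableOn (du e) (G.openDom e) := fun e =>
    locallyIntegrableOn_of_locallyIntegrable_restrict ((hdu e).1.locallyIntegrable one_le_two)
  have key : ∀ e, ∃ v g : ℝ → ℝ, (∀ x ∈ G.dom e, HasDerivWithinAt (u e) (v x) (G.dom e) x) ∧
      (∀ x, HasDerivAt v (g x) x) ∧ (∀ᵐ x, x ∈ G.openDom e → du e x = v x) ∧
      ∀ x ∈ G.dom e, 0 < u e x ∧ g x = u e x - u e x ^ (p - 1) := fun e => by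
    -- Composing with a retraction onto the edge makes the force continuous on all of `ℝ`, as the
    -- regularity theorem requires, without changing it on the edge.
    obtain ⟨r, r1, r2, r3⟩ := exists_retraction e
    have hur : Continuous fun x => u e (r x) := (hc e).comp_continuous r1 r2
    have hg : Continuous fun x => u e (r x) - |u e (r x)| ^ (p - 2) * u e (r x) :=
      hur.sub ((hur.abs.rpow_const fun x => Or.inr (by linarith)).mul hur)
    have hwk : IsWeakDerivOn (G.openDom e) (du e)
        fun x => u e (r x) - |u e (r x)| ^ (p - 2) * u e (r x) := fun χ h1 h2 h3 => by
      rw [isWeakDerivOn_of_boundState ht hloc hp hc e χ h1 h2 h3]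
      congr 1
      refine setIntegral_congr_fun (isOpen_openDom e).measurableSet fun x hx => ?_
      simp only [r3 x (openDom_subset_dom e hx)]
    obtain ⟨v, h1, h2, h3⟩ := exists_classical_of_weakDeriv (isOpen_openDom e)
      (ordConnected_openDom e) (nonempty_openDom e) (openDom_subset_dom e) (dom_subset_closure e)
      (hc e) (hloc e) hg (hdu e).2 hwk
    refine ⟨v, _, h1, h2, h3, fun x hx => ⟨hpos e x hx, ?_⟩⟩
    rw [r3 x hx, abs_rpow_mul_self (hpos e x hx)]
  choose v g h1 h2 h3 h4 using key
  have hhalf : ∀ h : Fin G.H, ∃ y : ℝ, ∀ x ∈ Ici (0 : ℝ),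
      u (G.halfLine h) x = soliton p (x + y) ∧ v (G.halfLine h) x = solitonVel p (x + y) := by
    intro h
    have hi : IntegrableOn (fun x => u (G.halfLine h) x ^ 2 + v (G.halfLine h) x ^ 2) (Ioi 0) := by
      refine Integrable.add (hL (G.halfLine h)).integrable_sq ?_
      refine ((hdu (G.halfLine h)).1.integrable_sq).congr ?_
      refine (ae_restrict_iff' measurableSet_Ioi).2 ?_
      filter_upwards [h3 (G.halfLine h)] with x hx hxI
      rw [hx hxI]
    obtain ⟨y, -, hy | hy⟩ := IsTraj.eq_soliton hp (fun b => IsTraj.of_dom (e := G.halfLine h)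
      (b := b) Icc_subset_Ici_self (h1 _) (h2 _) (h4 _)) hi
    · exact ⟨y, hy⟩
    · exact ⟨-y, by simpa only [← sub_eq_add_neg] using hy⟩
  choose y hy using hhalf
  have hcl : G.IsClassical p u v y :=
    ⟨fun i => IsTraj.of_dom (e := G.pendant i) Subset.rfl (h1 _) (h2 _) (h4 _),
      fun j => IsTraj.of_dom (e := G.loop j) Subset.rfl (h1 _) (h2 _) (h4 _), hy⟩
  -- Tested with the function `x` on one pendant and `0` elsewhere: it vanishes at the knot and
  -- isolates the derivative at the free end.
  have hpend : ∀ i, v (G.pendant i) G.ℓ = 0 := fun i => by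
    obtain ⟨a, b⟩ := memH1_single (e₀ := G.pendant i) (ξ := fun x => x) (dξ := fun _ => 1)
      continuousOn_id rfl (by simp) (memLp_Ioo_of_continuousOn continuousOn_id)
      (memLp_Ioo_of_continuousOn continuousOn_const)
      (isWeakDerivOn_of_hasDerivWithinAt (isOpen_openDom _) (ordConnected_openDom _)
        (fun x _ => hasDerivAt_id x) continuousOn_const)
    have h5 := ht _ _ a b
    rw [hcl.sum_integral hp h3 a b, Finset.sum_eq_single i (fun i' _ hne => by
      rw [Pi.single_eq_of_ne (by simpa using hne)]; simp) (by simp)] at h5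
    have h6 : ∀ e, (Pi.single (G.pendant i) (fun x : ℝ => x) : G.Fun) e 0 = 0 := fun e => by
      rcases eq_or_ne e (G.pendant i) with rfl | hne
      · simp
      · simp [Pi.single_eq_of_ne hne]
    have h7 : ∀ j x, (Pi.single (G.pendant i) (fun x : ℝ => x) : G.Fun) (G.loop j) x = 0 :=
      fun j x => by rw [Pi.single_eq_of_ne (by simp)]; rfl
    simp only [h6, h7, mul_zero, sub_self, Finset.sum_const_zero, add_zero, sub_zero,
      Pi.single_eq_same] at h5
    exact (mul_eq_zero.1 h5).resolve_right G.ℓ_pos.ne'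
  refine ⟨v, y, hcl, hpend, ?_⟩
  -- A test function equal to `1` at the knot and on the whole core, decaying on the half-lines:
  -- what remains is the balance of derivatives at the knot.
  set η : G.Fun := Sum.elim (fun _ x => Real.exp (-x)) fun _ _ => 1 with hη
  set dη : G.Fun := Sum.elim (fun _ x => -Real.exp (-x)) fun _ _ => 0 with hdη
  have hw : G.IsWeakGradient η dη := by
    rintro (h | i | j)
    · refine ⟨memLp_exp_neg.neg, isWeakDerivOn_of_hasDerivWithinAt isOpen_Ioi ordConnected_Ioi
        (fun x _ => ?_) (by simp only [hdη, Sum.elim_inl]; fun_prop)⟩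
      simpa [hη, hdη] using (hasDerivAt_neg x).exp
    all_goals
      exact ⟨MemLp.zero, isWeakDerivOn_of_hasDerivWithinAt isOpen_Ioo ordConnected_Ioo
        (fun x _ => hasDerivAt_const x 1) continuousOn_const⟩
  have hm : G.MemH1 η := by
    refine ⟨⟨?_, 1, ?_, fun j => rfl⟩, ?_, dη, hw⟩
    · rintro (h | i | j)
      · simp only [hη, Sum.elim_inl]
        fun_prop
      · exact continuousOn_const
      · exact continuousOn_const
    · rintro (h | i | j) <;> simp [hη]
    · rintro (h | i | j)
      · exact memLp_exp_neg
      · exact memLp_Ioo_of_continuousOn continuousOn_const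
      · exact memLp_Ioo_of_continuousOn continuousOn_const
  have h5 := ht η dη hm hw
  rw [hcl.sum_integral hp h3 hm hw] at h5
  simp only [hη, Sum.elim_inl, Sum.elim_inr, neg_zero, Real.exp_zero, mul_one,
    hpend, Finset.sum_const_zero, zero_sub, neg_eq_zero] at h5
  exact h5

end RegularSingleKnot

/-! ### Bound-states and the overdetermined problem -/

section SolitonValues

variable {p x y : ℝ}

lemma soliton_abs (p x : ℝ) : soliton p |x| = soliton p x := by
  rcases abs_choice x with h | h <;> rw [h]
  exact soliton_neg p x

lemma abs_eq_of_soliton_eq (hp : 2 < p) (h : soliton p x = soliton p y) : |x| = |y| := by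
  rw [← soliton_abs p x, ← soliton_abs p y] at h
  exact (strictAntiOn_soliton hp).injOn (abs_nonneg x) (abs_nonneg y) h

lemma soliton_eq_solitonMax (hp : 2 < p) (h : soliton p x = solitonMax p) : x = 0 := by
  rw [← soliton_zero p] at h
  simpa using abs_eq_of_soliton_eq hp h

/-- The soliton is even with a strict maximum at `0`: the value at `t = 0` gives `|y| = z`, and the
value at `t = z` excludes `y = -z`. -/
lemma exists_pos_shift_iff (hp : 2 < p) :
    (∃ z > 0, ∀ t ∈ Ici (0 : ℝ), soliton p (t + y) = soliton p (t + z)) ↔ 0 < y := by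
  refine ⟨fun ⟨z, hz, h⟩ => ?_, fun h => ⟨y, h, fun _ _ => rfl⟩⟩
  have h1 := abs_eq_of_soliton_eq hp (h 0 self_mem_Ici)
  rw [zero_add, zero_add, abs_of_pos hz] at h1
  by_contra! hle
  rw [abs_of_nonpos hle] at h1
  have h2 := abs_eq_of_soliton_eq hp (h z hz.le)
  rw [← h1, neg_add_cancel, abs_zero, eq_comm, abs_eq_zero] at h2
  linarith

lemma exists_neg_shift_iff (hp : 2 < p) :
    (∃ z > 0, ∀ t ∈ Ici (0 : ℝ), soliton p (t + y) = soliton p (t - z)) ↔ y < 0 := by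
  refine ⟨fun ⟨z, hz, h⟩ => ?_, fun h => ⟨-y, neg_pos.2 h, fun _ _ => by rw [sub_neg_eq_add]⟩⟩
  have h1 := abs_eq_of_soliton_eq hp (h 0 self_mem_Ici)
  rw [zero_add, zero_sub, abs_neg, abs_of_pos hz] at h1
  by_contra! hle
  rw [abs_of_nonneg hle] at h1
  have h2 := abs_eq_of_soliton_eq hp (h z hz.le)
  rw [sub_self, abs_zero, abs_eq_zero] at h2
  linarith

lemma solitonVel_eq_ite (hp : 2 < p) (hx : x ≠ 0) :
    solitonVel p x = if 0 < x then -√(2 * potential p (soliton p x)) else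
      √(2 * potential p (soliton p x)) := by
  split_ifs with h
  · exact solitonVel_eq hp h.le
  · have h1 : 0 < -x := neg_pos.2 (lt_of_le_of_ne (not_lt.1 h) hx)
    have h2 := solitonVel_eq hp h1.le
    rw [solitonVel_neg, soliton_neg] at h2
    linarith

lemma IsTraj.snd_eqOn {ℓ : ℝ} {u₁ v₁ u₂ v₂ : ℝ → ℝ} (hl : 0 < ℓ) (h₁ : IsTraj p ℓ u₁ v₁)
    (h₂ : IsTraj p ℓ u₂ v₂) (h : EqOn u₁ u₂ (Icc 0 ℓ)) : EqOn v₁ v₂ (Icc 0 ℓ) := fun x hx =>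
  (uniqueDiffOn_Icc hl x hx).eq_deriv _ (h₁.hu x hx) ((h₂.hu x hx).congr h (h hx))

end SolitonValues

namespace RegularSingleKnot

variable {G : RegularSingleKnot} {p θ : ℝ} {u v w : G.Fun} {y : Fin G.H → ℝ}

lemma numPlus_eq_card (hp : 2 < p)
    (h : ∀ h, ∀ x ∈ Ici (0 : ℝ), u (G.halfLine h) x = soliton p (x + y h)) :
    G.numPlus p u = (Finset.univ.filter fun h => 0 < y h).card := by
  rw [numPlus, ← Set.ncard_coe_finset]
  congr 1
  ext k
  rw [mem_ofPred_eq, Finset.coe_filter, mem_ofPred_eq, ← exists_pos_shift_iff hp]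
  simp only [Finset.mem_univ, true_and]
  refine exists_congr fun z => and_congr_right fun _ => forall₂_congr fun x hx => ?_
  rw [h k x hx]

lemma numMinus_eq_card (hp : 2 < p)
    (h : ∀ h, ∀ x ∈ Ici (0 : ℝ), u (G.halfLine h) x = soliton p (x + y h)) (hy : ∀ h, y h ≠ 0) :
    G.numMinus p u = (Finset.univ.filter fun h => ¬ 0 < y h).card := by
  rw [numMinus, ← Set.ncard_coe_finset]
  congr 1
  ext k
  have h1 : ¬ 0 < y k ↔ y k < 0 := by rw [not_lt, (hy k).le_iff_lt]
  rw [mem_ofPred_eq, Finset.coe_filter, mem_ofPred_eq, h1, ← exists_neg_shift_iff hp]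
  simp only [Finset.mem_univ, true_and]
  refine exists_congr fun z => and_congr_right fun _ => forall₂_congr fun x hx => ?_
  rw [h k x hx]

lemma numPlus_add_numMinus (hp : 2 < p)
    (h : ∀ h, ∀ x ∈ Ici (0 : ℝ), u (G.halfLine h) x = soliton p (x + y h)) (hy : ∀ h, y h ≠ 0) :
    G.numPlus p u + G.numMinus p u = G.H := by
  rw [numPlus_eq_card hp h, numMinus_eq_card hp h hy, Finset.card_filter_add_card_filter_not,
    Finset.card_univ, Fintype.card_fin]

lemma sum_solitonVel (hp : 2 < p)
    (h : ∀ h, ∀ x ∈ Ici (0 : ℝ), u (G.halfLine h) x = soliton p (x + y h)) (hy : ∀ h, y h ≠ 0)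
    {c : ℝ} (hc : ∀ h, soliton p (y h) = c) :
    ∑ h, solitonVel p (y h) =
      -(√(2 * potential p c) * ((G.numPlus p u : ℝ) - G.numMinus p u)) := by
  rw [numPlus_eq_card hp h, numMinus_eq_card hp h hy]
  simp only [fun h => solitonVel_eq_ite hp (hy h), hc, Finset.sum_ite, Finset.sum_const,
    nsmul_eq_mul]
  ring

/-- The derivatives of the restrictions to the compact edges. -/
def coreVel (G : RegularSingleKnot) (v : G.Fun) : G.CoreEdge → ℝ → ℝ
  | Sum.inl i => v (G.pendant i)
  | Sum.inr (Sum.inl j) => v (G.loop j)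
  | Sum.inr (Sum.inr j) => fun x => -v (G.loop j) (2 * G.ℓ - x)

lemma IsClassical.core (hu : G.IsClassical p u v y) (κ : G.CoreEdge) :
    IsTraj p G.ℓ (G.coreRestrict u κ) (G.coreVel v κ) := by
  have hl : G.ℓ ≤ 2 * G.ℓ := by linarith [G.ℓ_pos]
  rcases κ with i | j | j
  exacts [hu.pendant i, (hu.loop j).restrict hl, (hu.loop j).reverse.restrict hl]

lemma exists_coreEdge (h : 0 < G.P + G.L) : Nonempty G.CoreEdge := by
  rcases Nat.eq_zero_or_pos G.P with h0 | h0
  · exact ⟨Sum.inr (Sum.inl ⟨0, by omega⟩)⟩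
  · exact ⟨Sum.inl ⟨0, h0⟩⟩

lemma card_core_pos (h : 0 < G.P + G.L) : 0 < (G.P : ℝ) + 2 * G.L := by
  have : 0 < G.P + 2 * G.L := by omega
  exact_mod_cast this

lemma zero_mem_Icc (G : RegularSingleKnot) : (0 : ℝ) ∈ Icc 0 G.ℓ := ⟨le_rfl, G.ℓ_pos.le⟩

lemma ℓ_mem_Icc (G : RegularSingleKnot) : G.ℓ ∈ Icc 0 G.ℓ := ⟨G.ℓ_pos.le, le_rfl⟩

/-- The shape of a positive core-symmetric bound-state. -/
theorem IsSolution.exists_shift (hp : 2 < p) (h : G.IsSolution p θ u) (hPL : 0 < G.P + G.L) :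
    ∃ y : Fin G.H → ℝ, (∀ h, y h ≠ 0) ∧
      (∀ h, ∀ x ∈ Ici (0 : ℝ), u (G.halfLine h) x = soliton p (x + y h)) ∧
      ∀ κ, IsODESolution p θ G.ℓ (G.coreRestrict u κ) := by
  obtain ⟨hb, hpos, hsym, hθ⟩ := h
  obtain ⟨c, hc0, hc1⟩ := hb.1.1.2
  obtain ⟨v, y, hu, hv⟩ := hb.exists_isClassical hp hpos
  obtain ⟨κ₀⟩ := exists_coreEdge hPL
  have hvel : ∀ κ₁ κ₂, EqOn (G.coreVel v κ₁) (G.coreVel v κ₂) (Icc 0 G.ℓ) := fun κ₁ κ₂ =>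
    (hu.core κ₁).snd_eqOn G.ℓ_pos (hu.core κ₂) (hsym κ₁ κ₂)
  have hend : ∀ κ, G.coreVel v κ G.ℓ = 0 := by
    -- The two halves of a loop coincide but are run in opposite directions, so their velocities at
    -- the mid-point are equal and opposite.
    have hloop : ∀ j, v (G.loop j) G.ℓ = 0 := fun j => by
      have := hvel (Sum.inr (Sum.inl j)) (Sum.inr (Sum.inr j)) G.ℓ_mem_Icc
      simp only [coreVel, show 2 * G.ℓ - G.ℓ = G.ℓ by ring] at this
      linarith
    rintro (i | j | j)
    · exact hv.pendant i
    · exact hloop j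
    · simp [coreVel, show 2 * G.ℓ - G.ℓ = G.ℓ by ring, hloop j]
  have hstart : ∀ κ, G.coreRestrict u κ 0 = c := by
    rintro (i | j | j)
    · exact hc0 _
    · exact hc0 _
    · simpa [coreRestrict] using hc1 j
  set s := G.coreVel v κ₀ 0 with hs
  have hknot : ∑ h, solitonVel p (y h) + (G.P + 2 * G.L) * s = 0 := by
    have h1 : ∀ h, v (G.halfLine h) 0 = solitonVel p (y h) := fun h => by
      simpa using (hu.half h 0 self_mem_Ici).2
    have h2 : ∀ i, v (G.pendant i) 0 = s := fun i => hvel (Sum.inl i) κ₀ G.zero_mem_Icc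
    have h3 : ∀ j, v (G.loop j) 0 - v (G.loop j) (2 * G.ℓ) = 2 * s := fun j => by
      have h4 : v (G.loop j) 0 = s := hvel (Sum.inr (Sum.inl j)) κ₀ G.zero_mem_Icc
      have h5 : -v (G.loop j) (2 * G.ℓ - 0) = s := hvel (Sum.inr (Sum.inr j)) κ₀ G.zero_mem_Icc
      rw [sub_zero] at h5
      linarith
    have h4 := hv.knot
    simp only [h1, h2, h3, Finset.sum_const, Finset.card_univ, Fintype.card_fin,
      nsmul_eq_mul] at h4
    linarith
  have hyc : ∀ h, soliton p (y h) = c := fun h => by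
    have := (hu.half h 0 self_mem_Ici).1
    rw [zero_add] at this
    rw [← this]
    exact hc0 _
  have hN := card_core_pos hPL
  -- A zero shift would put the maximum of the soliton at the knot. All derivatives on the
  -- half-lines would vanish there, hence also `s`; the core would carry the soliton started at its
  -- peak, whose velocity at `ℓ` is not zero.
  have hy : ∀ h, y h ≠ 0 := by
    intro h₀ h0
    have hcm : c = solitonMax p := by rw [← hyc h₀, h0, soliton_zero]
    have h1 : ∀ h, solitonVel p (y h) = 0 := fun h => by
      rw [soliton_eq_solitonMax hp ((hyc h).trans hcm), solitonVel_zero]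
    simp only [h1, Finset.sum_const_zero, zero_add] at hknot
    have hs0 : s = 0 := (mul_eq_zero.1 hknot).resolve_left hN.ne'
    have h2 := ((hu.core κ₀).eqOn hp (soliton_isTraj hp 0 G.ℓ)
      (by simp [hstart κ₀, hcm, soliton_zero]) (by simpa [solitonVel_zero] using hs0)).2 G.ℓ_mem_Icc
    rw [hend κ₀] at h2
    simp only [add_zero] at h2
    exact (solitonVel_neg_of_pos hp G.ℓ_pos).ne h2.symm
  have hhalf : ∀ h, ∀ x ∈ Ici (0 : ℝ), u (G.halfLine h) x = soliton p (x + y h) :=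
    fun h x hx => (hu.half h x hx).1
  have hs' : s = θ * √(2 * potential p c) := by
    rw [sum_solitonVel hp hhalf hy hyc] at hknot
    rw [← hθ, incidenceIndex, div_mul_eq_mul_div, eq_div_iff hN.ne']
    linarith
  refine ⟨y, hy, hhalf, fun κ => ⟨G.coreVel v κ, (hu.core κ).hu, (hu.core κ).hv, ?_, ?_, hend κ,
    (hu.core κ).pos⟩⟩
  · rw [hstart κ, ← hyc ⟨0, G.one_le_H⟩]
    exact ⟨soliton_pos hp _, soliton_lt_solitonMax hp (hy _)⟩
  · rw [hstart κ, ← hs']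
    exact hvel κ κ₀ G.zero_mem_Icc

lemma card_filter_lt {n a : ℕ} (h : a ≤ n) :
    (Finset.univ.filter fun k : Fin n => (k : ℕ) < a).card = a := by
  rw [Fin.card_filter_val_lt]
  exact min_eq_right h

/-- Solutions of the overdetermined problem extend to the graph. -/
theorem exists_isSolution (hp : 2 < p) (hPL : 0 < G.P + G.L) (hadm : G.IsAdmissible θ)
    {f : ℝ → ℝ} (h : IsODESolution p θ G.ℓ f) :
    ∃ u, G.IsSolution p θ u ∧ ∀ κ, EqOn (G.coreRestrict u κ) f (Icc 0 G.ℓ) := by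
  obtain ⟨a, b, hab, hθ⟩ := hadm
  obtain ⟨g, h1, h2, h3, h4, h5, h6⟩ := h
  have ht : IsTraj p G.ℓ f g := ⟨h1, h2, h6⟩
  have hl := G.ℓ_pos
  obtain ⟨Y, hY0, hY⟩ := exists_soliton_eq hp ⟨h3.1, h3.2.le⟩
  have hYpos : 0 < Y := hY0.lt_of_ne (by
    rintro rfl
    rw [soliton_zero] at hY
    exact h3.2.ne hY.symm)
  -- On a loop: `f` up to the mid-point, then `f` backwards. The pieces match in `C¹` because `g ℓ =
  -- 0`.
  obtain ⟨m, n, k1, ⟨k2, k3⟩, k4⟩ := ht.concat hl.le hl.le ht.reverse (by simp) (by simp [h5])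
  rw [← two_mul] at k1 k4
  have hm : ∀ x ∈ Icc 0 G.ℓ, m (2 * G.ℓ - x) = f x ∧ n (2 * G.ℓ - x) = -g x := fun x hx => by
    have := k4 (2 * G.ℓ - x) ⟨by linarith [hx.2], by linarith [hx.1]⟩
    rwa [show G.ℓ - (2 * G.ℓ - x - G.ℓ) = x by ring] at this
  have hm0 := hm 0 G.zero_mem_Icc
  rw [sub_zero] at hm0
  -- The first `a` half-lines carry the decreasing branch, the others the branch that passes through
  -- the maximum.
  set y : Fin G.H → ℝ := fun h => if (h : ℕ) < a then Y else -Y with hy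
  have hypos : ∀ h, 0 < y h ↔ (h : ℕ) < a := fun h => by
    simp only [hy]
    split_ifs with hh
    · simp [hh, hYpos]
    · simp [hh, hYpos.le]
  have hy0 : ∀ h, y h ≠ 0 := fun h => by
    simp only [hy]
    split_ifs
    exacts [hYpos.ne', neg_ne_zero.2 hYpos.ne']
  have hyY : ∀ h, soliton p (y h) = f 0 := fun h => by
    simp only [hy]
    split_ifs
    exacts [hY, by rw [soliton_neg, hY]]
  set u : G.Fun := Sum.elim (fun h x => soliton p (x + y h)) (Sum.elim (fun _ => f) fun _ => m)
    with hu
  set v : G.Fun := Sum.elim (fun h x => solitonVel p (x + y h)) (Sum.elim (fun _ => g) fun _ => n)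
    with hv
  have hcl : G.IsClassical p u v y := ⟨fun _ => ht, fun _ => k1, fun _ _ _ => ⟨rfl, rfl⟩⟩
  have hhalf : ∀ h, ∀ x ∈ Ici (0 : ℝ), u (G.halfLine h) x = soliton p (x + y h) :=
    fun _ _ _ => rfl
  have hplus : G.numPlus p u = a := by
    rw [numPlus_eq_card hp hhalf]
    simp only [hypos]
    exact card_filter_lt (by omega)
  have hminus : G.numMinus p u = b := by
    have := numPlus_add_numMinus hp hhalf hy0
    omega
  have hN := card_core_pos hPL
  have hg0 : (G.P + 2 * G.L) * g 0 = ((a : ℝ) - b) * √(2 * potential p (f 0)) := by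
    rw [h4, hθ]
    field_simp
  have hbal : G.IsBalanced v := by
    refine ⟨fun i => h5, ?_⟩
    have e1 : ∀ h, v (G.halfLine h) 0 = solitonVel p (y h) := fun h => by simp [hv]
    have e2 : ∀ i, v (G.pendant i) 0 = g 0 := fun i => rfl
    have e3 : ∀ j, v (G.loop j) 0 - v (G.loop j) (2 * G.ℓ) = 2 * g 0 := fun j => by
      change n 0 - n (2 * G.ℓ) = 2 * g 0
      rw [hm0.2, k3 G.zero_mem_Icc]
      ring
    simp only [e1, e2, e3, sum_solitonVel hp hhalf hy0 hyY, hplus, hminus, Finset.sum_const,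
      Finset.card_univ, Fintype.card_fin, nsmul_eq_mul]
    linarith
  have hcore : ∀ κ, EqOn (G.coreRestrict u κ) f (Icc 0 G.ℓ) := by
    rintro (i | j | j)
    · exact fun x _ => rfl
    · exact k2
    · exact fun x hx => (hm x hx).1
  refine ⟨u, ⟨hcl.isBoundState hp (c := f 0) ⟨?_, fun j => hm0.1⟩ hbal, hcl.isPositive hp,
    fun κ₁ κ₂ => (hcore κ₁).trans (hcore κ₂).symm, ?_⟩, hcore⟩
  · rintro (h | i | j)
    · change soliton p (0 + y h) = f 0
      rw [zero_add, hyY h]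
    · rfl
    · exact k2 G.zero_mem_Icc
  · rw [incidenceIndex, hplus, hminus, hθ]

lemma eqOn_of_coreRestrict (h : ∀ κ, EqOn (G.coreRestrict u κ) (G.coreRestrict w κ) (Icc 0 G.ℓ)) :
    (∀ i, EqOn (u (G.pendant i)) (w (G.pendant i)) (Icc 0 G.ℓ)) ∧
      ∀ j, EqOn (u (G.loop j)) (w (G.loop j)) (Icc 0 (2 * G.ℓ)) := by
  refine ⟨fun i => h (Sum.inl i), fun j x hx => ?_⟩
  rcases le_total x G.ℓ with hle | hle
  · exact h (Sum.inr (Sum.inl j)) ⟨hx.1, hle⟩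
  · have := h (Sum.inr (Sum.inr j)) (x := 2 * G.ℓ - x) ⟨by linarith [hx.2], by linarith⟩
    simpa [coreRestrict] using this

lemma EqUpToPerm.eqOn_coreRestrict (h : G.EqUpToPerm u w) (κ : G.CoreEdge) :
    EqOn (G.coreRestrict u κ) (G.coreRestrict w κ) (Icc 0 G.ℓ) := by
  obtain ⟨-, -, h2, h3⟩ := h
  have hl := G.ℓ_pos
  rcases κ with i | j | j
  · exact h2 i
  · exact (h3 j).mono (Icc_subset_Icc_right (by linarith))
  · exact fun x hx => h3 j ⟨by linarith [hx.2], by linarith [hx.1]⟩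

/-- Two solutions with the same core differ by a permutation of the half-lines. -/
theorem IsSolution.eqUpToPerm (hp : 2 < p) (hPL : 0 < G.P + G.L) (hu : G.IsSolution p θ u)
    (hw : G.IsSolution p θ w)
    (h : ∀ κ, EqOn (G.coreRestrict u κ) (G.coreRestrict w κ) (Icc 0 G.ℓ)) :
    G.EqUpToPerm u w := by
  obtain ⟨y, hy0, hy, -⟩ := hu.exists_shift hp hPL
  obtain ⟨z, hz0, hz, -⟩ := hw.exists_shift hp hPL
  obtain ⟨c, hc0, -⟩ := hu.1.1.1.2
  obtain ⟨d, hd0, -⟩ := hw.1.1.1.2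
  have hcd : c = d := by
    obtain ⟨κ⟩ := exists_coreEdge hPL
    obtain ⟨e, he⟩ : ∃ e, u e 0 = w e 0 := by
      rcases κ with i | j | j
      · exact ⟨_, h (Sum.inl i) G.zero_mem_Icc⟩
      · exact ⟨_, h (Sum.inr (Sum.inl j)) G.zero_mem_Icc⟩
      · exact ⟨_, h (Sum.inr (Sum.inl j)) G.zero_mem_Icc⟩
    rw [← hc0 e, ← hd0 e, he]
  have hyz : ∀ k l, |y k| = |z l| := fun k l => by
    refine abs_eq_of_soliton_eq hp ?_
    have h1 := hy k 0 self_mem_Ici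
    have h2 := hz l 0 self_mem_Ici
    rw [zero_add] at h1 h2
    rw [← h1, ← h2, hc0, hd0, hcd]
  have hcard : (Finset.univ.filter fun h => 0 < y h).card =
      (Finset.univ.filter fun h => 0 < z h).card := by
    rw [← numPlus_eq_card hp hy, ← numPlus_eq_card hp hz]
    have h1 := numPlus_add_numMinus hp hy hy0
    have h2 := numPlus_add_numMinus hp hz hz0
    have h3 := hu.2.2.2.trans hw.2.2.2.symm
    rw [incidenceIndex, incidenceIndex, div_left_inj' (card_core_pos hPL).ne'] at h3
    have h4 : (G.numPlus p u : ℝ) + G.numMinus p u = G.numPlus p w + G.numMinus p w := by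
      exact_mod_cast h1.trans h2.symm
    have h5 : (G.numPlus p u : ℝ) = G.numPlus p w := by linarith
    exact_mod_cast h5
  -- All shifts have the same absolute value, fixed by the value at the knot, and the index together
  -- with `H⁺ + H⁻ = H` fixes the number of positive ones. It remains to match the signs.
  obtain ⟨σ, hσ⟩ := Equiv.Perm.exists_map_finset_eq _ _ hcard
  have hiff : ∀ k, 0 < y k ↔ 0 < z (σ k) := fun k => by
    have h1 : σ k ∈ (Finset.univ.filter fun h => 0 < z h) ↔
        k ∈ Finset.univ.filter fun h => 0 < y h := by
      rw [← hσ]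
      simp
    simpa using h1.symm
  refine ⟨σ, fun k x hx => ?_, eqOn_of_coreRestrict h⟩
  rw [hy k x hx, hz (σ k) x hx]
  have h1 := hyz k (σ k)
  by_cases hk : 0 < y k
  · rw [abs_of_pos hk, abs_of_pos ((hiff k).1 hk)] at h1
    rw [h1]
  · rw [abs_of_nonpos (not_lt.1 hk), abs_of_nonpos (not_lt.1 fun h => hk ((hiff k).2 h))] at h1
    rw [neg_inj.1 h1]

/-! ### Shape of a core-symmetric function, read on one compact edge. -/

section CoreSymmetric

lemma IsCoreSymmetric.isCoreIncreasing_iff (hs : G.IsCoreSymmetric u) (κ₀ : G.CoreEdge) :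
    G.IsCoreIncreasing u ↔ StrictMonoOn (G.coreRestrict u κ₀) (Icc 0 G.ℓ) :=
  ⟨fun h => h κ₀, fun h κ => h.congr (hs κ₀ κ)⟩

lemma IsCoreSymmetric.isCoreDecreasing_iff (hs : G.IsCoreSymmetric u) (κ₀ : G.CoreEdge) :
    G.IsCoreDecreasing u ↔ StrictAntiOn (G.coreRestrict u κ₀) (Icc 0 G.ℓ) :=
  ⟨fun h => h κ₀, fun h κ => h.congr (hs κ₀ κ)⟩

lemma IsCoreSymmetric.isCoreMonotone_iff (hs : G.IsCoreSymmetric u) (κ₀ : G.CoreEdge) :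
    G.IsCoreMonotone u ↔ IsMonotoneOn G.ℓ (G.coreRestrict u κ₀) :=
  or_congr (hs.isCoreIncreasing_iff κ₀) (hs.isCoreDecreasing_iff κ₀)

lemma IsCoreSymmetric.isCoreConstant_iff (hs : G.IsCoreSymmetric u) (κ₀ : G.CoreEdge) :
    G.IsCoreConstant u ↔ ∃ c, ∀ x ∈ Icc 0 G.ℓ, G.coreRestrict u κ₀ x = c :=
  ⟨fun h => ⟨_, h κ₀⟩, fun ⟨c, hc⟩ κ x hx => by
    rw [hs κ κ₀ hx, hs κ κ₀ G.zero_mem_Icc, hc x hx, hc 0 G.zero_mem_Icc]⟩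

end CoreSymmetric

/-- Uniqueness results for the overdetermined problem carry over to the graph. -/
theorem existsUniqueUpToPerm_of_existsUniqueOn (hp : 2 < p) (hPL : 0 < G.P + G.L)
    (hadm : G.IsAdmissible θ) {A R : (ℝ → ℝ) → Prop} {Q S : G.Fun → Prop} {κ₀ : G.CoreEdge}
    (hA : ∀ f g, A f → EqOn f g (Icc 0 G.ℓ) → A g) (hR : ∀ f g, R f → EqOn f g (Icc 0 G.ℓ) → R g)
    (hQ : ∀ u, G.IsSolution p θ u → (Q u ↔ A (G.coreRestrict u κ₀)))
    (hS : ∀ u, G.IsSolution p θ u → R (G.coreRestrict u κ₀) → S u)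
    (h : ExistsUniqueOn G.ℓ (fun f => IsODESolution p θ G.ℓ f ∧ A f) R) :
    G.ExistsUniqueUpToPerm (fun u => G.IsSolution p θ u ∧ Q u) S := by
  obtain ⟨f, ⟨h1, h2⟩, h3, h4⟩ := h
  obtain ⟨u, hu, he⟩ := exists_isSolution hp hPL hadm h1
  refine ⟨u, ⟨hu, (hQ u hu).2 (hA _ _ h2 (he κ₀).symm)⟩, hS u hu (hR _ _ h3 (he κ₀).symm), ?_⟩
  rintro w ⟨hw, hwQ⟩
  obtain ⟨-, -, -, hode⟩ := hw.exists_shift hp hPL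
  have h5 := h4 _ ⟨hode κ₀, (hQ w hw).1 hwQ⟩
  exact hw.eqUpToPerm hp hPL hu fun κ =>
    (hw.2.2.1 κ κ₀).trans (h5.trans (he κ).symm)

end RegularSingleKnot

end

/-! ### Assembly of the interval and graph results. -/

theorem mainTheorem1 (p : ℝ) (hp : 2 < p) :
    -- the overdetermined problem on an interval
    (∀ θ ℓ : ℝ, 0 < ℓ →
      (θ = 0 →
        ExistsUniqueOn ℓ
          (fun u => IsODESolution p θ ℓ u ∧ ∃ c : ℝ, ∀ x ∈ Set.Icc 0 ℓ, u x = c)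
          (fun u => ∀ x ∈ Set.Icc 0 ℓ, u x = 1) ∧
        (ℓ ≤ Real.pi / √(p - 2) → ¬ ∃ u, IsODESolution p θ ℓ u ∧ IsMonotoneOn ℓ u) ∧
        (Real.pi / √(p - 2) < ℓ →
          ExistsUniqueOn ℓ
            (fun u => IsODESolution p θ ℓ u ∧ StrictMonoOn u (Set.Icc 0 ℓ))
            (fun u => u 0 ∈ Set.Ioo 0 1) ∧
          ExistsUniqueOn ℓ
            (fun u => IsODESolution p θ ℓ u ∧ StrictAntiOn u (Set.Icc 0 ℓ))
            (fun u => 1 < u 0))) ∧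
      (θ ∈ Set.Ioo (0 : ℝ) 1 →
        ExistsUniqueOn ℓ (fun u => IsODESolution p θ ℓ u ∧ IsMonotoneOn ℓ u)
          (fun u => StrictMonoOn u (Set.Icc 0 ℓ))) ∧
      (θ ∈ Set.Ioo (-1 : ℝ) 0 →
        (ℓ ≤ Real.arsinh (|θ| / √(1 - θ ^ 2)) →
          ¬ ∃ u, IsODESolution p θ ℓ u ∧ IsMonotoneOn ℓ u) ∧
        (Real.arsinh (|θ| / √(1 - θ ^ 2)) < ℓ →
          ExistsUniqueOn ℓ (fun u => IsODESolution p θ ℓ u ∧ IsMonotoneOn ℓ u)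
            (fun u => StrictAntiOn u (Set.Icc 0 ℓ)))) ∧
      (θ = 1 →
        ExistsUniqueOn ℓ (fun u => IsODESolution p θ ℓ u)
          (fun u => StrictMonoOn u (Set.Icc 0 ℓ) ∧
            ∃ a : ℝ, ∀ x ∈ Set.Icc 0 ℓ, u x = soliton p (x + a))) ∧
      (θ ≤ -1 → ¬ ∃ u, IsODESolution p θ ℓ u) ∧
      (1 < θ → ∃ u, IsODESolution p θ ℓ u ∧ StrictMonoOn u (Set.Icc 0 ℓ)) ∧
      (1 < θ → θ ≤ 2 →
        ExistsUniqueOn ℓ (fun u => IsODESolution p θ ℓ u)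
          (fun u => StrictMonoOn u (Set.Icc 0 ℓ)))) ∧
    -- positive core-symmetric bound-states on a regular single-knot graph
    (∀ (G : RegularSingleKnot) (θ : ℝ), 0 < G.P + G.L → G.IsAdmissible θ →
      (θ = 0 →
        G.ExistsUniqueUpToPerm (fun u => G.IsSolution p θ u ∧ G.IsCoreConstant u)
          (fun _ => True) ∧
        (G.ℓ ≤ Real.pi / √(p - 2) → ¬ ∃ u, G.IsSolution p θ u ∧ G.IsCoreMonotone u) ∧
        (Real.pi / √(p - 2) < G.ℓ →
          G.ExistsUniqueUpToPerm (fun u => G.IsSolution p θ u ∧ G.IsCoreIncreasing u)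
            (fun _ => True) ∧
          G.ExistsUniqueUpToPerm (fun u => G.IsSolution p θ u ∧ G.IsCoreDecreasing u)
            (fun _ => True))) ∧
      (θ ∈ Set.Ioo (0 : ℝ) 1 →
        G.ExistsUniqueUpToPerm (fun u => G.IsSolution p θ u ∧ G.IsCoreMonotone u)
          (fun u => G.IsCoreIncreasing u)) ∧
      (θ ∈ Set.Ioo (-1 : ℝ) 0 →
        (G.ℓ ≤ Real.arsinh (|θ| / √(1 - θ ^ 2)) →
          ¬ ∃ u, G.IsSolution p θ u ∧ G.IsCoreMonotone u) ∧
        (Real.arsinh (|θ| / √(1 - θ ^ 2)) < G.ℓ →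
          G.ExistsUniqueUpToPerm (fun u => G.IsSolution p θ u ∧ G.IsCoreMonotone u)
            (fun u => G.IsCoreDecreasing u))) ∧
      (θ = 1 →
        G.ExistsUniqueUpToPerm (fun u => G.IsSolution p θ u)
          (fun u => G.IsCoreIncreasing u)) ∧
      (θ ≤ -1 → ¬ ∃ u, G.IsSolution p θ u) ∧
      (1 < θ → ∃ u, G.IsSolution p θ u ∧ G.IsCoreMonotone u) ∧
      (1 < θ → θ ≤ 2 →
        G.ExistsUniqueUpToPerm (fun u => G.IsSolution p θ u ∧ G.IsCoreMonotone u)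
          (fun u => G.IsCoreIncreasing u))) ∧
    -- multiplicity for large incidence index, with a threshold that depends on `p` only
    (∃ θstar : ℝ, 2 < θstar ∧ ∀ θ : ℝ, θstar < θ →
      ∃ ℓ₁ ℓ₂ : ℝ, 0 < ℓ₁ ∧ ℓ₁ < ℓ₂ ∧
        (∀ ℓ ∈ Set.Icc ℓ₁ ℓ₂, ∃ u w,
          (IsODESolution p θ ℓ u ∧ StrictMonoOn u (Set.Icc 0 ℓ)) ∧
          (IsODESolution p θ ℓ w ∧ StrictMonoOn w (Set.Icc 0 ℓ)) ∧
          ¬ Set.EqOn u w (Set.Icc 0 ℓ)) ∧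
        ∀ G : RegularSingleKnot, 0 < G.P + G.L → G.ℓ ∈ Set.Icc ℓ₁ ℓ₂ → G.IsAdmissible θ →
          ∃ u w,
            (G.IsSolution p θ u ∧ G.IsCoreIncreasing u) ∧
            (G.IsSolution p θ w ∧ G.IsCoreIncreasing w) ∧
            ¬ G.EqUpToPerm u w) := by
  refine ⟨fun θ ℓ hl => ?_, fun G θ hPL hadm => ?_, ?_⟩
  · refine ⟨?_, existsUniqueOn_of_mem_Ioo_zero_one hp hl, fun hθ =>
      ⟨not_exists_monotone_of_le_arsinh hp hl hθ,
        existsUniqueOn_of_mem_Ioo_neg_one_zero hp hl hθ⟩, ?_, not_exists_of_le_neg_one hp hl,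
      fun h => exists_increasing hp hl (one_pos.trans h),
      fun h1 h2 => existsUniqueOn_of_mem_Ioc_one_two hp hl ⟨h1, h2⟩⟩
    · rintro rfl
      exact ⟨existsUniqueOn_constant hp hl, not_exists_monotone_of_le hp hl, fun h =>
        ⟨existsUniqueOn_increasing_zero hp h, existsUniqueOn_decreasing_zero hp h⟩⟩
    · rintro rfl
      exact existsUniqueOn_one hp hl
  · obtain ⟨κ₀⟩ := RegularSingleKnot.exists_coreEdge hPL
    have hl := G.ℓ_pos
    have hode : ∀ u, G.IsSolution p θ u → IsODESolution p θ G.ℓ (G.coreRestrict u κ₀) :=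
      fun u hu => (hu.exists_shift hp hPL).choose_spec.2.2 κ₀
    have hcst : ∀ f g : ℝ → ℝ, (∃ c : ℝ, ∀ x ∈ Set.Icc 0 G.ℓ, f x = c) →
        Set.EqOn f g (Set.Icc 0 G.ℓ) → ∃ c : ℝ, ∀ x ∈ Set.Icc 0 G.ℓ, g x = c :=
      fun f g ⟨c, hc⟩ he => ⟨c, fun x hx => (he hx).symm.trans (hc x hx)⟩
    have hmono : ∀ f g : ℝ → ℝ, IsMonotoneOn G.ℓ f → Set.EqOn f g (Set.Icc 0 G.ℓ) →
        IsMonotoneOn G.ℓ g := fun f g h he => h.imp (·.congr he) (·.congr he)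
    have hinc : ∀ f g : ℝ → ℝ, StrictMonoOn f (Set.Icc 0 G.ℓ) → Set.EqOn f g (Set.Icc 0 G.ℓ) →
        StrictMonoOn g (Set.Icc 0 G.ℓ) := fun f g h he => h.congr he
    have hdec : ∀ f g : ℝ → ℝ, StrictAntiOn f (Set.Icc 0 G.ℓ) → Set.EqOn f g (Set.Icc 0 G.ℓ) →
        StrictAntiOn g (Set.Icc 0 G.ℓ) := fun f g h he => h.congr he
    have hno : (¬ ∃ u, IsODESolution p θ G.ℓ u ∧ IsMonotoneOn G.ℓ u) →
        ¬ ∃ u, G.IsSolution p θ u ∧ G.IsCoreMonotone u := fun h ⟨u, hu, hm⟩ =>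
      h ⟨_, hode u hu, (hu.2.2.1.isCoreMonotone_iff κ₀).1 hm⟩
    have hQmono : ∀ u, G.IsSolution p θ u →
        (G.IsCoreMonotone u ↔ IsMonotoneOn G.ℓ (G.coreRestrict u κ₀)) :=
      fun u hu => hu.2.2.1.isCoreMonotone_iff κ₀
    have hQinc : ∀ u, G.IsSolution p θ u →
        (G.IsCoreIncreasing u ↔ StrictMonoOn (G.coreRestrict u κ₀) (Set.Icc 0 G.ℓ)) :=
      fun u hu => hu.2.2.1.isCoreIncreasing_iff κ₀
    have hQdec : ∀ u, G.IsSolution p θ u →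
        (G.IsCoreDecreasing u ↔ StrictAntiOn (G.coreRestrict u κ₀) (Set.Icc 0 G.ℓ)) :=
      fun u hu => hu.2.2.1.isCoreDecreasing_iff κ₀
    refine ⟨?_, fun hθ => ?_, fun hθ => ⟨fun h => ?_, fun h => ?_⟩, ?_, ?_, fun hθ => ?_,
      fun h1 h2 => ?_⟩
    · rintro rfl
      refine ⟨?_, fun h => hno (not_exists_monotone_of_le hp hl h), fun h => ⟨?_, ?_⟩⟩
      · obtain ⟨f, h1, -, h2⟩ := existsUniqueOn_constant hp hl
        exact RegularSingleKnot.existsUniqueUpToPerm_of_existsUniqueOn (R := fun _ => True)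
          hp hPL hadm hcst
          (fun _ _ h _ => h) (fun u hu => hu.2.2.1.isCoreConstant_iff κ₀) (fun _ _ h => h)
          ⟨f, h1, trivial, h2⟩
      · obtain ⟨f, h1, -, h2⟩ := existsUniqueOn_increasing_zero hp h
        exact RegularSingleKnot.existsUniqueUpToPerm_of_existsUniqueOn (R := fun _ => True)
          hp hPL hadm hinc
          (fun _ _ h _ => h) hQinc (fun _ _ h => h) ⟨f, h1, trivial, h2⟩
      · obtain ⟨f, h1, -, h2⟩ := existsUniqueOn_decreasing_zero hp h
        exact RegularSingleKnot.existsUniqueUpToPerm_of_existsUniqueOn (R := fun _ => True)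
          hp hPL hadm hdec
          (fun _ _ h _ => h) hQdec (fun _ _ h => h) ⟨f, h1, trivial, h2⟩
    · exact RegularSingleKnot.existsUniqueUpToPerm_of_existsUniqueOn hp hPL hadm hmono hinc
        hQmono (fun u hu => (hQinc u hu).2) (existsUniqueOn_of_mem_Ioo_zero_one hp hl hθ)
    · exact hno (not_exists_monotone_of_le_arsinh hp hl hθ h)
    · exact RegularSingleKnot.existsUniqueUpToPerm_of_existsUniqueOn hp hPL hadm hmono hdec
        hQmono (fun u hu => (hQdec u hu).2) (existsUniqueOn_of_mem_Ioo_neg_one_zero hp hl hθ h)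
    · rintro rfl
      obtain ⟨f, h1, ⟨h2, -⟩, h3⟩ := existsUniqueOn_one hp hl
      -- No monotonicity is imposed for `θ = 1`, so the transfer to the graph is used with trivial
      -- side conditions.
      obtain ⟨u, hu, hu', hu''⟩ := RegularSingleKnot.existsUniqueUpToPerm_of_existsUniqueOn hp hPL
        hadm (A := fun _ => True) (Q := fun _ => True) (fun _ _ _ _ => trivial) hinc
        (fun _ _ => Iff.rfl) (fun u hu => (hQinc u hu).2)
        ⟨f, ⟨h1, trivial⟩, h2, fun w hw => h3 w hw.1⟩
      exact ⟨u, hu.1, hu', fun w hw => hu'' w ⟨hw, trivial⟩⟩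
    · rintro hθ ⟨u, hu⟩
      exact not_exists_of_le_neg_one hp hl hθ ⟨_, hode u hu⟩
    · obtain ⟨f, h1, h2⟩ := exists_increasing hp hl (one_pos.trans hθ)
      obtain ⟨u, hu, he⟩ := RegularSingleKnot.exists_isSolution hp hPL hadm h1
      exact ⟨u, hu, Or.inl fun κ => h2.congr (he κ).symm⟩
    · obtain ⟨f, h3, h4, h5⟩ := existsUniqueOn_of_mem_Ioc_one_two hp hl ⟨h1, h2⟩
      exact RegularSingleKnot.existsUniqueUpToPerm_of_existsUniqueOn hp hPL hadm hmono hinc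
        -- Uniqueness holds among all solutions on the interval, in particular among the monotone
        -- ones.
        hQmono (fun u hu => (hQinc u hu).2) ⟨f, ⟨h3, Or.inl h4⟩, h4, fun w hw => h5 w hw.1⟩
  · obtain ⟨θstar, h2, h⟩ := exists_multiplicity_threshold hp
    refine ⟨θstar, h2, fun θ hθ => ?_⟩
    obtain ⟨ℓ₁, ℓ₂, h0, h12, h⟩ := h θ hθ
    refine ⟨ℓ₁, ℓ₂, h0, h12, fun ℓ hℓ => ?_, fun G hPL hℓ hadm => ?_⟩
    · obtain ⟨u, w, hu, hw, hlt⟩ := h ℓ hℓ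
      exact ⟨u, w, hu, hw, fun he => hlt.ne (he ⟨le_rfl, h0.le.trans hℓ.1⟩)⟩
    · obtain ⟨f, g, hf, hg, hlt⟩ := h G.ℓ hℓ
      obtain ⟨u, hu, hue⟩ := RegularSingleKnot.exists_isSolution hp hPL hadm hf.1
      obtain ⟨w, hw, hwe⟩ := RegularSingleKnot.exists_isSolution hp hPL hadm hg.1
      obtain ⟨κ₀⟩ := RegularSingleKnot.exists_coreEdge hPL
      refine ⟨u, w, ⟨hu, fun κ => hf.2.congr (hue κ).symm⟩,
        ⟨hw, fun κ => hg.2.congr (hwe κ).symm⟩, fun he => hlt.ne ?_⟩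
      rw [← hue κ₀ G.zero_mem_Icc, ← hwe κ₀ G.zero_mem_Icc]
      exact he.eqOn_coreRestrict κ₀ G.zero_mem_Icc
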